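/- Let $G$ be a finite group and let $F(G)$ denote its Fitting subgroup, that is, the largest nilpotent normal subgroup of $G$. Let $A$ and $B$ be nilpotent subgroups of $G$ such that $G = AB = \{ab : a \in A,\ b \in B\}$, and suppose that $A$ is subnormal in the subgroup $\langle A, F(G)\rangle$ generated by $A$ and $F(G)$, and that $B$ is subnormal in $\langle B, F(G)\rangle$. Then $G$ is nilpotent. -/

import Mathlib

open scoped Pointwise

/-- The Fitting subgroup of `G`: the subgroup generated by all nilpotent normal subgroups of `G`.
For finite `G` it is itself nilpotent, so it is the largest nilpotent normal subgroup. -/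
def fittingSubgroup (G : Type*) [Group G] : Subgroup G :=
  sSup {N : Subgroup G | N.Normal ∧ Group.IsNilpotent N}

/-- `H` is `R`-subnormal: `H` is subnormal in the join `⟨H, R⟩`. -/
def IsRSubnormal {G : Type*} [Group G] (R H : Subgroup G) : Prop :=
  (H.subgroupOf (H ⊔ R)).IsSubnormal

/-! Write F for the Fitting subgroup of G. Inside ⟨A, F⟩ both A and F are subnormal and nilpotent,
so they lie in the Fitting subgroup of ⟨A, F⟩, and ⟨A, F⟩ is nilpotent; the same holds for B. Hence
p-elements of A and of B centralise the p'-part of F. Since G = AB, a Sylow p-subgroup of G is, up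
to conjugacy, the product of those of A and B (`exists_isSylowIn_forall_exists_mul`), so every
p-element of G centralises the p'-part of F (`commute_of_mem_fittingSubgroup`). If G is solvable,
then F contains its centralizer, and `IsFit.commute` deduces that p-elements and r-elements commute
for p ≠ r, which is nilpotency.

Most of the file proves that G is solvable, the Kegel–Wielandt theorem, by induction on |G|. One may
assume F = 1. If a prime p divides both |A| and |B|, the Sylow subgroup of A permutes with all
conjugates of that of B, and Kegel's maximality argument gives two nontrivial normal subgroups with
trivial intersection (`exists_normal_inf_eq_bot`); both quotients are solvable, hence so is G.

If |A| and |B| are coprime, a counterexample is simple, and by Burnside's theorem on conjugacy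
classes neither factor has prime power order. Fix maximal subgroups M ≥ A and H ≥ B
(`SimpleFactorization`). The Fitting subgroup of M lies in A, so elements of M of coprime prime
power orders dividing |A| commute. The goal is `SimpleFactorization.uniq_zpowers`: a nontrivial
element of A of prime power order lies in no conjugate of M except M. Then A meets its conjugate by
any g outside M trivially, so |A| ≤ |B|; by symmetry the coprime orders are equal, which is absurd.

The main obstruction used throughout is `SimpleFactorization.false_of_isSylowIn`: a proper solvable
subgroup cannot contain Sylow subgroups of G for primes from both factors, because Kegel's lemma
would make them generate G. -/

/-- `x` is a `p`-element: its order is a power of `p`. -/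
def IsPElt {G : Type*} [Group G] (p : ℕ) (x : G) : Prop := ∃ k : ℕ, x ^ p ^ k = 1

/-! ### Elements of prime power order and conjugation of subgroups. -/

section Elements

variable {G : Type*} [Group G]

theorem IsPElt.inv {p : ℕ} {x : G} (h : IsPElt p x) : IsPElt p x⁻¹ := by
  obtain ⟨k, hk⟩ := h
  exact ⟨k, by simp [hk]⟩

theorem IsPElt.map {G' : Type*} [Group G'] {p : ℕ} {x : G} (h : IsPElt p x) (f : G →* G') :
    IsPElt p (f x) := by
  obtain ⟨k, hk⟩ := h
  exact ⟨k, by rw [← map_pow, hk, map_one]⟩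

theorem IsPElt.conj {p : ℕ} {x : G} (h : IsPElt p x) (g : G) : IsPElt p (g * x * g⁻¹) :=
  h.map (MulAut.conj g).toMonoidHom

theorem IsPElt.conj' {p : ℕ} {x : G} (h : IsPElt p x) (g : G) : IsPElt p (g⁻¹ * x * g) := by
  simpa using h.conj g⁻¹

theorem IsPElt.of_mem_zpowers {p : ℕ} {x y : G} (h : IsPElt p x) (hy : y ∈ Subgroup.zpowers x) :
    IsPElt p y := by
  obtain ⟨k, hk⟩ := h
  obtain ⟨n, rfl⟩ := Subgroup.mem_zpowers_iff.1 hy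
  exact ⟨k, by rw [← zpow_natCast, zpow_comm, zpow_natCast, hk, one_zpow]⟩

theorem IsPElt.orderOf_eq {p : ℕ} {x : G} (hp : p.Prime) (h : IsPElt p x) :
    ∃ k, orderOf x = p ^ k := by
  obtain ⟨k, hk⟩ := h
  obtain ⟨m, -, hm⟩ := (Nat.dvd_prime_pow hp).1 (orderOf_dvd_of_pow_eq_one hk)
  exact ⟨m, hm⟩

theorem IsPElt.eq_one_of_pow {p n : ℕ} {x : G} (hx : IsPElt p x) (hn : n.Coprime p)
    (h : x ^ n = 1) : x = 1 := by
  obtain ⟨k, hk⟩ := hx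
  have h1 : orderOf x ∣ n := orderOf_dvd_of_pow_eq_one h
  have h2 : orderOf x ∣ p ^ k := orderOf_dvd_of_pow_eq_one hk
  exact orderOf_eq_one_iff.1 (Nat.eq_one_of_dvd_coprimes (hn.pow_right k) h1 h2)

theorem IsPGroup.isPElt {p : ℕ} {P : Subgroup G} (h : IsPGroup p P) {x : G} (hx : x ∈ P) :
    IsPElt p x := by
  obtain ⟨k, hk⟩ := isPGroup_iff_pow_pow_eq_one.1 h ⟨x, hx⟩
  exact ⟨k, by simpa using congrArg Subtype.val hk⟩

theorem isPGroup_of_isPElt {p : ℕ} {P : Subgroup G} (h : ∀ x ∈ P, IsPElt p x) : IsPGroup p P := by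
  refine isPGroup_iff_pow_pow_eq_one.2 fun x => ?_
  obtain ⟨k, hk⟩ := h x x.2
  exact ⟨k, Subtype.ext (by simpa using hk)⟩

theorem IsPElt.isPGroup_zpowers {p : ℕ} {x : G} (h : IsPElt p x) :
    IsPGroup p (Subgroup.zpowers x) :=
  isPGroup_of_isPElt fun _ hy => h.of_mem_zpowers hy

/-- Induction along coprime factorisations of the order: if x has order ab with a and b coprime,
Bézout writes x as a product of powers of x^a and x^b. -/
theorem mem_of_forall_isPElt_mem_aux [Finite G] (K : Subgroup G) (n : ℕ) : ∀ x : G,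
    orderOf x = n → (∀ p : ℕ, p.Prime → ∀ y ∈ Subgroup.zpowers x, IsPElt p y → y ∈ K) → x ∈ K := by
  induction n using Nat.recOnPosPrimePosCoprime with
  | zero => intro x hx; exact absurd hx (orderOf_pos x).ne'
  | one => intro x hx _; rw [orderOf_eq_one_iff.1 hx]; exact K.one_mem
  | prime_pow p k hp _ =>
    intro x hx h
    exact h p hp x (Subgroup.mem_zpowers x) ⟨k, by rw [← hx, pow_orderOf_eq_one]⟩
  | coprime a b ha hb hab iha ihb =>
    intro x hx h
    have h1 : x ^ a ∈ K := by
      refine ihb _ ?_ fun p hp y hy => h p hp y ?_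
      · rw [orderOf_pow_of_dvd (by omega) (hx ▸ Dvd.intro _ rfl), hx,
          Nat.mul_div_cancel_left _ (by omega)]
      · exact (Subgroup.zpowers_le.2 (Subgroup.npow_mem_zpowers x a)) hy
    have h2 : x ^ b ∈ K := by
      refine iha _ ?_ fun p hp y hy => h p hp y ?_
      · rw [orderOf_pow_of_dvd (by omega) (hx ▸ Dvd.intro_left _ rfl), hx,
          Nat.mul_div_cancel _ (by omega)]
      · exact (Subgroup.zpowers_le.2 (Subgroup.npow_mem_zpowers x b)) hy
    have h3 : (1 : ℤ) = a * a.gcdA b + b * a.gcdB b := by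
      rw [← Nat.gcd_eq_gcd_ab, hab.gcd_eq_one, Nat.cast_one]
    have h4 : x = (x ^ a) ^ (a.gcdA b) * (x ^ b) ^ (a.gcdB b) := by
      rw [← zpow_natCast, ← zpow_natCast, ← zpow_mul, ← zpow_mul, ← zpow_add, ← h3, zpow_one]
    rw [h4]
    exact K.mul_mem (K.zpow_mem h1 _) (K.zpow_mem h2 _)

/-- A subgroup containing all powers of `x` of prime power order contains `x`. -/
theorem mem_of_forall_isPElt_mem [Finite G] {K : Subgroup G} {x : G}
    (h : ∀ p : ℕ, p.Prime → ∀ y ∈ Subgroup.zpowers x, IsPElt p y → y ∈ K) : x ∈ K :=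
  mem_of_forall_isPElt_mem_aux K _ x rfl h

/-- The decomposition of an element into its `p`-part and its `p'`-part. -/
theorem exists_isPElt_mul [Finite G] {p : ℕ} (hp : p.Prime) (x : G) :
    ∃ u ∈ Subgroup.zpowers x, ∃ v ∈ Subgroup.zpowers x,
      x = u * v ∧ IsPElt p u ∧ (orderOf v).Coprime p := by
  obtain ⟨k, m, hm, hx⟩ := Nat.exists_eq_pow_mul_and_not_dvd (orderOf_pos x).ne' p hp.ne_one
  have hc : (p ^ k).Coprime m := ((Nat.Prime.coprime_iff_not_dvd hp).2 hm).pow_left k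
  have h3 : (1 : ℤ) = (p ^ k : ℕ) * (p ^ k).gcdA m + m * (p ^ k).gcdB m := by
    rw [← Nat.gcd_eq_gcd_ab, hc.gcd_eq_one, Nat.cast_one]
  refine ⟨x ^ ((m : ℤ) * (p ^ k).gcdB m), ⟨_, rfl⟩, x ^ (((p ^ k : ℕ) : ℤ) * (p ^ k).gcdA m),
    ⟨_, rfl⟩, ?_, ⟨k, ?_⟩, ?_⟩
  · rw [← zpow_add, add_comm, ← h3, zpow_one]
  · have : ((m : ℤ) * (p ^ k).gcdB m) * ((p ^ k : ℕ) : ℤ) = (orderOf x : ℤ) * (p ^ k).gcdB m := by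
      rw [hx]; push_cast; ring
    rw [← zpow_natCast, ← zpow_mul, this, zpow_mul, zpow_natCast, pow_orderOf_eq_one, one_zpow]
  · have h1 : orderOf (x ^ (((p ^ k : ℕ) : ℤ) * (p ^ k).gcdA m)) ∣ m := by
      apply orderOf_dvd_of_pow_eq_one
      have : (((p ^ k : ℕ) : ℤ) * (p ^ k).gcdA m) * (m : ℤ) = (orderOf x : ℤ) * (p ^ k).gcdA m := by
        rw [hx]; push_cast; ring
      rw [← zpow_natCast, ← zpow_mul, this, zpow_mul, zpow_natCast, pow_orderOf_eq_one, one_zpow]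
    exact Nat.Coprime.coprime_dvd_left h1 ((Nat.Prime.coprime_iff_not_dvd hp).2 hm).symm

theorem mem_conj_smul {g x : G} {H : Subgroup G} :
    x ∈ MulAut.conj g • H ↔ g⁻¹ * x * g ∈ H := by
  rw [Subgroup.mem_pointwise_smul_iff_inv_smul_mem, ← map_inv]
  simp [MulAut.smul_def]

theorem conj_smul_le_iff {g : G} {H K : Subgroup G} :
    MulAut.conj g • H ≤ K ↔ ∀ x ∈ H, g * x * g⁻¹ ∈ K := by
  constructor
  · intro h x hx
    exact h (mem_conj_smul.2 (by simpa [mul_assoc] using hx))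
  · intro h x hx
    simpa [mul_assoc] using h _ (mem_conj_smul.1 hx)

theorem conj_mul_smul (g h : G) (H : Subgroup G) :
    MulAut.conj (g * h) • H = MulAut.conj g • MulAut.conj h • H := by
  rw [map_mul, mul_smul]

theorem conj_inv_smul_conj_smul (g : G) (H : Subgroup G) :
    MulAut.conj g⁻¹ • MulAut.conj g • H = H := by
  rw [← conj_mul_smul]; simp

theorem conj_smul_conj_inv_smul (g : G) (H : Subgroup G) :
    MulAut.conj g • MulAut.conj g⁻¹ • H = H := by
  rw [← conj_mul_smul]; simp

theorem conj_smul_le_conj_smul {g : G} {H K : Subgroup G} (h : H ≤ K) :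
    MulAut.conj g • H ≤ MulAut.conj g • K :=
  Subgroup.pointwise_smul_le_pointwise_smul_iff.2 h

theorem conj_smul_mem_self {g : G} {H : Subgroup G} (h : g ∈ H) : MulAut.conj g • H = H :=
  Subgroup.conj_smul_eq_self_of_mem h

theorem card_conj_smul (g : G) (H : Subgroup G) :
    Nat.card (MulAut.conj g • H : Subgroup G) = Nat.card H :=
  (Nat.card_congr (Subgroup.equivSMul (MulAut.conj g) H).toEquiv).symm

theorem conj_smul_eq_of_le [Finite G] {g : G} {H : Subgroup G} (h : MulAut.conj g • H ≤ H) :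
    MulAut.conj g • H = H :=
  Subgroup.eq_of_le_of_card_ge h (card_conj_smul g H).ge

theorem conj_smul_eq_iff_mem_normalizer {g : G} {H : Subgroup G} :
    MulAut.conj g • H = H ↔ g ∈ Subgroup.normalizer (H : Set G) := by
  rw [Subgroup.mem_normalizer_iff]
  constructor
  · intro h x
    have := mem_conj_smul (g := g) (x := g * x * g⁻¹) (H := H)
    rw [h] at this
    simpa [mul_assoc] using this.symm
  · intro h
    ext x
    rw [mem_conj_smul]
    have := h (g⁻¹ * x * g)
    simpa [mul_assoc] using this

theorem mem_normalizer_of_conj_mem [Finite G] {g : G} {H : Subgroup G}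
    (h : ∀ x ∈ H, g * x * g⁻¹ ∈ H) : g ∈ Subgroup.normalizer (H : Set G) :=
  conj_smul_eq_iff_mem_normalizer.1 (conj_smul_eq_of_le (conj_smul_le_iff.2 h))

theorem conj_mem_of_mem_normalizer {g x : G} {H : Subgroup G}
    (hg : g ∈ Subgroup.normalizer (H : Set G)) (hx : x ∈ H) : g * x * g⁻¹ ∈ H :=
  (Subgroup.mem_normalizer_iff.1 hg x).1 hx

theorem IsPGroup.conj_smul {p : ℕ} {P : Subgroup G} (h : IsPGroup p P) (g : G) :
    IsPGroup p (MulAut.conj g • P : Subgroup G) :=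
  h.of_equiv (Subgroup.equivSMul (MulAut.conj g) P)

theorem Group.IsNilpotent.conj_smul {A : Subgroup G} (h : Group.IsNilpotent A) (g : G) :
    Group.IsNilpotent (MulAut.conj g • A : Subgroup G) :=
  have := h
  Group.nilpotent_of_mulEquiv (Subgroup.equivSMul (MulAut.conj g) A)

theorem Group.IsNilpotent.mono {A B : Subgroup G} (h : Group.IsNilpotent B) (hAB : A ≤ B) :
    Group.IsNilpotent A :=
  have := h
  Group.nilpotent_of_mulEquiv (Subgroup.subgroupOfEquivOfLe hAB)

end Elements

/-! ### Sylow theory relative to a subgroup, and indices in factorised groups. -/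

section SylowIn

variable {G : Type*} [Group G]

/-- `Q` is a Sylow `p`-subgroup of the subgroup `K`. -/
structure IsSylowIn (p : ℕ) (Q K : Subgroup G) : Prop where
  le : Q ≤ K
  isPGroup : IsPGroup p Q
  not_dvd : ¬ p ∣ Q.relIndex K

theorem isPGroup_subgroupOf {p : ℕ} {Q : Subgroup G} (h : IsPGroup p Q) (K : Subgroup G) :
    IsPGroup p (Q.subgroupOf K) :=
  h.comap_of_injective K.subtype K.subtype_injective

/-- A relative Sylow subgroup, as a term of Mathlib's type of Sylow subgroups. -/
def IsSylowIn.toSylow {p : ℕ} (hp : p.Prime) {Q K : Subgroup G} (h : IsSylowIn p Q K) :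
    Sylow p K :=
  have : Fact p.Prime := ⟨hp⟩
  (isPGroup_subgroupOf h.isPGroup K).toSylow h.not_dvd

theorem IsSylowIn.coe_toSylow {p : ℕ} (hp : p.Prime) {Q K : Subgroup G} (h : IsSylowIn p Q K) :
    (h.toSylow hp : Subgroup K) = Q.subgroupOf K := rfl

theorem Sylow.isSylowIn_map [Finite G] {p : ℕ} (hp : p.Prime) {K : Subgroup G} (P : Sylow p K) :
    IsSylowIn p ((P : Subgroup K).map K.subtype) K := by
  have : Fact p.Prime := ⟨hp⟩
  refine ⟨Subgroup.map_subtype_le _, P.isPGroup'.map _, ?_⟩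
  have : ((P : Subgroup K).map K.subtype).subgroupOf K = P :=
    Subgroup.comap_map_eq_self_of_injective K.subtype_injective _
  rw [Subgroup.relIndex, this]
  exact P.not_dvd_index

theorem exists_isSylowIn_ge [Finite G] {p : ℕ} (hp : p.Prime) {P K : Subgroup G}
    (hP : IsPGroup p P) (hPK : P ≤ K) : ∃ Q, P ≤ Q ∧ IsSylowIn p Q K := by
  obtain ⟨Q, hQ⟩ := (isPGroup_subgroupOf hP K).exists_le_sylow
  refine ⟨_, ?_, Q.isSylowIn_map hp⟩
  intro x hx
  exact ⟨⟨x, hPK hx⟩, hQ hx, rfl⟩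

theorem exists_isSylowIn [Finite G] {p : ℕ} (hp : p.Prime) (K : Subgroup G) :
    ∃ Q, IsSylowIn p Q K := by
  obtain ⟨Q, -, h⟩ := exists_isSylowIn_ge hp (IsPGroup.of_bot (G := G)) (bot_le (a := K))
  exact ⟨Q, h⟩

theorem IsSylowIn.exists_le_conj [Finite G] {p : ℕ} (hp : p.Prime) {P Q K : Subgroup G}
    (hQ : IsSylowIn p Q K) (hP : IsPGroup p P) (hPK : P ≤ K) :
    ∃ k ∈ K, P ≤ MulAut.conj k • Q := by
  have : Fact p.Prime := ⟨hp⟩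
  obtain ⟨R, hR⟩ := (isPGroup_subgroupOf hP K).exists_le_sylow
  obtain ⟨k, hk⟩ := MulAction.exists_smul_eq K (hQ.toSylow hp) R
  refine ⟨k, k.2, fun x hx => ?_⟩
  have h1 : (⟨x, hPK hx⟩ : K) ∈ (k • hQ.toSylow hp : Sylow p K) := by
    rw [hk]; exact hR hx
  have h2 : (⟨x, hPK hx⟩ : K) ∈ MulAut.conj k • (Q.subgroupOf K) := h1
  rw [mem_conj_smul] at h2 ⊢
  exact h2

theorem IsSylowIn.card_le [Finite G] {p : ℕ} (hp : p.Prime) {P Q K : Subgroup G}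
    (hQ : IsSylowIn p Q K) (hP : IsPGroup p P) (hPK : P ≤ K) : Nat.card P ≤ Nat.card Q := by
  obtain ⟨k, -, hk⟩ := hQ.exists_le_conj hp hP hPK
  rw [← card_conj_smul k Q]
  exact Nat.card_le_card_of_injective _ (Subgroup.inclusion_injective hk)

theorem IsSylowIn.exists_eq_conj [Finite G] {p : ℕ} (hp : p.Prime) {P Q K : Subgroup G}
    (hQ : IsSylowIn p Q K) (hP : IsSylowIn p P K) : ∃ k ∈ K, P = MulAut.conj k • Q := by
  obtain ⟨k, hkK, hk⟩ := hQ.exists_le_conj hp hP.isPGroup hP.le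
  refine ⟨k, hkK, Subgroup.eq_of_le_of_card_ge hk ?_⟩
  rw [card_conj_smul]
  exact hP.card_le hp hQ.isPGroup hQ.le

theorem IsSylowIn.mono {p : ℕ} {Q K K' : Subgroup G} (h : IsSylowIn p Q K) (hQ : Q ≤ K')
    (hK : K' ≤ K) : IsSylowIn p Q K' :=
  ⟨hQ, h.isPGroup, fun hd => h.not_dvd
    (Subgroup.relIndex_mul_relIndex Q K' K hQ hK ▸ hd.mul_right _)⟩

theorem IsSylowIn.trans {p : ℕ} (hp : p.Prime) {Q K L : Subgroup G} (h : IsSylowIn p Q K)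
    (hKL : K ≤ L) (hd : ¬ p ∣ K.relIndex L) : IsSylowIn p Q L :=
  ⟨h.le.trans hKL, h.isPGroup, fun h' => by
    rw [← Subgroup.relIndex_mul_relIndex Q K L h.le hKL] at h'
    exact (hp.dvd_mul.1 h').elim h.not_dvd hd⟩

theorem IsSylowIn.not_dvd_of_le {p : ℕ} {Q K L : Subgroup G} (h : IsSylowIn p Q L) (hQ : Q ≤ K) :
    ¬ p ∣ K.relIndex L := fun hd =>
  h.not_dvd (hd.trans (Subgroup.relIndex_dvd_of_le_left L hQ))

theorem relIndex_conj_smul (g : G) (H K : Subgroup G) :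
    (MulAut.conj g • H).relIndex (MulAut.conj g • K) = H.relIndex K :=
  Subgroup.relIndex_pointwise_smul _ _ _

theorem IsSylowIn.conj_smul {p : ℕ} {Q K : Subgroup G} (h : IsSylowIn p Q K) (g : G) :
    IsSylowIn p (MulAut.conj g • Q) (MulAut.conj g • K) :=
  ⟨conj_smul_le_conj_smul h.le, h.isPGroup.conj_smul g, by
    rw [relIndex_conj_smul]; exact h.not_dvd⟩

theorem IsSylowIn.conj_smul_of_mem {p : ℕ} {Q K : Subgroup G} (h : IsSylowIn p Q K) {g : G}
    (hg : g ∈ K) : IsSylowIn p (MulAut.conj g • Q) K := by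
  simpa only [conj_smul_mem_self hg] using h.conj_smul g

/-- A `p`-subgroup normalised by `K` lies in every Sylow `p`-subgroup of `K`. -/
theorem IsSylowIn.le_of_conj_mem [Finite G] {p : ℕ} (hp : p.Prime) {Y Q K : Subgroup G}
    (hQ : IsSylowIn p Q K) (hY : IsPGroup p Y) (hYK : Y ≤ K)
    (hn : ∀ k ∈ K, ∀ y ∈ Y, k * y * k⁻¹ ∈ Y) : Y ≤ Q := by
  obtain ⟨k, hk, h⟩ := hQ.exists_le_conj hp hY hYK
  intro y hy
  have := mem_conj_smul.1 (h (hn k hk y hy))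
  simpa [mul_assoc] using this

theorem IsSylowIn.exists_conj_mem [Finite G] {p : ℕ} (hp : p.Prime) {Q K : Subgroup G}
    (hQ : IsSylowIn p Q K) {x : G} (hx : IsPElt p x) (hxK : x ∈ K) :
    ∃ k ∈ K, k⁻¹ * x * k ∈ Q := by
  obtain ⟨k, hk, h⟩ := hQ.exists_le_conj hp hx.isPGroup_zpowers (Subgroup.zpowers_le.2 hxK)
  exact ⟨k, hk, mem_conj_smul.1 (h (Subgroup.mem_zpowers x))⟩

/-- A subgroup containing a Sylow subgroup for every prime is the whole group. -/
theorem eq_of_forall_not_dvd_relIndex {K L : Subgroup G} (hKL : K ≤ L)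
    (h : ∀ p : ℕ, p.Prime → ¬ p ∣ K.relIndex L) : K = L := by
  refine le_antisymm hKL (Subgroup.relIndex_eq_one.1 ?_)
  by_contra h1
  obtain ⟨p, hp, hd⟩ := Nat.exists_prime_and_dvd h1
  exact h p hp hd

/-- The relative index of a factor in a factorised subgroup. -/
theorem relIndex_of_forall_exists_mul {X Y K : Subgroup G} (hX : X ≤ K)
    (h : ∀ k ∈ K, ∃ x ∈ X, ∃ y ∈ Y, k = x * y) : Y.relIndex K = Y.relIndex X := by
  refine (Nat.card_congr (Equiv.ofBijective (Subgroup.quotientSubgroupOfEmbeddingOfLE Y hX)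
    ⟨(Subgroup.quotientSubgroupOfEmbeddingOfLE Y hX).injective, ?_⟩)).symm
  intro q
  obtain ⟨⟨k, hk⟩, rfl⟩ := QuotientGroup.mk_surjective q
  obtain ⟨x, hx, y, hy, rfl⟩ := h k hk
  refine ⟨QuotientGroup.mk ⟨x, hx⟩, ?_⟩
  rw [Subgroup.quotientSubgroupOfEmbeddingOfLE_apply_mk]
  refine QuotientGroup.eq.2 ?_
  rw [Subgroup.mem_subgroupOf]
  simpa using hy

theorem relIndex_of_forall_exists_mul' {X Y K : Subgroup G} (hY : Y ≤ K)
    (h : ∀ k ∈ K, ∃ x ∈ X, ∃ y ∈ Y, k = x * y) : X.relIndex K = X.relIndex Y := by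
  refine relIndex_of_forall_exists_mul hY fun k hk => ?_
  obtain ⟨x, hx, y, hy, hxy⟩ := h k⁻¹ (K.inv_mem hk)
  exact ⟨y⁻¹, Y.inv_mem hy, x⁻¹, X.inv_mem hx, by rw [← mul_inv_rev, ← hxy, inv_inv]⟩

theorem card_mul_relIndex {H K : Subgroup G} (h : H ≤ K) :
    Nat.card H * H.relIndex K = Nat.card K := by
  have := Subgroup.relIndex_mul_relIndex ⊥ H K bot_le h
  simpa using this

end SylowIn

/-! ### Finite nilpotent groups through commuting elements of coprime orders. -/

section Nilpotent

variable {G : Type*} [Group G]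

theorem Group.IsNilpotent.commute_of_isPElt [Finite G] {A : Subgroup G} (hA : Group.IsNilpotent A)
    {p r : ℕ} (hp : p.Prime) (hr : r.Prime) (hpr : p ≠ r) {x y : G} (hxA : x ∈ A) (hyA : y ∈ A)
    (hx : IsPElt p x) (hy : IsPElt r y) : Commute x y := by
  have : Fact p.Prime := ⟨hp⟩
  have : Fact r.Prime := ⟨hr⟩
  obtain ⟨P, hP⟩ := (isPGroup_subgroupOf hx.isPGroup_zpowers A).exists_le_sylow
  obtain ⟨R, hR⟩ := (isPGroup_subgroupOf hy.isPGroup_zpowers A).exists_le_sylow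
  have hd : Disjoint (P : Subgroup A) R := IsPGroup.disjoint_of_ne p r hpr _ _ P.isPGroup' R.isPGroup'
  have h := Subgroup.commute_of_normal_of_disjoint (P : Subgroup A) R inferInstance inferInstance hd
    ⟨x, hxA⟩ ⟨y, hyA⟩ (hP (Subgroup.mem_zpowers x)) (hR (Subgroup.mem_zpowers y))
  exact congrArg Subtype.val h

theorem commute_of_forall_isPElt [Finite G] {x y : G}
    (h : ∀ p r : ℕ, p.Prime → r.Prime → ∀ x' ∈ Subgroup.zpowers x, ∀ y' ∈ Subgroup.zpowers y,
      IsPElt p x' → IsPElt r y' → Commute x' y') : Commute x y := by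
  have h1 : y ∈ Subgroup.centralizer {x} := by
    refine mem_of_forall_isPElt_mem fun r hr y' hy' hy'r => ?_
    have h2 : x ∈ Subgroup.centralizer {y'} := by
      refine mem_of_forall_isPElt_mem fun p hp x' hx' hx'p => ?_
      rw [Subgroup.mem_centralizer_singleton_iff]
      exact h p r hp hr x' hx' y' hy' hx'p hy'r
    rw [Subgroup.mem_centralizer_singleton_iff] at h2 ⊢
    exact h2.symm
  rw [Subgroup.mem_centralizer_singleton_iff] at h1
  exact h1.symm

/-- The subgroup generated by the `p`-elements of `A`. -/
def pPart (A : Subgroup G) (p : ℕ) : Subgroup G := Subgroup.closure {x | x ∈ A ∧ IsPElt p x}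

theorem mem_pPart_of_mem {A : Subgroup G} {p : ℕ} {x : G} (hx : x ∈ A) (hp : IsPElt p x) :
    x ∈ pPart A p := Subgroup.subset_closure ⟨hx, hp⟩

theorem pPart_le (A : Subgroup G) (p : ℕ) : pPart A p ≤ A :=
  (Subgroup.closure_le _).2 fun _ h => h.1

theorem conj_mem_pPart {A : Subgroup G} {p : ℕ} {g : G} (hg : ∀ a ∈ A, g * a * g⁻¹ ∈ A) {x : G}
    (hx : x ∈ pPart A p) : g * x * g⁻¹ ∈ pPart A p := by
  have : pPart A p ≤ (pPart A p).comap (MulAut.conj g).toMonoidHom :=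
    (Subgroup.closure_le _).2 fun y hy => mem_pPart_of_mem (hg y hy.1) (hy.2.conj g)
  exact this hx

theorem centralizer_pPart {A : Subgroup G} {p : ℕ} {g : G}
    (h : ∀ a ∈ A, IsPElt p a → Commute g a) {x : G} (hx : x ∈ pPart A p) : Commute g x := by
  have : pPart A p ≤ Subgroup.centralizer {g} :=
    (Subgroup.closure_le _).2 fun y hy =>
      Subgroup.mem_centralizer_singleton_iff.2 (h y hy.1 hy.2).symm
  exact (Subgroup.mem_centralizer_singleton_iff.1 (this hx)).symm

/-- A Sylow p-subgroup of a nilpotent group is normal, so it contains every p-element. -/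
theorem Group.IsNilpotent.isSylowIn_pPart [Finite G] {A : Subgroup G} (hA : Group.IsNilpotent A)
    {p : ℕ} (hp : p.Prime) : IsSylowIn p (pPart A p) A := by
  have : Fact p.Prime := ⟨hp⟩
  obtain ⟨Q, hQ⟩ := exists_isSylowIn hp A
  suffices h : pPart A p = Q by rwa [h]
  refine le_antisymm ((Subgroup.closure_le _).2 fun x hx => ?_) fun x hx =>
    mem_pPart_of_mem (hQ.le hx) (hQ.isPGroup.isPElt hx)
  obtain ⟨k, hk, h⟩ := hQ.exists_conj_mem hp hx.2 hx.1
  have hn : (hQ.toSylow hp : Subgroup A).Normal := inferInstance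
  have h2 := hn.conj_mem ⟨k⁻¹ * x * k, hQ.le h⟩ h ⟨k, hk⟩
  rw [IsSylowIn.coe_toSylow, Subgroup.mem_subgroupOf] at h2
  simpa [mul_assoc] using h2

theorem Group.IsNilpotent.isPGroup_pPart [Finite G] {A : Subgroup G} (hA : Group.IsNilpotent A)
    {p : ℕ} (hp : p.Prime) : IsPGroup p (pPart A p) := (hA.isSylowIn_pPart hp).isPGroup

theorem Group.IsNilpotent.mem_pPart_iff [Finite G] {A : Subgroup G} (hA : Group.IsNilpotent A)
    {p : ℕ} (hp : p.Prime) {x : G} : x ∈ pPart A p ↔ x ∈ A ∧ IsPElt p x :=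
  ⟨fun h => ⟨pPart_le A p h, (hA.isPGroup_pPart hp).isPElt h⟩, fun h => mem_pPart_of_mem h.1 h.2⟩

theorem le_of_forall_pPart_le [Finite G] {A K : Subgroup G}
    (h : ∀ p : ℕ, p.Prime → pPart A p ≤ K) : A ≤ K := fun _ hx =>
  mem_of_forall_isPElt_mem fun p hp _ hy hyp =>
    h p hp (mem_pPart_of_mem (Subgroup.zpowers_le.2 hx hy) hyp)

theorem pPart_eq_bot_of_not_dvd [Finite G] {A : Subgroup G} {p : ℕ} (hp : p.Prime)
    (h : ¬ p ∣ Nat.card A) : pPart A p = ⊥ := by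
  refine le_bot_iff.1 ((Subgroup.closure_le _).2 fun x hx => ?_)
  obtain ⟨k, hk⟩ := hx.2.orderOf_eq hp
  rcases Nat.eq_zero_or_pos k with rfl | hk0
  · exact Subgroup.mem_bot.2 (orderOf_eq_one_iff.1 (by simpa using hk))
  · exact absurd (((dvd_pow_self p hk0.ne').trans hk.symm.dvd).trans
      (Subgroup.orderOf_dvd_natCard A hx.1)) h

theorem pPart_ne_bot [Finite G] {A : Subgroup G} {p : ℕ} (hp : p.Prime)
    (h : p ∣ Nat.card A) : pPart A p ≠ ⊥ := by
  have : Fact p.Prime := ⟨hp⟩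
  obtain ⟨x, hx⟩ := exists_prime_orderOf_dvd_card' (G := A) p h
  intro h0
  have h1 : (x : G) ∈ pPart A p :=
    mem_pPart_of_mem x.2 ⟨1, by rw [pow_one, ← hx, ← Subgroup.orderOf_coe, pow_orderOf_eq_one]⟩
  rw [h0, Subgroup.mem_bot] at h1
  rw [← Subgroup.orderOf_coe, h1, orderOf_one] at hx
  exact hp.one_lt.ne hx

theorem Group.IsNilpotent.commute_pPart [Finite G] {A : Subgroup G} (hA : Group.IsNilpotent A)
    {p r : ℕ} (hp : p.Prime) (hr : r.Prime) (hpr : p ≠ r) {x y : G} (hx : x ∈ pPart A p)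
    (hy : y ∈ pPart A r) : Commute x y := by
  rw [hA.mem_pPart_iff hp] at hx
  rw [hA.mem_pPart_iff hr] at hy
  exact hA.commute_of_isPElt hp hr hpr hx.1 hy.1 hx.2 hy.2

/-- A finite group in which elements of coprime prime power orders commute is nilpotent. -/
theorem isNilpotent_of_forall_commute [Finite G] {A : Subgroup G}
    (h : ∀ p r : ℕ, p.Prime → r.Prime → p ≠ r → ∀ x ∈ A, ∀ y ∈ A, IsPElt p x → IsPElt r y →
      Commute x y) : Group.IsNilpotent A := by
  refine (Group.isNilpotent_of_finite_tfae.out 0 3 rfl rfl).2 fun p hp P => ?_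
  have hP := P.isSylowIn_map hp.out
  set Q := (P : Subgroup A).map A.subtype
  -- The normaliser of Q in A contains Q and, for each r ≠ p, a Sylow r-subgroup of A, which
  -- centralises Q; so its index has no prime divisor.
  have key : A ⊓ Subgroup.normalizer (Q : Set G) = A := by
    refine eq_of_forall_not_dvd_relIndex inf_le_left fun r hr => ?_
    rcases eq_or_ne r p with rfl | hrp
    · exact hP.not_dvd_of_le (le_inf hP.le Subgroup.le_normalizer)
    · obtain ⟨R, hR⟩ := exists_isSylowIn hr A
      refine hR.not_dvd_of_le (le_inf hR.le fun y hy => mem_normalizer_of_conj_mem fun x hx => ?_)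
      have := h p r hp.out hr hrp.symm x (hP.le hx) y (hR.le hy) (hP.isPGroup.isPElt hx)
        (hR.isPGroup.isPElt hy)
      rw [this.symm.eq]
      simpa using hx
  refine ⟨fun x hx g => ?_⟩
  have hg : (g : G) ∈ Subgroup.normalizer (Q : Set G) := (key.symm ▸ g.2 : (g : G) ∈ A ⊓ _).2
  obtain ⟨y, hy, hyx⟩ := conj_mem_of_mem_normalizer hg (⟨x, hx, rfl⟩ : (x : G) ∈ Q)
  have : g * x * g⁻¹ = y := Subtype.ext hyx.symm
  rwa [this]

theorem IsPGroup.isNilpotent_subgroup [Finite G] {p : ℕ} (hp : p.Prime) {P : Subgroup G}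
    (h : IsPGroup p P) : Group.IsNilpotent P :=
  have : Fact p.Prime := ⟨hp⟩
  h.isNilpotent

/-- Proper subgroups of a nilpotent subgroup grow under taking normalisers. -/
theorem Group.IsNilpotent.lt_inf_normalizer [Finite G] {A D : Subgroup G}
    (hA : Group.IsNilpotent A) (hD : D < A) : D < A ⊓ Subgroup.normalizer (D : Set G) := by
  refine lt_of_le_of_ne (le_inf hD.le Subgroup.le_normalizer) fun he => ?_
  have hlt : D.subgroupOf A < ⊤ :=
    lt_top_iff_ne_top.2 fun h => hD.not_ge (Subgroup.subgroupOf_eq_top.1 h)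
  refine (normalizerCondition_of_isNilpotent (G := A) _ hlt).not_ge fun x hx => ?_
  rw [Subgroup.mem_subgroupOf, he]
  refine ⟨x.2, mem_normalizer_of_conj_mem fun d hd => ?_⟩
  exact (Subgroup.mem_normalizer_iff.1 hx ⟨d, hD.le hd⟩).1 hd

end Nilpotent

/-! ### The Fitting subgroup, its centralizer in solvable groups, and subnormal subgroups. -/

section Fitting

variable {G : Type*} [Group G]

instance pPart_normal (N : Subgroup G) [hN : N.Normal] (p : ℕ) : (pPart N p).Normal :=
  ⟨fun _ hx g => conj_mem_pPart (fun a ha => hN.conj_mem a ha g) hx⟩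

theorem IsSylowIn.mem_of_normal [Finite G] {p : ℕ} (hp : p.Prime) {P K : Subgroup G}
    (h : IsSylowIn p P K) [hP : P.Normal] {x : G} (hxK : x ∈ K) (hx : IsPElt p x) : x ∈ P := by
  obtain ⟨k, -, hk⟩ := h.exists_conj_mem hp hx hxK
  simpa [mul_assoc] using hP.conj_mem _ hk k

/-- **Fitting's theorem** for finite groups. -/
theorem isNilpotent_sup_of_normal [Finite G] {M N : Subgroup G} [M.Normal] [N.Normal]
    (hM : Group.IsNilpotent M) (hN : Group.IsNilpotent N) :
    Group.IsNilpotent (M ⊔ N : Subgroup G) := by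
  -- The product of the p-parts is a normal p-subgroup; its index in MN is prime to p, as seen by
  -- adjoining M first and then N.
  have key : ∀ p : ℕ, p.Prime → IsSylowIn p (pPart M p ⊔ pPart N p) (M ⊔ N) := by
    intro p hp
    have : Fact p.Prime := ⟨hp⟩
    have hle : pPart M p ⊔ pPart N p ≤ M ⊔ N := sup_le_sup (pPart_le M p) (pPart_le N p)
    refine ⟨hle, (hM.isPGroup_pPart hp).to_sup_of_normal_left (hN.isPGroup_pPart hp), ?_⟩
    have h1 : (pPart M p ⊔ pPart N p).relIndex ((pPart M p ⊔ pPart N p) ⊔ M) =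
        (pPart M p ⊔ pPart N p).relIndex M := Subgroup.relIndex_sup_left _ _
    have h2 : ((pPart M p ⊔ pPart N p) ⊔ M).relIndex (((pPart M p ⊔ pPart N p) ⊔ M) ⊔ N) =
        ((pPart M p ⊔ pPart N p) ⊔ M).relIndex N := Subgroup.relIndex_sup_left _ _
    have h3 : ((pPart M p ⊔ pPart N p) ⊔ M) ⊔ N = M ⊔ N := by
      rw [sup_assoc, sup_eq_right.2 hle]
    rw [← h3, ← Subgroup.relIndex_mul_relIndex (pPart M p ⊔ pPart N p) _ _ le_sup_left le_sup_left,
      h1, h2, hp.dvd_mul, not_or]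
    exact ⟨(hM.isSylowIn_pPart hp).not_dvd_of_le le_sup_left,
      (hN.isSylowIn_pPart hp).not_dvd_of_le (le_sup_right.trans le_sup_left)⟩
  refine isNilpotent_of_forall_commute fun p r hp hr hpr x hx y hy hxp hyr => ?_
  have : Fact p.Prime := ⟨hp⟩
  have : Fact r.Prime := ⟨hr⟩
  exact Subgroup.commute_of_normal_of_disjoint _ _ inferInstance inferInstance
    (IsPGroup.disjoint_of_ne p r hpr _ _ (key p hp).isPGroup (key r hr).isPGroup) x y
    ((key p hp).mem_of_normal hp hx hxp) ((key r hr).mem_of_normal hr hy hyr)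

instance fittingSubgroup_normal : (fittingSubgroup G).Normal :=
  Subgroup.sSup_normal _ fun _ h => h.1

theorem le_fittingSubgroup {N : Subgroup G} (h : N.Normal) (hN : Group.IsNilpotent N) :
    N ≤ fittingSubgroup G := le_sSup ⟨h, hN⟩

/-- By Fitting's theorem a maximal nilpotent normal subgroup absorbs all the others. -/
theorem isNilpotent_fittingSubgroup [Finite G] : Group.IsNilpotent (fittingSubgroup G) := by
  obtain ⟨N, ⟨hN, hNn⟩, hmax⟩ := (Set.toFinite {N : Subgroup G | N.Normal ∧ Group.IsNilpotent N}
    ).exists_maximal ⟨⊥, inferInstance, inferInstance⟩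
  suffices h : fittingSubgroup G ≤ N from hNn.mono h
  refine sSup_le fun K hK => ?_
  have := hK.1
  exact le_sup_right.trans
    (hmax ⟨inferInstance, isNilpotent_sup_of_normal hNn hK.2⟩ (le_sup_left (b := K)))

instance fittingSubgroup_characteristic : (fittingSubgroup G).Characteristic := by
  refine Subgroup.characteristic_iff_map_le.2 fun φ => ?_
  rw [Subgroup.map_le_iff_le_comap]
  refine sSup_le fun N hN => ?_
  rw [← Subgroup.map_le_iff_le_comap]
  have := hN.1
  have := hN.2
  exact le_fittingSubgroup (hN.1.map _ φ.surjective)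
    (Group.nilpotent_of_mulEquiv (φ.subgroupMap N))

/-- In a finite solvable group the Fitting subgroup contains its centralizer. -/
theorem centralizer_fittingSubgroup_le [Finite G] [Group.IsSolvable G] :
    Subgroup.centralizer (fittingSubgroup G : Set G) ≤ fittingSubgroup G := by
  set F := fittingSubgroup G
  set C := Subgroup.centralizer (F : Set G) with hC
  obtain ⟨n, hn⟩ := (Group.isSolvable_def G).1 inferInstance
  -- Climb the derived series from its trivial end. The derived subgroup of L = C ∩ G⁽ᵐ⁾ lies in F
  -- by the previous stage, so C centralises it; L is then nilpotent and normal, hence inside F.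
  have key : ∀ m ≤ n, C ⊓ derivedSeries G m ≤ F := by
    intro m hm
    induction hm using Nat.decreasingInduction with
    | self => rw [hn]; simp
    | of_succ m _ ih =>
      refine le_fittingSubgroup inferInstance ?_
      set L := C ⊓ derivedSeries G m
      have hL : ⁅L, L⁆ ≤ F := by
        refine le_trans (le_inf ?_ ?_) ih
        · exact (Subgroup.commutator_le_left L L).trans inf_le_left
        · rw [derivedSeries_succ]
          exact Subgroup.commutator_mono inf_le_right inf_le_right
      refine Subgroup.isNilpotent_of_ker_le_center (Abelianization.of (G := L)) ?_
      rw [Abelianization.ker_of]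
      intro x hx
      rw [Subgroup.mem_center_iff]
      intro y
      have hxF : (x : G) ∈ F := by
        apply hL
        rw [← Subgroup.map_subtype_commutator]
        exact ⟨x, hx, rfl⟩
      exact Subtype.ext ((Subgroup.mem_centralizer_iff.1 y.2.1 x hxF).symm)
  simpa using key 0 (Nat.zero_le n)

/-- `F` is a nilpotent normal self-centralizing subgroup of `M`. -/
structure IsFit (F M : Subgroup G) : Prop where
  le : F ≤ M
  isNilpotent : Group.IsNilpotent F
  conj_mem : ∀ m ∈ M, ∀ f ∈ F, m * f * m⁻¹ ∈ F
  mem_of_commute : ∀ x ∈ M, (∀ f ∈ F, Commute x f) → x ∈ F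

theorem exists_isFit [Finite G] (M : Subgroup G) [hM : Group.IsSolvable M] : ∃ F, IsFit F M := by
  refine ⟨(fittingSubgroup M).map M.subtype, Subgroup.map_subtype_le _, ?_, ?_, ?_⟩
  · have := isNilpotent_fittingSubgroup (G := M)
    exact Group.nilpotent_of_mulEquiv
      ((fittingSubgroup M).equivMapOfInjective _ M.subtype_injective)
  · rintro m hm _ ⟨f, hf, rfl⟩
    exact ⟨_, (fittingSubgroup_normal (G := M)).conj_mem f hf ⟨m, hm⟩, rfl⟩
  · intro x hx h
    refine ⟨⟨x, hx⟩, centralizer_fittingSubgroup_le (Subgroup.mem_centralizer_iff.2 ?_), rfl⟩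
    intro f hf
    exact Subtype.ext (h f ⟨f, hf, rfl⟩).symm.eq

theorem isFit_fittingSubgroup [Finite G] [Group.IsSolvable G] : IsFit (fittingSubgroup G) ⊤ :=
  ⟨le_top, isNilpotent_fittingSubgroup, fun m _ f hf => fittingSubgroup_normal.conj_mem f hf m,
    fun _ _ h => centralizer_fittingSubgroup_le
      (Subgroup.mem_centralizer_iff.2 fun f hf => (h f hf).symm.eq)⟩

theorem IsFit.conj_mem_pPart {F M : Subgroup G} (h : IsFit F M) {p : ℕ} {m x : G} (hm : m ∈ M)
    (hx : x ∈ pPart F p) : m * x * m⁻¹ ∈ pPart F p := _root_.conj_mem_pPart (h.conj_mem m hm) hx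

/-- If the `p`-elements of `M` centralise the `p'`-part of `F`, and similarly for `r`, then
`p`-elements and `r`-elements of `M` commute. -/
theorem IsFit.commute [Finite G] {F M : Subgroup G} (h : IsFit F M) {p r : ℕ} (hp : p.Prime)
    (hr : r.Prime) (hpr : p ≠ r)
    (h1 : ∀ t : ℕ, t.Prime → t ≠ p → ∀ x ∈ M, ∀ f ∈ F, IsPElt p x → IsPElt t f → Commute x f)
    (h2 : ∀ t : ℕ, t.Prime → t ≠ r → ∀ x ∈ M, ∀ f ∈ F, IsPElt r x → IsPElt t f → Commute x f)
    {x y : G} (hx : x ∈ M) (hy : y ∈ M) (hxp : IsPElt p x) (hyr : IsPElt r y) : Commute x y := by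
  have : Fact p.Prime := ⟨hp⟩
  set c := x⁻¹ * (y⁻¹ * x * y) with hc
  have hcM : c ∈ M := M.mul_mem (M.inv_mem hx) (M.mul_mem (M.mul_mem (M.inv_mem hy) hx) hy)
  -- On the p-part of F both y and its conjugate act trivially; on the other parts both x and its
  -- conjugate do. So c acts trivially on all of F.
  have hcent : ∀ f ∈ F, Commute c f := by
    have key : F ≤ Subgroup.centralizer {c} := by
      refine le_of_forall_pPart_le fun t ht => (Subgroup.closure_le _).2 fun f hf => ?_
      refine Subgroup.mem_centralizer_singleton_iff.2 (Commute.symm (?_ : Commute c f))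
      rcases eq_or_ne t p with rfl | htp
      · have e : c = (x⁻¹ * y⁻¹ * x) * y := by rw [hc]; group
        rw [e]
        refine Commute.mul_left ?_ (h2 t ht hpr y hy f hf.1 hyr hf.2)
        have := h2 t ht hpr (x⁻¹ * y⁻¹ * x) (M.mul_mem (M.mul_mem (M.inv_mem hx) (M.inv_mem hy)) hx)
          f hf.1 (by simpa using hyr.inv.conj' x) hf.2
        exact this
      · refine Commute.mul_left (h1 t ht htp x hx f hf.1 hxp hf.2).inv_left ?_
        exact h1 t ht htp _ (M.mul_mem (M.mul_mem (M.inv_mem hy) hx) hy) f hf.1 (hxp.conj' y) hf.2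
    intro f hf
    exact (Subgroup.mem_centralizer_singleton_iff.1 (key hf)).symm
  have hcF : c ∈ F := h.mem_of_commute c hcM hcent
  obtain ⟨u, hu, v, hv, huv, hup, hvp⟩ := exists_isPElt_mul hp c
  have huF : u ∈ F := Subgroup.zpowers_le.2 hcF hu
  have hvF : v ∈ F := Subgroup.zpowers_le.2 hcF hv
  have hxv : Commute x v := by
    refine commute_of_forall_isPElt fun a b ha hb x' hx' v' hv' hxa hvb => ?_
    rcases eq_or_ne b p with rfl | hbp
    · have : v' = 1 := by
        refine hvb.eq_one_of_pow (n := orderOf v) hvp ?_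
        exact orderOf_dvd_iff_pow_eq_one.1 (orderOf_dvd_of_mem_zpowers hv')
      rw [this]; exact Commute.one_right _
    · exact h1 b hb hbp x' (Subgroup.zpowers_le.2 hx hx') v' (Subgroup.zpowers_le.2 hvF hv')
        (hxp.of_mem_zpowers hx') hvb
  have hxu : IsPElt p (x * u) := by
    have hnorm : Subgroup.zpowers x ≤ Subgroup.normalizer (pPart F p : Set G) := by
      rw [Subgroup.zpowers_le]
      exact mem_normalizer_of_conj_mem fun f hf => h.conj_mem_pPart hx hf
    have hP : IsPGroup p (Subgroup.zpowers x ⊔ pPart F p : Subgroup G) :=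
      hxp.isPGroup_zpowers.to_sup_of_normal_right' (h.isNilpotent.isPGroup_pPart hp) hnorm
    exact hP.isPElt (Subgroup.mul_mem_sup (Subgroup.mem_zpowers x) (mem_pPart_of_mem huF hup))
  -- The conjugate of x by y is a p-element and equals (xu)v, where xu is a p-element commuting with
  -- the p'-element v.
  have hv1 : v = 1 := by
    have e : y⁻¹ * x * y = (x * u) * v := by rw [mul_assoc x u v, ← huv, hc]; group
    have hcomm : Commute (x * u) v := by
      refine Commute.mul_left hxv ?_
      obtain ⟨a, rfl⟩ := hu
      obtain ⟨b, rfl⟩ := hv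
      exact (Commute.refl c).zpow_zpow a b
    obtain ⟨a, ha⟩ := hxu
    obtain ⟨b, hb⟩ : IsPElt p ((x * u) * v) := e ▸ hxp.conj' y
    have hvpow : v ^ p ^ (a + b) = 1 := by
      have h3 : ((x * u) * v) ^ p ^ (a + b) = 1 := by
        rw [pow_add, mul_comm, pow_mul, hb, one_pow]
      rwa [hcomm.mul_pow, pow_add p a b, pow_mul (x * u), ha, one_pow, one_mul, ← pow_add] at h3
    exact IsPElt.eq_one_of_pow (n := orderOf v) ⟨a + b, hvpow⟩ hvp (pow_orderOf_eq_one v)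
  rw [hv1, mul_one] at huv
  have hcp : IsPElt p c := huv ▸ hup
  have hyc : Commute y c := h2 p hp hpr y hy c hcF hyr hcp
  -- As y commutes with c, conjugating x by yⁿ multiplies it by cⁿ. Taking for n the order of an
  -- r-element kills the p-element c.
  have hxc : ∀ n : ℕ, (y ^ n)⁻¹ * x * y ^ n = x * c ^ n := by
    intro n
    induction n with
    | zero => simp
    | succ n ih =>
      have e1 : (y ^ (n + 1))⁻¹ * x * y ^ (n + 1) = y⁻¹ * ((y ^ n)⁻¹ * x * y ^ n) * y := by
        rw [pow_succ]; group
      have e2 : y⁻¹ * c ^ n * y = c ^ n := by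
        rw [mul_assoc, ← (hyc.pow_right n).eq]; group
      have e3 : y⁻¹ * x * y = x * c := by rw [hc]; group
      calc (y ^ (n + 1))⁻¹ * x * y ^ (n + 1) = y⁻¹ * (x * c ^ n) * y := by rw [e1, ih]
        _ = (y⁻¹ * x * y) * (y⁻¹ * c ^ n * y) := by group
        _ = x * c ^ (n + 1) := by rw [e2, e3, mul_assoc, ← pow_succ']
  obtain ⟨k, hk⟩ := hyr
  have hc1 : c = 1 := by
    have := hxc (r ^ k)
    rw [hk, inv_one, one_mul, mul_one, left_eq_mul] at this
    exact hcp.eq_one_of_pow (((Nat.coprime_primes hr hp).2 hpr.symm).pow_left k) this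
  have : y⁻¹ * x * y = x := by
    rw [hc, inv_mul_eq_one] at hc1
    exact hc1.symm
  calc x * y = y * (y⁻¹ * x * y) := by group
    _ = y * x := by rw [this]

/-- Subnormal nilpotent subgroups lie in the Fitting subgroup. -/
theorem Subgroup.IsSubnormal.le_fittingSubgroup [Finite G] {A : Subgroup G} (h : A.IsSubnormal)
    (hA : Group.IsNilpotent A) : A ≤ fittingSubgroup G := by
  -- The Fitting subgroup of H is characteristic in H, hence normal in any K in which H is normal;
  -- this is iterated up the subnormal chain.
  suffices key : ∀ A : Subgroup G, A.IsSubnormal →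
      (fittingSubgroup A).map A.subtype ≤ fittingSubgroup G by
    refine le_trans ?_ (key A h)
    intro x hx
    refine ⟨⟨x, hx⟩, ?_, rfl⟩
    exact _root_.le_fittingSubgroup (N := (⊤ : Subgroup A)) inferInstance
      (Group.isNilpotent_top.2 hA) (Subgroup.mem_top _)
  intro A hA
  induction hA with
  | top =>
    have := isNilpotent_fittingSubgroup (G := (⊤ : Subgroup G))
    refine _root_.le_fittingSubgroup ?_ ?_
    · exact (fittingSubgroup_normal (G := (⊤ : Subgroup G))).map _
        fun x => ⟨⟨x, Subgroup.mem_top x⟩, rfl⟩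
    · exact Group.nilpotent_of_mulEquiv
        ((fittingSubgroup (⊤ : Subgroup G)).equivMapOfInjective _ (Subgroup.subtype_injective _))
  | step H K hle _ hN ih =>
    refine le_trans ?_ ih
    have hnil := isNilpotent_fittingSubgroup (G := H)
    have h1 : Group.IsNilpotent ((fittingSubgroup H).map (Subgroup.inclusion hle)) :=
      Group.nilpotent_of_mulEquiv
        ((fittingSubgroup H).equivMapOfInjective _ (Subgroup.inclusion_injective hle))
    have h2 : ((fittingSubgroup H).map (Subgroup.inclusion hle)).Normal := by
      refine ⟨?_⟩
      rintro _ ⟨f, hf, rfl⟩ k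
      have hmem : ∀ x : H, (k : G) * x * (k : G)⁻¹ ∈ H := fun x =>
        hN.conj_mem ⟨x, hle x.2⟩ x.2 k
      have hmem' : ∀ x : H, (k : G)⁻¹ * x * (k : G) ∈ H := fun x => by
        have := hN.conj_mem ⟨x, hle x.2⟩ x.2 k⁻¹
        rw [Subgroup.mem_subgroupOf] at this
        simpa using this
      let φ : H ≃* H :=
        { toFun := fun x => ⟨k * x * (k : G)⁻¹, hmem x⟩
          invFun := fun x => ⟨(k : G)⁻¹ * x * k, hmem' x⟩
          left_inv := fun x => Subtype.ext (by simp [mul_assoc])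
          right_inv := fun x => Subtype.ext (by simp [mul_assoc])
          map_mul' := fun x y => Subtype.ext (by simp [mul_assoc]) }
      have hφ : φ f ∈ fittingSubgroup H :=
        Subgroup.characteristic_iff_map_le.1 fittingSubgroup_characteristic φ ⟨f, hf, rfl⟩
      exact ⟨φ f, hφ, rfl⟩
    have h3 := _root_.le_fittingSubgroup h2 h1
    rintro _ ⟨f, hf, rfl⟩
    exact ⟨_, h3 ⟨f, hf, rfl⟩, rfl⟩

end Fitting

/-! ### Existence of Hall subgroups in solvable groups. -/

section Hall

/-- **Hall's theorem**: a finite solvable group has a Hall `π`-subgroup. -/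
theorem exists_hall_subgroup (π : ℕ → Prop) (n : ℕ) : ∀ (G : Type*) [Group G] [Finite G]
    [Group.IsSolvable G], Nat.card G = n → ∃ L : Subgroup G,
      (∀ p : ℕ, p.Prime → p ∣ Nat.card L → π p) ∧ ∀ p : ℕ, p.Prime → p ∣ L.index → ¬ π p := by
  induction n using Nat.strong_induction_on with
  | _ n ih =>
  intro G _ _ _ hn
  rcases subsingleton_or_nontrivial G with hG | hG
  · refine ⟨⊥, fun p hp h => ?_, fun p hp h => ?_⟩
    · rw [Subgroup.card_bot] at h
      exact absurd (Nat.dvd_one.1 h) hp.ne_one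
    · rw [Subgroup.index_bot, Nat.card_unique] at h
      exact absurd (Nat.dvd_one.1 h) hp.ne_one
  have hF : fittingSubgroup G ≠ ⊥ := by
    intro h0
    have := centralizer_fittingSubgroup_le (G := G)
    rw [h0] at this
    obtain ⟨x, hx⟩ := exists_ne (1 : G)
    exact hx (Subgroup.mem_bot.1 (this (Subgroup.mem_centralizer_iff.2 fun y hy => by
      rw [Subgroup.mem_bot.1 hy]; simp)))
  obtain ⟨p, hp, hpd⟩ := Nat.exists_prime_and_dvd
    (fun h => hF (Subgroup.card_eq_one.1 h) : Nat.card (fittingSubgroup G) ≠ 1)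
  have hnil := isNilpotent_fittingSubgroup (G := G)
  -- A nontrivial normal p-subgroup by which to divide. The preimage L' of a Hall subgroup of the
  -- quotient is itself Hall when p belongs to π; otherwise a Schur–Zassenhaus complement of N in L'
  -- is.
  set N := pPart (fittingSubgroup G) p with hN
  have hNbot : N ≠ ⊥ := pPart_ne_bot hp hpd
  have hNp : IsPGroup p N := hnil.isPGroup_pPart hp
  have : Fact p.Prime := ⟨hp⟩
  obtain ⟨k, hk⟩ := (IsPGroup.iff_card (p := p) (G := N)).1 hNp
  have hcard : Nat.card (G ⧸ N) < n := by
    rw [← hn, Subgroup.card_eq_card_quotient_mul_card_subgroup N]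
    exact lt_mul_of_one_lt_right Nat.card_pos ((Subgroup.one_lt_card_iff_ne_bot _).2 hNbot)
  obtain ⟨L, hL1, hL2⟩ := ih _ hcard (G ⧸ N) rfl
  set L' := L.comap (QuotientGroup.mk' N)
  have hNL : N ≤ L' := fun x hx => by
    have : QuotientGroup.mk' N x = 1 := (QuotientGroup.eq_one_iff x).2 hx
    rw [Subgroup.mem_comap, this]; exact L.one_mem
  have hidx : L'.index = L.index := Subgroup.index_comap_of_surjective _ (QuotientGroup.mk'_surjective N)
  have hrel : N.relIndex L' = Nat.card L := by
    have h1 := Subgroup.relIndex_mul_index hNL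
    have h2 : N.index = Nat.card L * L.index := by
      rw [Subgroup.card_mul_index, Subgroup.index_eq_card]
    rw [h2, hidx] at h1
    exact Nat.eq_of_mul_eq_mul_right (Nat.pos_of_ne_zero Subgroup.index_ne_zero_of_finite) h1
  have hcL : Nat.card L' = p ^ k * Nat.card L := by
    rw [← card_mul_relIndex hNL, hk, hrel]
  by_cases hπ : π p
  · refine ⟨L', fun q hq hd => ?_, fun q hq hd => hL2 q hq (hidx ▸ hd)⟩
    rw [hcL, hq.dvd_mul] at hd
    rcases hd with hd | hd
    · rwa [(Nat.prime_dvd_prime_iff_eq hq hp).1 (hq.dvd_of_dvd_pow hd)]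
    · exact hL1 q hq hd
  · have hcop : (Nat.card (N.subgroupOf L')).Coprime (N.subgroupOf L').index := by
      have e1 : Nat.card (N.subgroupOf L') = p ^ k := by
        rw [Nat.card_congr (Subgroup.subgroupOfEquivOfLe hNL).toEquiv, hk]
      have e2 : (N.subgroupOf L').index = Nat.card L := hrel
      rw [e1, e2]
      exact ((Nat.Prime.coprime_iff_not_dvd hp).2 fun h => hπ (hL1 p hp h)).pow_left k
    obtain ⟨H, hH⟩ := Subgroup.exists_right_complement'_of_coprime hcop
    have hHL : Nat.card H = Nat.card L := by
      rw [← hH.symm.index_eq_card]; exact hrel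
    have hmap : Nat.card (H.map L'.subtype) = Nat.card L := by
      rw [← hHL]
      exact (Nat.card_congr (H.equivMapOfInjective _ L'.subtype_injective).toEquiv).symm
    refine ⟨H.map L'.subtype, fun q hq hd => hL1 q hq (hmap ▸ hd), fun q hq hd => ?_⟩
    have h1 := Subgroup.card_mul_index (H.map L'.subtype)
    have h2 := Subgroup.card_mul_index L'
    rw [← h2, hmap, hcL, hidx] at h1
    have h3 : (H.map L'.subtype).index = p ^ k * L.index := by
      refine Nat.eq_of_mul_eq_mul_left (Nat.card_pos (α := L)) ?_
      rw [h1]; ring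
    rw [h3, hq.dvd_mul] at hd
    rcases hd with hd | hd
    · rwa [(Nat.prime_dvd_prime_iff_eq hq hp).1 (hq.dvd_of_dvd_pow hd)]
    · exact hL2 q hq hd

end Hall

/-! ### Sylow subgroups of products, permutability and Kegel's arguments. -/

section Factorization

variable {G : Type*} [Group G]

theorem forall_exists_mul_symm {A B : Subgroup G} (h : ∀ x : G, ∃ a ∈ A, ∃ b ∈ B, x = a * b)
    (x : G) : ∃ b ∈ B, ∃ a ∈ A, x = b * a := by
  obtain ⟨a, ha, b, hb, e⟩ := h x⁻¹
  exact ⟨b⁻¹, B.inv_mem hb, a⁻¹, A.inv_mem ha, by rw [← mul_inv_rev, ← e, inv_inv]⟩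

/-- For g = ab the conjugate of B by g is its conjugate by a; writing xa = cd then gives x =
(ca⁻¹)(ada⁻¹). -/
theorem forall_exists_mul_conj {A B : Subgroup G} (h : ∀ x : G, ∃ a ∈ A, ∃ b ∈ B, x = a * b)
    (g x : G) : ∃ a ∈ A, ∃ b ∈ MulAut.conj g • B, x = a * b := by
  obtain ⟨a, ha, b, hb, e⟩ := h g
  obtain ⟨c, hc, d, hd, e'⟩ := h (x * a)
  refine ⟨c * a⁻¹, A.mul_mem hc (A.inv_mem ha), a * d * a⁻¹, ?_, ?_⟩
  · rw [mem_conj_smul, e]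
    have : (a * b)⁻¹ * (a * d * a⁻¹) * (a * b) = b⁻¹ * d * b := by group
    rw [this]
    exact B.mul_mem (B.mul_mem (B.inv_mem hb) hd) hb
  · calc x = (x * a) * a⁻¹ := by group
      _ = _ := by rw [e']; group

/-- The hypothesis says that Y meets as many cosets of X as K has, so Y meets all of them. -/
theorem exists_mul_of_relIndex_eq [Finite G] {X Y K : Subgroup G} (hY : Y ≤ K)
    (h : X.relIndex K = X.relIndex Y) {k : G} (hk : k ∈ K) : ∃ x ∈ X, ∃ y ∈ Y, k = x * y := by
  have hb := (Subgroup.quotientSubgroupOfEmbeddingOfLE X hY).injective.bijective_of_nat_card_le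
    h.le
  obtain ⟨q, hq⟩ := hb.2 (QuotientGroup.mk (⟨k, hk⟩⁻¹ : K))
  obtain ⟨y, rfl⟩ := QuotientGroup.mk_surjective q
  rw [Subgroup.quotientSubgroupOfEmbeddingOfLE_apply_mk, QuotientGroup.eq,
    Subgroup.mem_subgroupOf] at hq
  refine ⟨k * y, ?_, (y : G)⁻¹, Y.inv_mem y.2, by group⟩
  simpa using X.inv_mem hq

theorem IsPGroup.exists_relIndex_eq [Finite G] {p : ℕ} (hp : p.Prime) {P : Subgroup G}
    (h : IsPGroup p P) (X : Subgroup G) : ∃ k, X.relIndex P = p ^ k := by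
  have : Fact p.Prime := ⟨hp⟩
  obtain ⟨k, hk⟩ := (IsPGroup.iff_card (p := p) (G := P)).1 h
  obtain ⟨m, -, hm⟩ := (Nat.dvd_prime_pow hp).1 (hk ▸ Subgroup.relIndex_dvd_card X P)
  exact ⟨m, hm⟩

theorem conj_smul_pPart_of_mem [Finite G] {A : Subgroup G} {a : G} (ha : a ∈ A) (p : ℕ) :
    MulAut.conj a • pPart A p = pPart A p :=
  conj_smul_eq_of_le (conj_smul_le_iff.2 fun _ hx =>
    conj_mem_pPart (fun _ hy => A.mul_mem (A.mul_mem ha hy) (A.inv_mem ha)) hx)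

theorem pPart_conj_smul (g : G) (A : Subgroup G) (p : ℕ) :
    pPart (MulAut.conj g • A) p = MulAut.conj g • pPart A p := by
  have key : ∀ (g : G) (A : Subgroup G),
      pPart (MulAut.conj g • A) p ≤ MulAut.conj g • pPart A p := fun g A =>
    (Subgroup.closure_le _).2 fun x hx =>
      mem_conj_smul.2 (mem_pPart_of_mem (mem_conj_smul.1 hx.1) (hx.2.conj' g))
  refine le_antisymm (key g A) ?_
  have := conj_smul_le_conj_smul (g := g) (key g⁻¹ (MulAut.conj g • A))
  rwa [conj_inv_smul_conj_smul, conj_smul_conj_inv_smul] at this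

/-- If `G = AB` with `A` and `B` nilpotent, then the product of the Sylow `p`-subgroups of `A`
and `B` is a Sylow `p`-subgroup of `G`. -/
theorem exists_isSylowIn_forall_exists_mul [Finite G] {A B : Subgroup G}
    (hA : Group.IsNilpotent A) (hB : Group.IsNilpotent B)
    (h : ∀ x : G, ∃ a ∈ A, ∃ b ∈ B, x = a * b) {p : ℕ} (hp : p.Prime) :
    ∃ P, IsSylowIn p P ⊤ ∧ pPart A p ≤ P ∧ pPart B p ≤ P ∧
      ∀ x ∈ P, ∃ a ∈ pPart A p, ∃ b ∈ pPart B p, x = a * b := by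
  obtain ⟨P, hAP, hP⟩ := exists_isSylowIn_ge hp (hA.isPGroup_pPart hp) (le_top (a := pPart A p))
  obtain ⟨g, -, hg⟩ := hP.exists_le_conj hp (hB.isPGroup_pPart hp) (le_top (a := pPart B p))
  -- Elements of A normalise the p-part of A, and likewise for B, so conjugating P by a⁻¹ keeps the
  -- p-part of A inside and brings in that of B.
  obtain ⟨a, ha, b, hb, e⟩ := h g⁻¹
  have hP' : IsSylowIn p (MulAut.conj a⁻¹ • P) ⊤ := hP.conj_smul_of_mem (Subgroup.mem_top _)
  set P' := MulAut.conj a⁻¹ • P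
  have hA' : pPart A p ≤ P' := by
    rw [← conj_smul_pPart_of_mem (A.inv_mem ha) p]
    exact conj_smul_le_conj_smul hAP
  have hB' : pPart B p ≤ P' := by
    rw [← conj_smul_pPart_of_mem hb p]
    have := conj_smul_le_conj_smul (g := b) hg
    have e' : b * g = a⁻¹ := by
      rw [← inv_inv g, e]; group
    rwa [← conj_mul_smul, e'] at this
  refine ⟨P', hP', hA', hB', fun x hx => exists_mul_of_relIndex_eq hB' ?_ hx⟩
  set X := pPart A p
  set Y := pPart B p
  -- With h2, two ways to count: after cancelling |B : A ∩ B|, the p-powers |P' : X| and |Y : X ∩ Y|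
  -- agree up to factors prime to p, hence agree.
  have h1 : X.relIndex P' * P'.relIndex ⊤ = X.relIndex A * A.relIndex B := by
    rw [Subgroup.relIndex_mul_relIndex _ _ _ hA' le_top,
      ← relIndex_of_forall_exists_mul' le_top fun k _ => h k,
      Subgroup.relIndex_mul_relIndex _ _ _ (pPart_le A p) le_top]
  have h2 : X.relIndex Y * Y.relIndex B = (X ⊓ Y).relIndex (A ⊓ B) * A.relIndex B := by
    rw [← Subgroup.inf_relIndex_right X Y, Subgroup.relIndex_mul_relIndex _ _ _ inf_le_right
      (pPart_le B p), ← Subgroup.inf_relIndex_right A B, Subgroup.relIndex_mul_relIndex _ _ _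
      (inf_le_inf (pPart_le A p) (pPart_le B p)) inf_le_right]
  have c1 : (P'.relIndex ⊤).Coprime p := ((Nat.Prime.coprime_iff_not_dvd hp).2 hP'.not_dvd).symm
  have c2 : (X.relIndex A).Coprime p :=
    ((Nat.Prime.coprime_iff_not_dvd hp).2 (hA.isSylowIn_pPart hp).not_dvd).symm
  have c3 : (Y.relIndex B).Coprime p :=
    ((Nat.Prime.coprime_iff_not_dvd hp).2 (hB.isSylowIn_pPart hp).not_dvd).symm
  have c4 : ((X ⊓ Y).relIndex (A ⊓ B)).Coprime p := by
    refine ((Nat.Prime.coprime_iff_not_dvd hp).2 ?_).symm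
    refine ((hA.mono (inf_le_left (b := B))).isSylowIn_pPart hp).not_dvd_of_le ?_
    exact (Subgroup.closure_le _).2 fun x hx =>
      ⟨mem_pPart_of_mem hx.1.1 hx.2, mem_pPart_of_mem hx.1.2 hx.2⟩
  obtain ⟨m, hm⟩ := hP'.isPGroup.exists_relIndex_eq hp X
  obtain ⟨n, hn⟩ := (hB.isPGroup_pPart hp).exists_relIndex_eq hp X
  rw [hm] at h1 ⊢
  rw [hn] at h2 ⊢
  have h3 : p ^ m * (P'.relIndex ⊤ * (X ⊓ Y).relIndex (A ⊓ B)) =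
      p ^ n * (Y.relIndex B * X.relIndex A) := by
    calc _ = (p ^ m * P'.relIndex ⊤) * (X ⊓ Y).relIndex (A ⊓ B) := by ring
      _ = (p ^ n * Y.relIndex B) * X.relIndex A := by rw [h1, h2]; ring
      _ = _ := by ring
  refine Nat.dvd_antisymm ?_ ?_
  · exact ((c3.mul_left c2).symm.pow_left m).dvd_of_dvd_mul_right (Dvd.intro _ h3)
  · exact ((c1.mul_left c4).symm.pow_left n).dvd_of_dvd_mul_right (Dvd.intro _ h3.symm)

/-- `X` and `Y` permute: `XY = YX`. -/
def Permutes (X Y : Subgroup G) : Prop :=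
  ∀ x ∈ X, ∀ y ∈ Y, ∃ y' ∈ Y, ∃ x' ∈ X, x * y = y' * x'

theorem Permutes.symm {X Y : Subgroup G} (h : Permutes X Y) : Permutes Y X := fun y hy x hx => by
  obtain ⟨y', hy', x', hx', e⟩ := h x⁻¹ (X.inv_mem hx) y⁻¹ (Y.inv_mem hy)
  exact ⟨x'⁻¹, X.inv_mem hx', y'⁻¹, Y.inv_mem hy', by
    rw [← mul_inv_rev, ← e, mul_inv_rev, inv_inv, inv_inv]⟩

theorem Permutes.conj_smul {X Y : Subgroup G} (h : Permutes X Y) (g : G) :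
    Permutes (MulAut.conj g • X) (MulAut.conj g • Y) := fun x hx y hy => by
  obtain ⟨y', hy', x', hx', e⟩ := h _ (mem_conj_smul.1 hx) _ (mem_conj_smul.1 hy)
  refine ⟨g * y' * g⁻¹, mem_conj_smul.2 ?_, g * x' * g⁻¹, mem_conj_smul.2 ?_, ?_⟩
  · simpa [mul_assoc] using hy'
  · simpa [mul_assoc] using hx'
  · calc x * y = g * ((g⁻¹ * x * g) * (g⁻¹ * y * g)) * g⁻¹ := by group
      _ = _ := by rw [e]; group

theorem permutes_of_forall_exists_mul {X Y K : Subgroup G} (hX : X ≤ K) (hY : Y ≤ K)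
    (h : ∀ k ∈ K, ∃ x ∈ X, ∃ y ∈ Y, k = x * y) : Permutes X Y := by
  refine Permutes.symm fun y hy x hx => ?_
  obtain ⟨x', hx', y', hy', e⟩ := h (y * x) (K.mul_mem (hY hy) (hX hx))
  exact ⟨x', hx', y', hy', e⟩

theorem Permutes.sup_left {X X' Y : Subgroup G} (h : Permutes X Y) (h' : Permutes X' Y) :
    Permutes (X ⊔ X') Y := by
  intro x hx
  rw [Subgroup.sup_eq_closure] at hx
  have base : ∀ z ∈ (X : Set G) ∪ X', ∀ y ∈ Y, ∃ y' ∈ Y, ∃ x' ∈ X ⊔ X', z * y = y' * x' := by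
    rintro z (hz | hz) y hy
    · obtain ⟨y', hy', x', hx', e⟩ := h z hz y hy
      exact ⟨y', hy', x', Subgroup.mem_sup_left hx', e⟩
    · obtain ⟨y', hy', x', hx', e⟩ := h' z hz y hy
      exact ⟨y', hy', x', Subgroup.mem_sup_right hx', e⟩
  have step : ∀ z ∈ (X : Set G) ∪ X', ∀ w : G,
      (∀ y ∈ Y, ∃ y' ∈ Y, ∃ x' ∈ X ⊔ X', w * y = y' * x') →
      ∀ y ∈ Y, ∃ y' ∈ Y, ∃ x' ∈ X ⊔ X', (z * w) * y = y' * x' := by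
    intro z hz w hw y hy
    obtain ⟨y', hy', x', hx', e⟩ := hw y hy
    obtain ⟨y'', hy'', x'', hx'', e'⟩ := base z hz y' hy'
    exact ⟨y'', hy'', x'' * x', mul_mem hx'' hx', by rw [mul_assoc, e, ← mul_assoc, e', mul_assoc]⟩
  induction hx using Subgroup.closure_induction_left with
  | one => exact fun y hy => ⟨y, hy, 1, one_mem _, by simp⟩
  | mul_left z hz w _ ih => exact step z hz w ih
  | inv_mul_cancel z hz w _ ih =>
    refine step z⁻¹ ?_ w ih
    rcases hz with hz | hz
    · exact Or.inl (X.inv_mem hz)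
    · exact Or.inr (X'.inv_mem hz)

theorem Permutes.exists_mul {X Y : Subgroup G} (h : Permutes X Y) {k : G} (hk : k ∈ X ⊔ Y) :
    ∃ x ∈ X, ∃ y ∈ Y, k = x * y := by
  rw [Subgroup.sup_eq_closure] at hk
  induction hk using Subgroup.closure_induction_left with
  | one => exact ⟨1, X.one_mem, 1, Y.one_mem, by simp⟩
  | mul_left z hz w _ ih =>
    obtain ⟨x, hx, y, hy, rfl⟩ := ih
    rcases hz with hz | hz
    · exact ⟨z * x, X.mul_mem hz hx, y, hy, by group⟩
    · obtain ⟨x', hx', y', hy', e⟩ := h.symm z hz x hx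
      exact ⟨x', hx', y' * y, Y.mul_mem hy' hy, by rw [← mul_assoc, e, mul_assoc]⟩
  | inv_mul_cancel z hz w _ ih =>
    obtain ⟨x, hx, y, hy, rfl⟩ := ih
    rcases hz with hz | hz
    · exact ⟨z⁻¹ * x, X.mul_mem (X.inv_mem hz) hx, y, hy, by group⟩
    · obtain ⟨x', hx', y', hy', e⟩ := h.symm z⁻¹ (Y.inv_mem hz) x hx
      exact ⟨x', hx', y' * y, Y.mul_mem hy' hy, by rw [← mul_assoc, e, mul_assoc]⟩

theorem Permutes.isPGroup_sup [Finite G] {X Y : Subgroup G} (h : Permutes X Y) {p : ℕ}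
    (hp : p.Prime) (hX : IsPGroup p X) (hY : IsPGroup p Y) : IsPGroup p (X ⊔ Y : Subgroup G) := by
  have : Fact p.Prime := ⟨hp⟩
  obtain ⟨m, hm⟩ := (IsPGroup.iff_card (p := p) (G := X)).1 hX
  obtain ⟨n, hn⟩ := hY.exists_relIndex_eq hp X
  refine IsPGroup.of_card (n := m + n) ?_
  rw [← card_mul_relIndex (le_sup_left (a := X) (b := Y)),
    relIndex_of_forall_exists_mul' le_sup_right fun k hk => h.exists_mul hk, hm, hn, pow_add]

/-- Kegel's maximality argument: if `X` permutes with all conjugates of `Y`, then some maximal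
overgroup of `X` with this property is normalised by all conjugates of `Y`. -/
theorem exists_conj_smul_le_normalizer [Finite G] {X Y : Subgroup G} (S : Subgroup G → Prop)
    (hX : S X) (hXY : ∀ g : G, Permutes X (MulAut.conj g • Y))
    (hS : ∀ (Z Z' : Subgroup G) (g : G), S Z → (∀ h : G, Permutes Z (MulAut.conj h • Y)) →
      (∀ h : G, Permutes Z' (MulAut.conj h • Y)) → Z ≤ Z' → Z' ≤ Z ⊔ MulAut.conj g • Y → S Z') :
    ∃ Z, X ≤ Z ∧ S Z ∧ ∀ g : G, MulAut.conj g • Y ≤ Subgroup.normalizer (Z : Set G) := by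
  obtain ⟨Z, ⟨hXZ, hSZ, hZY⟩, hmax⟩ := (Set.toFinite {Z : Subgroup G | X ≤ Z ∧ S Z ∧
    ∀ g : G, Permutes Z (MulAut.conj g • Y)}).exists_maximal ⟨X, le_rfl, hX, hXY⟩
  refine ⟨Z, hXZ, hSZ, fun g y hy => ?_⟩
  -- Conjugation by y permutes the conjugates of Y, so the conjugate of Z by y permutes with all of
  -- them too, and so does its join with Z. Maximality then forces that conjugate into Z.
  have hperm : ∀ h : G, Permutes (Z ⊔ MulAut.conj y • Z) (MulAut.conj h • Y) := by
    intro h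
    refine (hZY h).sup_left ?_
    have := (hZY (y⁻¹ * h)).conj_smul y
    rwa [← conj_mul_smul, mul_inv_cancel_left] at this
  have hle : Z ⊔ MulAut.conj y • Z ≤ Z ⊔ MulAut.conj g • Y := by
    refine sup_le le_sup_left (conj_smul_le_iff.2 fun z hz => ?_)
    have hy' := Subgroup.mem_sup_right (S := Z) hy
    exact mul_mem (mul_mem hy' (Subgroup.mem_sup_left hz)) (inv_mem hy')
  have h1 := hmax ⟨hXZ.trans le_sup_left, hS Z _ g hSZ hZY hperm le_sup_left hle, hperm⟩ le_sup_left
  exact mem_normalizer_of_conj_mem fun z hz =>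
    conj_smul_le_iff.1 ((le_sup_right (a := Z)).trans h1) z hz

/-- **Kegel's lemma**: in a simple group, nontrivial subgroups `X`, `Y` generating a proper
subgroup cannot be such that `X` permutes with all conjugates of `Y`. -/
theorem sup_eq_top_of_permutes [Finite G] [IsSimpleGroup G] {X Y : Subgroup G}
    (hX : X ≠ ⊥) (hY : Y ≠ ⊥) (hXY : ∀ g : G, Permutes X (MulAut.conj g • Y)) :
    X ⊔ Y = ⊤ := by
  by_contra h
  -- Whether Z and a conjugate of Y generate G does not depend on the conjugate: when G is their
  -- product, any other conjugate of Y arises from it by conjugation with an element of Z.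
  have hconj : ∀ (Z : Subgroup G) (g h : G), Permutes Z (MulAut.conj h • Y) →
      Z ⊔ MulAut.conj h • Y = ⊤ → Z ⊔ MulAut.conj g • Y = ⊤ := by
    intro Z g h hp htop
    obtain ⟨a, ha, b, hb, e⟩ := hp.exists_mul (htop ▸ Subgroup.mem_top (g * h⁻¹))
    have h1 : g = a * h * (h⁻¹ * b * h) := by
      calc g = (g * h⁻¹) * h := by group
        _ = _ := by rw [e]; group
    have h2 : MulAut.conj g • Y = MulAut.conj a • MulAut.conj h • Y := by
      rw [h1, conj_mul_smul, conj_mul_smul, conj_smul_mem_self (mem_conj_smul.1 hb)]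
    have h3 : MulAut.conj a • (Z ⊔ MulAut.conj h • Y) = Z ⊔ MulAut.conj g • Y := by
      rw [Subgroup.smul_sup, h2, conj_smul_mem_self ha]
    rw [← h3, htop, conj_smul_mem_self (Subgroup.mem_top a)]
  obtain ⟨Z, hXZ, hSZ, hn⟩ := exists_conj_smul_le_normalizer (X := X) (Y := Y)
    (fun Z => ∀ g : G, Z ⊔ MulAut.conj g • Y ≠ ⊤)
    (fun g hg => h (by simpa using hconj X 1 g (hXY g) hg)) hXY
    (fun Z Z' g hZ _ hZ' _ hle k hk => hZ g (top_le_iff.1 ((hconj Z' g k (hZ' k) hk).symm.le.trans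
      (sup_le hle le_sup_right))))
  -- The conjugates of Y generate the simple group G and normalise Z, so Z would be normal.
  have h1 : Subgroup.normalClosure (Y : Set G) ≤ Subgroup.normalizer (Z : Set G) := by
    refine (Subgroup.closure_le _).2 fun x hx => ?_
    obtain ⟨y, hy, hyx⟩ := Group.mem_conjugatesOfSet_iff.1 hx
    obtain ⟨g, rfl⟩ := isConj_iff.1 hyx
    exact hn g (mem_conj_smul.2 (by simpa [mul_assoc] using hy))
  have h2 : Subgroup.normalClosure (Y : Set G) = ⊤ :=
    (Subgroup.normalClosure_normal.eq_bot_or_eq_top).resolve_left fun h0 =>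
      hY (le_bot_iff.1 (h0 ▸ Subgroup.le_normalClosure))
  have hZ : Z.Normal := Subgroup.normalizer_eq_top_iff.1 (top_le_iff.1 (h2 ▸ h1))
  rcases hZ.eq_bot_or_eq_top with h0 | h0
  · exact hX (le_bot_iff.1 (h0 ▸ hXZ))
  · exact hSZ 1 (by rw [h0, top_sup_eq])

/-- If `G = AB` with `A`, `B` nilpotent of orders divisible by `p` and `G` has trivial Fitting
subgroup, then `G` has two nontrivial normal subgroups with trivial intersection. -/
theorem exists_normal_inf_eq_bot [Finite G] {A B : Subgroup G} (hA : Group.IsNilpotent A)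
    (hB : Group.IsNilpotent B) (h : ∀ x : G, ∃ a ∈ A, ∃ b ∈ B, x = a * b) {p : ℕ} (hp : p.Prime)
    (hpA : p ∣ Nat.card A) (hpB : p ∣ Nat.card B) (hF : fittingSubgroup G = ⊥) :
    ∃ M N : Subgroup G, M.Normal ∧ N.Normal ∧ M ≠ ⊥ ∧ N ≠ ⊥ ∧ M ⊓ N = ⊥ := by
  obtain ⟨Z, hXZ, hZp, hn⟩ := exists_conj_smul_le_normalizer (X := pPart A p) (Y := pPart B p)
    (fun Z => IsPGroup p Z) (hA.isPGroup_pPart hp)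
    (fun g => by
      obtain ⟨P, -, h1, h2, h3⟩ := exists_isSylowIn_forall_exists_mul hA (hB.conj_smul g)
        (forall_exists_mul_conj h g) hp
      rw [pPart_conj_smul] at h2 h3
      exact permutes_of_forall_exists_mul h1 h2 h3)
    (fun Z Z' g hZ hperm _ _ hle => ((hperm g).isPGroup_sup hp hZ
      ((hB.isPGroup_pPart hp).conj_smul g)).to_le hle)
  set N := Subgroup.normalClosure (pPart B p : Set G) with hN
  have hNZ : N ≤ Subgroup.normalizer (Z : Set G) := by
    refine (Subgroup.closure_le _).2 fun x hx => ?_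
    obtain ⟨y, hy, hyx⟩ := Group.mem_conjugatesOfSet_iff.1 hx
    obtain ⟨g, rfl⟩ := isConj_iff.1 hyx
    exact hn g (mem_conj_smul.2 (by simpa [mul_assoc] using hy))
  have hNn : N.Normal := Subgroup.normalClosure_normal
  -- N normalises the p-group Z, so Z ∩ N is a subnormal p-subgroup and lies in the trivial Fitting
  -- subgroup. Hence [Z, N] = 1, and the centralizer of N contains Z.
  have hD : Z ⊓ N = ⊥ := by
    rw [← le_bot_iff, ← hF]
    refine Subgroup.IsSubnormal.le_fittingSubgroup
      (Subgroup.IsSubnormal.step _ N inf_le_right hNn.isSubnormal ⟨?_⟩)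
      ((hZp.isNilpotent_subgroup hp).mono inf_le_left)
    rintro ⟨x, hxN⟩ hx n
    rw [Subgroup.mem_subgroupOf] at hx ⊢
    exact ⟨conj_mem_of_mem_normalizer (hNZ n.2) hx.1, hNn.conj_mem x hxN n⟩
  refine ⟨Subgroup.centralizer N, N, inferInstance, hNn, fun h0 => ?_, fun h0 => ?_, ?_⟩
  · refine pPart_ne_bot hp hpA (le_bot_iff.1 (hXZ.trans (h0 ▸ fun z hz => ?_)))
    refine Subgroup.mem_centralizer_iff.2 fun n hn => ?_
    have h1 : n * z * n⁻¹ * z⁻¹ ∈ Z ⊓ N := by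
      refine ⟨Z.mul_mem (conj_mem_of_mem_normalizer (hNZ hn) hz) (Z.inv_mem hz), ?_⟩
      have := N.mul_mem hn (hNn.conj_mem _ (N.inv_mem hn) z)
      simpa [mul_assoc] using this
    rw [hD, Subgroup.mem_bot, mul_inv_eq_one, mul_inv_eq_iff_eq_mul] at h1
    exact h1
  · exact pPart_ne_bot hp hpB (le_bot_iff.1 (h0 ▸ Subgroup.le_normalClosure))
  · rw [← le_bot_iff, ← hF]
    exact le_fittingSubgroup inferInstance (isNilpotent_of_forall_commute
      fun _ _ _ _ _ x hx y hy _ _ => (Subgroup.mem_centralizer_iff.1 hx.1 y hy.2).symm)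

end Factorization

/-! ### Means of roots of unity and matrices of finite order. -/

section Burnside

open Polynomial

/-- If the mean of finitely many `n`-th roots of unity is an algebraic integer, then it is zero or
all the roots of unity are equal. -/
theorem sum_eq_zero_or_forall_eq_of_isIntegral {ι : Type*} [Fintype ι] [Nonempty ι] {n : ℕ}
    (hn : 0 < n) (f : ι → ℂ) (hf : ∀ i, f i ^ n = 1)
    (hint : IsIntegral ℤ ((∑ i, f i) / Fintype.card ι)) :
    ∑ i, f i = 0 ∨ ∃ c, ∀ i, f i = c := by
  have hd : (0 : ℝ) < Fintype.card ι := by exact_mod_cast Fintype.card_pos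
  set K := IntermediateField.adjoin ℚ (Set.range f) with hK
  have hfin : FiniteDimensional ℚ K := by
    refine IntermediateField.finiteDimensional_adjoin ?_
    rintro _ ⟨i, rfl⟩
    exact IsIntegral.of_pow hn (by rw [hf i]; exact isIntegral_one)
  have : NumberField K := ⟨⟩
  let F : ι → K := fun i => ⟨f i, IntermediateField.subset_adjoin ℚ _ ⟨i, rfl⟩⟩
  have hF : ∀ i, F i ^ n = 1 := fun i => Subtype.ext (hf i)
  set α : K := (∑ i, F i) / Fintype.card ι with hα
  have hαc : (α : ℂ) = (∑ i, f i) / Fintype.card ι := by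
    rw [hα]; push_cast; rfl
  rcases eq_or_ne α 0 with h0 | h0
  · left
    rw [h0, ZeroMemClass.coe_zero] at hαc
    have := (div_eq_zero_iff.1 hαc.symm).resolve_right (by exact_mod_cast Fintype.card_ne_zero)
    exact this
  right
  have hαint : IsIntegral ℤ α := by
    rw [← hαc] at hint
    exact (isIntegral_algHom_iff ((algebraMap K ℂ).toIntAlgHom) (algebraMap K ℂ).injective).1 hint
  -- All conjugates of the mean have absolute value at most 1, so by Kronecker it is a root of
  -- unity. Absolute value 1 then means equality in the triangle inequality, which forces the
  -- summands to coincide.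
  have hbound : ∀ φ : K →+* ℂ, ‖φ α‖ ≤ 1 := by
    intro φ
    rw [hα, map_div₀, map_sum, map_natCast, norm_div, div_le_one (by simpa using hd)]
    refine (norm_sum_le _ _).trans ?_
    have : ∀ i, ‖φ (F i)‖ = 1 := fun i =>
      Complex.norm_eq_one_of_pow_eq_one (by rw [← map_pow, hF, map_one]) hn.ne'
    simp [this]
  obtain ⟨m, hm, hαm⟩ := NumberField.Embeddings.pow_eq_one_of_norm_le_one K ℂ h0 hαint hbound
  have hnorm : ‖(α : ℂ)‖ = 1 :=
    Complex.norm_eq_one_of_pow_eq_one (by rw [← SubmonoidClass.coe_pow, hαm]; rfl) hm.ne'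
  refine ⟨α, fun i => ?_⟩
  have hfn : ∀ i, ‖f i‖ = 1 := fun i => Complex.norm_eq_one_of_pow_eq_one (hf i) hn.ne'
  set w := (starRingEnd ℂ) (α : ℂ)
  have hwα : w * α = 1 := by
    rw [mul_comm, Complex.mul_conj, Complex.normSq_eq_norm_sq, hnorm]; simp
  have hwn : ∀ i, ‖w * f i‖ = 1 := fun i => by
    rw [norm_mul, hfn, mul_one, RCLike.norm_conj, hnorm]
  have hsum : ∑ i, (w * f i).re = ∑ _i : ι, (1 : ℝ) := by
    rw [← Complex.re_sum, ← Finset.mul_sum]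
    have : ∑ i, f i = α * Fintype.card ι := by
      rw [hαc, div_mul_cancel₀]
      exact_mod_cast Fintype.card_ne_zero
    rw [this, ← mul_assoc, hwα]
    simp
  have hre : (w * f i).re = 1 :=
    (Finset.sum_eq_sum_iff_of_le fun i _ => (Complex.re_le_norm _).trans (hwn i).le).1 hsum i
      (Finset.mem_univ i)
  have h1 : w * f i = 1 := by
    have h2 := Complex.sq_norm (w * f i)
    rw [hwn i, Complex.normSq_apply, hre] at h2
    refine Complex.ext hre ?_
    have : (w * f i).im * (w * f i).im = 0 := by linarith
    simpa using this
  calc f i = (w * f i) * α := by rw [mul_right_comm, hwα, one_mul]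
    _ = α := by rw [h1, one_mul]

theorem Matrix.pow_eq_one_of_mem_roots_charpoly {d n : ℕ} {M : Matrix (Fin d) (Fin d) ℂ}
    (hM : M ^ n = 1) {c : ℂ} (hc : c ∈ M.charpoly.roots) : c ^ n = 1 := by
  have hd : Nonempty (Fin d) := by
    by_contra h
    rw [not_nonempty_iff] at h
    simp [Matrix.charpoly] at hc
  have h1 : c ∈ spectrum ℂ M := by
    rw [Matrix.mem_spectrum_iff_isRoot_charpoly]
    exact (mem_roots'.1 hc).2
  have h2 := spectrum.subset_polynomial_aeval M (X ^ n : ℂ[X]) ⟨c, h1, rfl⟩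
  simpa [hM, spectrum.one_eq] using h2

theorem Matrix.isIntegral_trace_of_pow_eq_one {d n : ℕ} {M : Matrix (Fin d) (Fin d) ℂ}
    (hn : 0 < n) (hM : M ^ n = 1) : IsIntegral ℤ M.trace := by
  rw [Matrix.trace_eq_sum_roots_charpoly]
  refine IsIntegral.multiset_sum fun c hc => IsIntegral.of_pow hn ?_
  rw [Matrix.pow_eq_one_of_mem_roots_charpoly hM hc]
  exact isIntegral_one

/-- A matrix of finite order with a single eigenvalue is scalar. -/
theorem Matrix.eq_smul_one_of_charpoly_eq {d n : ℕ} {M : Matrix (Fin d) (Fin d) ℂ} (hn : 0 < n)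
    (hM : M ^ n = 1) {c : ℂ} (hc : M.charpoly = (X - C c) ^ d) (hcn : c ^ n = 1) :
    M = c • 1 := by
  have hdvd : (X - C c) ∣ (X ^ n - 1 : ℂ[X]) := by
    rw [dvd_iff_isRoot]; simp [hcn]
  obtain ⟨u, hu⟩ := hdvd
  have hsep : (X ^ n - 1 : ℂ[X]).Separable := by
    have := separable_X_pow_sub_C (F := ℂ) (n := n) 1 (by exact_mod_cast hn.ne') one_ne_zero
    simpa using this
  rw [hu] at hsep
  -- Xⁿ − 1 is separable, so its gcd with (X − c)ᵈ is X − c. Both polynomials vanish at M, hence so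
  -- does X − c.
  obtain ⟨a, b, hab⟩ : IsCoprime u ((X - C c) ^ d) := (hsep.isCoprime.symm).pow_right
  have h1 : (X - C c : ℂ[X]) = a * (X ^ n - 1) + b * (X - C c) * (X - C c) ^ d := by
    calc (X - C c : ℂ[X]) = (X - C c) * (a * u + b * (X - C c) ^ d) := by rw [hab, mul_one]
      _ = _ := by rw [hu]; ring
  have h2 := congrArg (aeval M) h1
  have h3 := M.aeval_self_charpoly
  rw [hc] at h3
  rw [map_add, map_mul, map_mul (aeval M) _ ((X - C c) ^ d), h3] at h2
  simp only [map_sub, aeval_X, aeval_C, map_pow, map_one, hM, sub_self, mul_zero, add_zero] at h2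
  rw [sub_eq_zero.1 h2, Algebra.algebraMap_eq_smul_one]

/-- A matrix `M` of finite order whose normalised trace is an algebraic integer is scalar or has
trace zero. -/
theorem Matrix.trace_eq_zero_or_eq_smul_one {d n : ℕ} (hd : d ≠ 0)
    {M : Matrix (Fin d) (Fin d) ℂ} (hn : 0 < n) (hM : M ^ n = 1)
    (h : IsIntegral ℤ (M.trace / d)) : M.trace = 0 ∨ ∃ c : ℂ, M = c • 1 := by
  have hsplit : M.charpoly.Splits := IsAlgClosed.splits _
  have hcard : M.charpoly.roots.card = d := by
    rw [← hsplit.natDegree_eq_card_roots, Matrix.charpoly_natDegree_eq_dim, Fintype.card_fin]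
  obtain ⟨l, hl⟩ : ∃ l : List ℂ, (l : Multiset ℂ) = M.charpoly.roots := Quot.exists_rep _
  have hll : l.length = d := by rw [← hcard, ← hl]; rfl
  have : Nonempty (Fin l.length) := ⟨⟨0, by omega⟩⟩
  have htr : M.trace = ∑ i, l.get i := by
    rw [Matrix.trace_eq_sum_roots_charpoly, ← hl, Multiset.sum_coe, ← List.sum_ofFn, List.ofFn_get]
  have hroot : ∀ i, l.get i ∈ M.charpoly.roots := fun i => by
    rw [← hl]; exact Multiset.mem_coe.2 (List.get_mem l i)
  rcases sum_eq_zero_or_forall_eq_of_isIntegral hn l.get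
    (fun i => Matrix.pow_eq_one_of_mem_roots_charpoly hM (hroot i))
    (by rw [← htr, Fintype.card_fin, hll]; exact h) with h0 | ⟨c, hc⟩
  · exact Or.inl (htr.trans h0)
  · right
    have hrep : M.charpoly.roots = Multiset.replicate d c := by
      rw [Multiset.eq_replicate]
      refine ⟨hcard, fun b hb => ?_⟩
      rw [← hl, Multiset.mem_coe] at hb
      obtain ⟨i, rfl⟩ := List.get_of_mem hb
      exact hc i
    refine ⟨c, Matrix.eq_smul_one_of_charpoly_eq hn hM ?_ ?_⟩
    · rw [hsplit.eq_prod_roots_of_monic M.charpoly_monic, hrep]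
      simp
    · refine Matrix.pow_eq_one_of_mem_roots_charpoly hM ?_
      rw [hrep]
      exact Multiset.mem_replicate.2 ⟨hd, rfl⟩

end Burnside

/-! ### Burnside's theorem on conjugacy classes of prime power size. -/

section ClassSize

open MonoidAlgebra

/-- Left multiplication on d × d matrices acts separately on the d columns, so each trace is counted
d times. -/
theorem trace_mulLeft_pi_matrix {n : ℕ} {d : Fin n → ℕ}
    (x : Π i, Matrix (Fin (d i)) (Fin (d i)) ℂ) :
    LinearMap.trace ℂ _ (LinearMap.mulLeft ℂ x) = ∑ i, (d i : ℂ) * (x i).trace := by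
  rw [LinearMap.trace_eq_matrix_trace ℂ
    (Pi.basis fun i => Matrix.stdBasis ℂ (Fin (d i)) (Fin (d i))), Matrix.trace, Fintype.sum_sigma]
  refine Finset.sum_congr rfl fun i _ => ?_
  have key : ∀ jk : Fin (d i) × Fin (d i), (LinearMap.toMatrix
      (Pi.basis fun i => Matrix.stdBasis ℂ (Fin (d i)) (Fin (d i)))
      (Pi.basis fun i => Matrix.stdBasis ℂ (Fin (d i)) (Fin (d i)))
      (LinearMap.mulLeft ℂ x)).diag ⟨i, jk⟩ = x i jk.1 jk.1 := by
    rintro ⟨j, k⟩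
    rw [Matrix.diag_apply, LinearMap.toMatrix_apply, Pi.basis_repr, Pi.basis_apply,
      LinearMap.mulLeft_apply, Pi.mul_apply, Pi.single_eq_same, Matrix.stdBasis_eq_single]
    change (x i * Matrix.single j k 1 : Matrix (Fin (d i)) (Fin (d i)) ℂ) j k = x i j j
    simp
  rw [Finset.sum_congr rfl fun jk _ => key jk, Fintype.sum_prod_type]
  simp only [Finset.sum_const, Finset.card_univ, Fintype.card_fin, nsmul_eq_mul]
  rw [← Finset.mul_sum]
  rfl

variable {G : Type*} [Group G]

/-- Left multiplication by g permutes the group basis without fixed points. -/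
theorem trace_mulLeft_single [Finite G] {g : G} (hg : g ≠ 1) :
    LinearMap.trace ℂ _ (LinearMap.mulLeft ℂ (single g (1 : ℂ))) = 0 := by
  have := Fintype.ofFinite G
  classical
  rw [LinearMap.trace_eq_matrix_trace ℂ (MonoidAlgebra.basis G ℂ), Matrix.trace]
  refine Finset.sum_eq_zero fun h _ => ?_
  rw [Matrix.diag_apply, LinearMap.toMatrix_apply, LinearMap.mulLeft_apply,
    MonoidAlgebra.basis_apply, single_mul_single]
  change (single (g * h) (1 * 1 : ℂ)).coeff h = 0
  simp [hg]

/-- A homomorphism from a nonabelian simple group to a monoid is trivial if some nontrivial element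
has image commuting with the image of the homomorphism. -/
theorem MonoidHom.eq_one_of_forall_commute [IsSimpleGroup G] {M : Type*} [Monoid M]
    (hG : ¬ ∀ a b : G, a * b = b * a) (f : G →* M) {g : G} (hg : g ≠ 1)
    (h : ∀ y, Commute (f g) (f y)) (x : G) : f x = 1 := by
  let Z : Subgroup G :=
    { carrier := {x | ∀ y, Commute (f x) (f y)}
      mul_mem' := fun {a b} ha hb y => by rw [map_mul]; exact (ha y).mul_left (hb y)
      one_mem' := fun y => by rw [map_one]; exact Commute.one_left _
      inv_mem' := fun {a} ha y => by
        have h1 : f a * f (a⁻¹ * y * a⁻¹) = f (a⁻¹ * y * a⁻¹) * f a := ha _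
        rw [← map_mul, ← map_mul, inv_mul_cancel_right, mul_assoc, mul_inv_cancel_left] at h1
        change f a⁻¹ * f y = f y * f a⁻¹
        rw [← map_mul, ← map_mul, h1] }
  have hZ : Z.Normal := ⟨fun a ha y => by
    have : f (y * a * y⁻¹) = f a := by
      rw [map_mul, map_mul, ← (ha y).eq, mul_assoc, ← map_mul, mul_inv_cancel, map_one, mul_one]
    intro z
    rw [this]
    exact ha z⟩
  have hZt : Z = ⊤ := hZ.eq_bot_or_eq_top.resolve_left fun h0 =>
    hg (Subgroup.mem_bot.1 (h0 ▸ (show g ∈ Z from h)))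
  have hcomm : ∀ a b, Commute (f a) (f b) := fun a => (show a ∈ Z from hZt ▸ Subgroup.mem_top a)
  have hK : f.ker = ⊤ := by
    refine f.normal_ker.eq_bot_or_eq_top.resolve_left fun h0 => hG fun a b => ?_
    have : a * b * a⁻¹ * b⁻¹ ∈ f.ker := by
      rw [MonoidHom.mem_ker, map_mul, map_mul, map_mul, (hcomm a b).eq, mul_assoc (f b), ← map_mul,
        mul_inv_cancel, map_one, mul_one, ← map_mul, mul_inv_cancel, map_one]
    rw [h0, Subgroup.mem_bot, mul_inv_eq_one, mul_inv_eq_iff_eq_mul] at this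
    exact this
  exact MonoidHom.mem_ker.1 (hK ▸ Subgroup.mem_top x)

/-- **Burnside**: in a nonabelian finite simple group no nontrivial element has a conjugacy class
of prime power size. -/
theorem commute_of_card_isConj_eq_prime_pow [Finite G] [IsSimpleGroup G] {q k : ℕ} (hq : q.Prime)
    {g : G} (hg : g ≠ 1) (hk : Nat.card {x // IsConj g x} = q ^ k) : ∀ a b : G, a * b = b * a := by
  by_contra hG
  have := Fintype.ofFinite G
  have : Fintype {x // IsConj g x} := Fintype.ofFinite _
  obtain ⟨n, d, hd, ⟨φ⟩⟩ :=
    IsSemisimpleRing.exists_algEquiv_pi_matrix_of_isAlgClosed ℂ (MonoidAlgebra ℂ G)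
  let π : ∀ i, MonoidAlgebra ℂ G →ₐ[ℂ] Matrix (Fin (d i)) (Fin (d i)) ℂ := fun i =>
    (Pi.evalAlgHom ℂ (fun i => Matrix (Fin (d i)) (Fin (d i)) ℂ) i).comp (φ : MonoidAlgebra ℂ G →ₐ[ℂ] _)
  let ρ : ∀ i, G →* Matrix (Fin (d i)) (Fin (d i)) ℂ := fun i =>
    ((π i : MonoidAlgebra ℂ G →* _)).comp (of ℂ G)
  have hπ : ∀ i x, π i (single x 1) = ρ i x := fun _ _ => rfl
  have hpow : ∀ i x, ρ i x ^ Nat.card G = 1 := fun i x => by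
    rw [← map_pow, pow_card_eq_one', map_one]
  have hcentral : ∀ i (M : Matrix (Fin (d i)) (Fin (d i)) ℂ), (∀ x, Commute M (ρ i x)) →
      ∃ c : ℂ, M = c • 1 := by
    intro i M hM
    have h1 : ∀ a : MonoidAlgebra ℂ G, Commute M (π i a) := by
      intro a
      induction a using MonoidAlgebra.induction_linear with
      | zero => rw [map_zero]; exact Commute.zero_right _
      | add a b ha hb => rw [map_add]; exact ha.add_right hb
      | single x r =>
        have : single x r = r • single x (1 : ℂ) := by simp
        rw [this, map_smul, hπ]
        exact (hM x).smul_right r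
    have h2 : M ∈ Set.range (Matrix.scalar (Fin (d i))) := by
      refine Matrix.mem_range_scalar_of_commute_single fun j k _ => ?_
      have h3 := h1 (φ.symm (Pi.single i (Matrix.single j k 1)))
      have h4 : π i (φ.symm (Pi.single i (Matrix.single j k 1))) = Matrix.single j k 1 := by
        change φ (φ.symm (Pi.single i (Matrix.single j k 1))) i = _
        rw [φ.apply_symm_apply, Pi.single_eq_same]
      rw [h4] at h3
      exact h3.symm
    obtain ⟨c, hc⟩ := h2
    exact ⟨c, by rw [← hc, Matrix.scalar_apply, Matrix.smul_one_eq_diagonal]⟩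
  -- The trace of g on the regular representation, computed once on the group basis and once through
  -- the Wedderburn decomposition. It replaces column orthogonality of characters.
  have hsum : ∑ i, (d i : ℂ) * (ρ i g).trace = 0 := by
    have h1 := trace_mulLeft_pi_matrix (φ (single g 1))
    have h2 : (φ.toLinearEquiv).conj (LinearMap.mulLeft ℂ (single g (1 : ℂ))) =
        LinearMap.mulLeft ℂ (φ (single g 1)) := by
      refine LinearMap.ext fun y => ?_
      simp [LinearEquiv.conj_apply]
    rw [← h2, LinearMap.trace_conj', trace_mulLeft_single hg] at h1
    exact h1.symm
  have htriv : ∀ i, (∀ x, ρ i x = 1) → ∀ a, π i a = algebraMap ℂ _ (lift ℂ ℂ G 1 a) := by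
    intro i hi a
    have : π i = (Algebra.ofId ℂ _).comp (lift ℂ ℂ G 1) := by
      refine MonoidAlgebra.algHom_ext (fun x => ?_) (by ext)
      rw [hπ, hi]; simp
    rw [this]; rfl
  -- On a trivial component the algebra acts by scalars through the augmentation, yet it maps onto
  -- all matrices.
  have hdim : ∀ i, (∀ x, ρ i x = 1) → d i = 1 := by
    intro i hi
    by_contra hne
    have h0 := (hd i).out
    let j : Fin (d i) := ⟨0, by omega⟩
    let k : Fin (d i) := ⟨1, by omega⟩
    have h1 := htriv i hi (φ.symm (Pi.single i (Matrix.single j j 1)))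
    have h2 : π i (φ.symm (Pi.single i (Matrix.single j j 1))) = Matrix.single j j 1 := by
      change φ (φ.symm (Pi.single i (Matrix.single j j 1))) i = _
      rw [φ.apply_symm_apply, Pi.single_eq_same]
    rw [h2] at h1
    have h3 := congrFun (congrFun h1 j) j
    have h4 := congrFun (congrFun h1 k) k
    have hjk : j ≠ k := by simp [j, k]
    rw [Matrix.algebraMap_matrix_apply, if_pos rfl] at h3 h4
    rw [Matrix.single_apply_same] at h3
    rw [← h3, Matrix.single_apply_of_ne _ _ _ _ _ (by simp [hjk])] at h4
    simp at h4
  -- The central idempotent of component i maps to 1 there and to 0 in component j, while both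
  -- values are given by its augmentation.
  have hunique : ∀ i j, (∀ x, ρ i x = 1) → (∀ x, ρ j x = 1) → i = j := by
    intro i j hi hj
    by_contra hij
    have hdi := hd i
    have hdj := hd j
    have h1 := htriv i hi (φ.symm (Pi.single i 1))
    have h2 := htriv j hj (φ.symm (Pi.single i 1))
    have h3 : π i (φ.symm (Pi.single i 1)) = 1 := by
      change φ (φ.symm (Pi.single i 1)) i = _
      rw [φ.apply_symm_apply, Pi.single_eq_same]
    have h4 : π j (φ.symm (Pi.single i 1)) = 0 := by
      change φ (φ.symm (Pi.single i 1)) j = _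
      rw [φ.apply_symm_apply, Pi.single_eq_of_ne (Ne.symm hij)]
    have h5 := (algebraMap ℂ (Matrix (Fin (d i)) (Fin (d i)) ℂ)).injective
      ((map_one _).trans (h3.symm.trans h1))
    have h6 := (algebraMap ℂ (Matrix (Fin (d j)) (Fin (d j)) ℂ)).injective
      ((map_zero _).trans (h4.symm.trans h2))
    exact zero_ne_one (h6.trans h5.symm)
  obtain ⟨i₀, hi₀⟩ : ∃ i, ∀ x, ρ i x = 1 := by
    -- The sum of all group elements is nonzero and absorbs multiplication by G, so in some
    -- component it is a nonzero scalar, and G acts trivially there.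
    set e : MonoidAlgebra ℂ G := ∑ x : G, single x 1 with he
    have hleft : ∀ x : G, single x 1 * e = e := fun x => by
      rw [he, Finset.mul_sum]
      simp only [single_mul_single, mul_one]
      exact Fintype.sum_equiv (Equiv.mulLeft x) _ _ fun _ => rfl
    have hright : ∀ x : G, e * single x 1 = e := fun x => by
      rw [he, Finset.sum_mul]
      simp only [single_mul_single, mul_one]
      exact Fintype.sum_equiv (Equiv.mulRight x) _ _ fun _ => rfl
    have he0 : e ≠ 0 := by
      intro h0
      have h1 : e.coeff 1 = 1 := by
        rw [he]
        simp
      rw [h0] at h1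
      simp at h1
    obtain ⟨i, hi⟩ : ∃ i, φ e i ≠ 0 := by
      by_contra! hall
      exact he0 (φ.injective ((funext hall).trans (map_zero φ).symm))
    have hl : ∀ x, ρ i x * π i e = π i e := fun x => by rw [← hπ, ← map_mul, hleft]
    have hr : ∀ x, π i e * ρ i x = π i e := fun x => by rw [← hπ, ← map_mul, hright]
    obtain ⟨c, hc⟩ := hcentral i (π i e) fun x => (hr x).trans (hl x).symm
    have hc0 : c ≠ 0 := by
      rintro rfl
      exact hi (hc.trans (zero_smul _ _))
    refine ⟨i, fun x => ?_⟩
    have := hl x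
    rw [hc, mul_smul_comm, mul_one] at this
    exact smul_right_injective _ hc0 this
  have hint : ∀ i, IsIntegral ℤ (ρ i g).trace := fun i =>
    Matrix.isIntegral_trace_of_pow_eq_one Nat.card_pos (hpow i g)
  -- The class sum is integral over ℤ and acts on each component as a scalar, namely this central
  -- character value.
  have hclass : ∀ i, IsIntegral ℤ (((q ^ k : ℕ) : ℂ) * (ρ i g).trace / d i) := by
    intro i
    have hdi := hd i
    set S := ∑ x : {x // IsConj g x}, ρ i x with hS
    have hSint : IsIntegral ℤ S := by
      have h1 : IsIntegral ℤ (∑ x : {x // IsConj g x}, single (x : G) (1 : ℤ)) :=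
        IsIntegral.of_finite ℤ _
      have h2 := h1.map (lift ℤ (Matrix (Fin (d i)) (Fin (d i)) ℂ) G (ρ i))
      rw [map_sum] at h2
      simpa using h2
    obtain ⟨c, hc⟩ := hcentral i S fun y => by
      change S * ρ i y = ρ i y * S
      rw [hS, Finset.sum_mul, Finset.mul_sum]
      let e : {x // IsConj g x} ≃ {x // IsConj g x} :=
        (MulAut.conj y⁻¹).toEquiv.subtypeEquiv fun x => by
          refine ⟨fun h => h.trans (isConj_iff.2 ⟨y⁻¹, rfl⟩), fun h => h.trans (isConj_iff.2 ⟨y, ?_⟩)⟩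
          simp [mul_assoc]
      refine Fintype.sum_equiv e _ _ fun x => ?_
      rw [← map_mul, ← map_mul]
      congr 1
      change (x : G) * y = y * (y⁻¹ * x * y⁻¹⁻¹)
      group
    have hcint : IsIntegral ℤ c := by
      rw [hc, ← Algebra.algebraMap_eq_smul_one] at hSint
      exact (isIntegral_algHom_iff
        ((algebraMap ℂ (Matrix (Fin (d i)) (Fin (d i)) ℂ)).toIntAlgHom)
        (algebraMap ℂ (Matrix (Fin (d i)) (Fin (d i)) ℂ)).injective).1 hSint
    have htr : ((q ^ k : ℕ) : ℂ) * (ρ i g).trace = c * d i := by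
      have h1 := congrArg Matrix.trace hc
      rw [Matrix.trace_smul, Matrix.trace_one, Fintype.card_fin, hS, Matrix.trace_sum] at h1
      have h2 : ∀ x : {x // IsConj g x}, (ρ i x).trace = (ρ i g).trace := by
        rintro ⟨x, hx⟩
        obtain ⟨y, rfl⟩ := isConj_iff.1 hx
        rw [map_mul, map_mul, Matrix.trace_mul_comm, ← mul_assoc, ← map_mul, inv_mul_cancel,
          map_one, one_mul]
      rw [Finset.sum_congr rfl fun x _ => h2 x, Finset.sum_const, Finset.card_univ,
        ← Nat.card_eq_fintype_card, hk, nsmul_eq_mul] at h1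
      rw [h1, smul_eq_mul]
    rw [htr, mul_div_cancel_right₀ _ (by exact_mod_cast hdi.out)]
    exact hcint
  -- If q does not divide the degree, Bézout makes the normalised trace integral. The trace is then
  -- 0 or g acts as a scalar, and the latter would make the component trivial by simplicity.
  have hother : ∀ i, i ≠ i₀ → ∃ β : ℂ, IsIntegral ℤ β ∧ (d i : ℂ) * (ρ i g).trace = q * β := by
    intro i hi
    have hdi := hd i
    by_cases hqd : q ∣ d i
    · obtain ⟨m, hm⟩ := hqd
      refine ⟨m * (ρ i g).trace, ((isIntegral_algebraMap (R := ℤ) (x := (m : ℤ))).mul (hint i)), ?_⟩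
      have hm' : (d i : ℂ) = q * m := by rw [hm]; push_cast; rfl
      rw [hm', mul_assoc]
    · refine ⟨0, isIntegral_zero, ?_⟩
      have hcop : IsCoprime (((q ^ k : ℕ) : ℤ)) (d i : ℤ) := by
        rw [Nat.isCoprime_iff_coprime]
        exact ((Nat.Prime.coprime_iff_not_dvd hq).2 hqd).pow_left k
      obtain ⟨a, b, hab⟩ := hcop
      have hab' : (a : ℂ) * ((q ^ k : ℕ) : ℂ) + b * d i = 1 := by exact_mod_cast hab
      have hd0 : (d i : ℂ) ≠ 0 := by exact_mod_cast hdi.out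
      have h1 : (ρ i g).trace / d i =
          a * (((q ^ k : ℕ) : ℂ) * (ρ i g).trace / d i) + b * (ρ i g).trace := by
        calc (ρ i g).trace / d i = (a * ((q ^ k : ℕ) : ℂ) + b * d i) * ((ρ i g).trace / d i) := by
              rw [hab', one_mul]
          _ = _ := by field_simp
      have h2 : IsIntegral ℤ ((ρ i g).trace / d i) := by
        rw [h1]
        exact ((isIntegral_algebraMap (R := ℤ) (x := a)).mul (hclass i)).add
          ((isIntegral_algebraMap (R := ℤ) (x := b)).mul (hint i))
      rcases Matrix.trace_eq_zero_or_eq_smul_one hdi.out Nat.card_pos (hpow i g) h2 with h3 | ⟨c, hc⟩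
      · rw [h3]; simp
      · refine absurd (hunique i i₀ ?_ hi₀) hi
        refine (ρ i).eq_one_of_forall_commute hG hg fun y => ?_
        rw [hc]
        exact (Commute.one_left _).smul_left c
  choose! β hβint hβ using hother
  have h₀ : (d i₀ : ℂ) * (ρ i₀ g).trace = 1 := by
    have hd1 : (d i₀ : ℂ) = 1 := by rw [hdim i₀ hi₀, Nat.cast_one]
    rw [hi₀ g, Matrix.trace_one, Fintype.card_fin, hd1, one_mul]
  rw [← Finset.add_sum_erase _ _ (Finset.mem_univ i₀), h₀, Finset.sum_congr rfl fun i hi => hβ i (Finset.ne_of_mem_erase hi),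
    ← Finset.mul_sum] at hsum
  set γ := ∑ i ∈ Finset.univ.erase i₀, β i
  have hγ : IsIntegral ℤ γ := IsIntegral.sum _ fun i hi => hβint i (Finset.ne_of_mem_erase hi)
  have hq0 : (q : ℂ) ≠ 0 := by exact_mod_cast hq.ne_zero
  -- Isolating the unique trivial component leaves 1 + qγ = 0 with γ an algebraic integer, so −1/q
  -- would be an integer.
  have hγq : γ = algebraMap ℚ ℂ (-1 / q) := by
    have : (q : ℂ) * γ = -1 := by
      have h1 : (1 : ℂ) + q * γ = 0 := by simpa using hsum
      linear_combination h1
    rw [eq_comm]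
    push_cast [map_div₀]
    rw [← this]
    simp [hq0]
  rw [hγq] at hγ
  have h1 : IsIntegral ℤ (-1 / q : ℚ) :=
    (isIntegral_algHom_iff ((algebraMap ℚ ℂ).toIntAlgHom) (algebraMap ℚ ℂ).injective).1 hγ
  obtain ⟨m, hm⟩ := IsIntegrallyClosed.isIntegral_iff.1 h1
  have hq0' : (q : ℚ) ≠ 0 := by exact_mod_cast hq.ne_zero
  have h2 : (m : ℚ) * q = -1 := by
    rw [eq_div_iff hq0'] at hm
    exact hm
  have h3 : m * q = -1 := by exact_mod_cast h2
  have h4 : (q : ℤ) ∣ 1 := ⟨-m, by linarith⟩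
  exact hq.one_lt.ne' (by exact_mod_cast Int.eq_one_of_dvd_one (by positivity) h4)

theorem card_isConj [Finite G] (g : G) :
    Nat.card {x // IsConj g x} = (Subgroup.centralizer {g}).index := by
  have h1 := MulAction.index_stabilizer (ConjAct G) g
  rw [ConjAct.stabilizer_eq_centralizer, ConjAct.orbit_eq_carrier_conjClasses] at h1
  have h2 : (Subgroup.centralizer {ConjAct.toConjAct g}).index =
    (Subgroup.centralizer {g}).index := rfl
  rw [← h2, h1, Set.ncard]
  refine Nat.card_congr (Equiv.subtypeEquivRight fun x => ?_)
  rw [ConjClasses.mem_carrier_iff_mk_eq, ConjClasses.mk_eq_mk_iff_isConj, isConj_comm]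

end ClassSize

/-! ### The minimal configuration in the coprime case and the structure of M. -/

section Configuration

variable {G : Type*} [Group G]

/-- `L` is a nilpotent Hall subgroup of `K` for the set of prime divisors of `a`. -/
structure IsNilHall (a : ℕ) (L K : Subgroup G) : Prop where
  le : L ≤ K
  isNilpotent : Group.IsNilpotent L
  dvd_of_dvd_card : ∀ p : ℕ, p.Prime → p ∣ Nat.card L → p ∣ a
  not_dvd_relIndex : ∀ p : ℕ, p.Prime → p ∣ a → ¬ p ∣ L.relIndex K

theorem IsNilHall.coprime_relIndex {a : ℕ} {L K : Subgroup G} (h : IsNilHall a L K) :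
    a.Coprime (L.relIndex K) :=
  Nat.coprime_of_dvd fun p hp hpa hd => h.not_dvd_relIndex p hp hpa hd

theorem IsNilHall.trans {a : ℕ} {L K J : Subgroup G} (h : IsNilHall a L K) (hKJ : K ≤ J)
    (hd : ∀ p : ℕ, p.Prime → p ∣ a → ¬ p ∣ K.relIndex J) : IsNilHall a L J :=
  ⟨h.le.trans hKJ, h.isNilpotent, h.dvd_of_dvd_card, fun p hp hpa hdvd => by
    rw [← Subgroup.relIndex_mul_relIndex L K J h.le hKJ, hp.dvd_mul] at hdvd
    exact hdvd.elim (h.not_dvd_relIndex p hp hpa) (hd p hp hpa)⟩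

/-- A nonabelian simple group `G = AB` with `A`, `B` nilpotent of coprime orders, neither of them
of prime power order, in which all proper subgroups with a similar factorization are solvable,
together with maximal subgroups `M ≥ A` and `H ≥ B`. -/
structure SimpleFactorization (A B M H : Subgroup G) : Prop where
  isSimpleGroup : IsSimpleGroup G
  not_isSolvable : ¬ Group.IsSolvable G
  nilA : Group.IsNilpotent A
  nilB : Group.IsNilpotent B
  coprime : (Nat.card A).Coprime (Nat.card B)
  exists_mul : ∀ x : G, ∃ a ∈ A, ∃ b ∈ B, x = a * b
  -- Phrased through orders, since the nilpotent subgroups to which it is applied need not lie in A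
  -- and B.
  isSolvable : ∀ K L W : Subgroup G, K ≠ ⊤ → L ≤ K → W ≤ K → Group.IsNilpotent L →
    Group.IsNilpotent W → (Nat.card L).Coprime (Nat.card W) →
    Nat.card K ∣ Nat.card L * Nat.card W → Group.IsSolvable K
  exists_prime_ne_A : ∀ p : ℕ, ∃ r : ℕ, r.Prime ∧ r ≠ p ∧ r ∣ Nat.card A
  exists_prime_ne_B : ∀ p : ℕ, ∃ r : ℕ, r.Prime ∧ r ≠ p ∧ r ∣ Nat.card B
  isCoatom_M : IsCoatom M
  A_le : A ≤ M
  isCoatom_H : IsCoatom H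
  B_le : B ≤ H

theorem dvd_card_of_isPElt_mem {K : Subgroup G} {p : ℕ} (hp : p.Prime) {x : G} (hxK : x ∈ K)
    (hx : IsPElt p x) (hx1 : x ≠ 1) : p ∣ Nat.card K := by
  refine dvd_trans ?_ (Subgroup.card_dvd_of_le (Subgroup.zpowers_le.2 hxK))
  obtain ⟨k, hk⟩ := hx.orderOf_eq hp
  rw [Nat.card_zpowers, hk]
  refine dvd_pow_self p fun h0 => hx1 ?_
  rwa [h0, pow_zero, orderOf_eq_one_iff] at hk

namespace SimpleFactorization

variable {A B M H : Subgroup G}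

theorem symm (h : SimpleFactorization A B M H) : SimpleFactorization B A H M where
  isSimpleGroup := h.isSimpleGroup
  not_isSolvable := h.not_isSolvable
  nilA := h.nilB
  nilB := h.nilA
  coprime := h.coprime.symm
  exists_mul := forall_exists_mul_symm h.exists_mul
  isSolvable := h.isSolvable
  exists_prime_ne_A := h.exists_prime_ne_B
  exists_prime_ne_B := h.exists_prime_ne_A
  isCoatom_M := h.isCoatom_H
  A_le := h.B_le
  isCoatom_H := h.isCoatom_M
  B_le := h.A_le

theorem not_dvd (h : SimpleFactorization A B M H) {p : ℕ} (hp : p.Prime) (hA : p ∣ Nat.card A) :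
    ¬ p ∣ Nat.card B := fun hB => hp.one_lt.ne' (Nat.eq_one_of_dvd_coprimes h.coprime hA hB)

theorem relIndex_top_dvd (h : SimpleFactorization A B M H) :
    A.relIndex ⊤ ∣ Nat.card B := by
  rw [relIndex_of_forall_exists_mul' le_top fun k _ => h.exists_mul k]
  exact Subgroup.relIndex_dvd_card A B

theorem ne_top_of_isSolvable (h : SimpleFactorization A B M H) {K : Subgroup G}
    (hK : Group.IsSolvable K) : K ≠ ⊤ := by
  rintro rfl
  exact h.not_isSolvable (Group.isSolvable_of_surjective (f := (⊤ : Subgroup G).subtype)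
    fun x => ⟨⟨x, Subgroup.mem_top x⟩, rfl⟩)

theorem normalizer_ne_top (h : SimpleFactorization A B M H) {D : Subgroup G}
    (hD : D ≠ ⊥) (hDt : D ≠ ⊤) : Subgroup.normalizer (D : Set G) ≠ ⊤ := fun h0 => by
  have := h.isSimpleGroup
  exact (Subgroup.normalizer_eq_top_iff.1 h0).eq_bot_or_eq_top.elim hD hDt

theorem exists_mul_of_mem (h : SimpleFactorization A B M H) {K : Subgroup G} (hK : A ≤ K) {k : G}
    (hk : k ∈ K) : ∃ a ∈ A, ∃ b ∈ B ⊓ K, k = a * b := by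
  obtain ⟨a, ha, b, hb, rfl⟩ := h.exists_mul k
  exact ⟨a, ha, b, ⟨hb, (K.mul_mem_cancel_left (hK ha)).1 hk⟩, rfl⟩

theorem card_dvd (h : SimpleFactorization A B M H) (K : Subgroup G) :
    Nat.card K ∣ Nat.card A * Nat.card B := by
  refine (Subgroup.card_dvd_of_le le_top).trans ?_
  rw [← card_mul_relIndex (le_top (a := A))]
  exact Nat.mul_dvd_mul_left _ h.relIndex_top_dvd

theorem ne_top_of_isNilpotent (h : SimpleFactorization A B M H) {K : Subgroup G}
    (hK : Group.IsNilpotent K) : K ≠ ⊤ := h.ne_top_of_isSolvable inferInstance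

theorem isNilHall_of_le (h : SimpleFactorization A B M H) {K : Subgroup G} (hK : A ≤ K) :
    IsNilHall (Nat.card A) A K :=
  ⟨hK, h.nilA, fun _ _ hd => hd, fun _ hp hpA hd => h.not_dvd hp hpA
    (hd.trans ((Dvd.intro _ (Subgroup.relIndex_mul_relIndex A K ⊤ hK le_top)).trans
      h.relIndex_top_dvd))⟩

theorem isNilHall_inf (h : SimpleFactorization A B M H) {K : Subgroup G} (hK : A ≤ K) :
    IsNilHall (Nat.card B) (B ⊓ K) K :=
  ⟨inf_le_right, h.nilB.mono inf_le_left,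
    fun _ _ hd => hd.trans (Subgroup.card_dvd_of_le inf_le_left), fun p hp hpB hd => by
      rw [relIndex_of_forall_exists_mul hK fun k hk => h.exists_mul_of_mem hK hk] at hd
      exact h.symm.not_dvd hp hpB (hd.trans (Subgroup.relIndex_dvd_card _ _))⟩

theorem dvd_or_dvd (h : SimpleFactorization A B M H) {p : ℕ} (hp : p.Prime) {K : Subgroup G}
    (hd : p ∣ Nat.card K) : p ∣ Nat.card A ∨ p ∣ Nat.card B :=
  hp.dvd_mul.1 (hd.trans (h.card_dvd K))

/-- |K| divides |A||B|, so only primes of A and B occur, and nilpotent Hall subgroups for these two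
sets of primes account for all of |K|. -/
theorem isSolvable_of_isNilHall (h : SimpleFactorization A B M H) {K L W : Subgroup G}
    (hK : K ≠ ⊤) (hL : IsNilHall (Nat.card A) L K) (hW : IsNilHall (Nat.card B) W K) :
    Group.IsSolvable K := by
  refine h.isSolvable K L W hK hL.le hW.le hL.isNilpotent hW.isNilpotent ?_ ?_
  · exact Nat.coprime_of_dvd fun p hp h1 h2 =>
      h.not_dvd hp (hL.dvd_of_dvd_card p hp h1) (hW.dvd_of_dvd_card p hp h2)
  · rw [← card_mul_relIndex hL.le]
    refine Nat.mul_dvd_mul_left _ ?_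
    have h1 : L.relIndex K ∣ Nat.card B :=
      (hL.coprime_relIndex.symm).dvd_of_dvd_mul_left
        ((Subgroup.relIndex_dvd_card L K).trans (h.card_dvd K))
    have h2 : L.relIndex K ∣ Nat.card W * W.relIndex K := by
      rw [card_mul_relIndex hW.le]
      exact Subgroup.relIndex_dvd_card L K
    exact (hW.coprime_relIndex.coprime_dvd_left h1).dvd_of_dvd_mul_right h2

/-- A subgroup of `B` normalised by `A` is trivial. -/
theorem eq_bot_of_conj_mem (h : SimpleFactorization A B M H) {Y : Subgroup G} (hY : Y ≤ B)
    (hA : ∀ a ∈ A, ∀ y ∈ Y, a * y * a⁻¹ ∈ Y) : Y = ⊥ := by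
  have := h.isSimpleGroup
  -- Every g is ba with b in B and a in A, so every conjugate of Y stays in B.
  have h1 : Subgroup.normalClosure (Y : Set G) ≤ B := by
    refine (Subgroup.closure_le _).2 fun x hx => ?_
    obtain ⟨y, hy, hyx⟩ := Group.mem_conjugatesOfSet_iff.1 hx
    obtain ⟨g, rfl⟩ := isConj_iff.1 hyx
    obtain ⟨b, hb, a, ha, rfl⟩ := h.symm.exists_mul g
    have h2 := B.mul_mem (B.mul_mem hb (hY (hA a ha y hy))) (B.inv_mem hb)
    simpa [mul_assoc] using h2
  rcases (Subgroup.normalClosure_normal (s := (Y : Set G))).eq_bot_or_eq_top with h0 | h0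
  · exact le_bot_iff.1 (h0 ▸ Subgroup.le_normalClosure)
  · exact absurd (top_le_iff.1 (h0 ▸ h1)) (h.ne_top_of_isNilpotent h.nilB)

theorem dvd_of_isPElt (h : SimpleFactorization A B M H) {p : ℕ} (hp : p.Prime) {x : G}
    (hx : IsPElt p x) (hx1 : x ≠ 1) : p ∣ Nat.card A ∨ p ∣ Nat.card B := by
  refine h.dvd_or_dvd hp (K := Subgroup.zpowers x) ?_
  obtain ⟨k, hk⟩ := hx.orderOf_eq hp
  rw [Nat.card_zpowers, hk]
  refine dvd_pow_self p fun h0 => hx1 ?_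
  rwa [h0, pow_zero, orderOf_eq_one_iff] at hk

theorem isSolvable_of_le (h : SimpleFactorization A B M H) {K : Subgroup G} (hK : A ≤ K)
    (hKt : K ≠ ⊤) : Group.IsSolvable K :=
  h.isSolvable_of_isNilHall hKt (h.isNilHall_of_le hK) (h.isNilHall_inf hK)

theorem isSolvable_M (h : SimpleFactorization A B M H) : Group.IsSolvable M :=
  h.isSolvable_of_le h.A_le h.isCoatom_M.1

variable [Finite G]

theorem isSylowIn_pPart (h : SimpleFactorization A B M H) {p : ℕ} (hp : p.Prime)
    (hpA : p ∣ Nat.card A) : IsSylowIn p (pPart A p) ⊤ :=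
  (h.nilA.isSylowIn_pPart hp).trans hp le_top fun hd =>
    h.not_dvd hp hpA (hd.trans h.relIndex_top_dvd)

theorem isSylowIn_pPart_of_le (h : SimpleFactorization A B M H) {K : Subgroup G} {p : ℕ}
    (hp : p.Prime) (hpA : p ∣ Nat.card A) (hK : pPart A p ≤ K) : IsSylowIn p (pPart A p) K :=
  (h.isSylowIn_pPart hp hpA).mono hK le_top

theorem normalizer_ne_top_of_isPGroup (h : SimpleFactorization A B M H) {p : ℕ} (hp : p.Prime)
    {D : Subgroup G} (hD : D ≠ ⊥) (hDp : IsPGroup p D) : Subgroup.normalizer (D : Set G) ≠ ⊤ :=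
  h.normalizer_ne_top hD (h.ne_top_of_isNilpotent (hDp.isNilpotent_subgroup hp))

theorem pPart_ne_bot (h : SimpleFactorization A B M H) {p : ℕ} (hp : p.Prime)
    (hpA : p ∣ Nat.card A) : pPart A p ≠ ⊥ := by
  have := h.nilA
  exact _root_.pPart_ne_bot hp hpA

/-- A normal `p`-subgroup of an overgroup `K` of `A` lies in `A`. -/
theorem le_of_conj_mem (h : SimpleFactorization A B M H) {K Y : Subgroup G} (hK : A ≤ K)
    {p : ℕ} (hp : p.Prime) (hY : IsPGroup p Y) (hYK : Y ≤ K)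
    (hn : ∀ k ∈ K, ∀ y ∈ Y, k * y * k⁻¹ ∈ Y) : Y ≤ pPart A p := by
  rcases eq_or_ne Y ⊥ with rfl | hY1
  · exact bot_le
  obtain ⟨⟨y, hy⟩, hy1⟩ := (Subgroup.ne_bot_iff_exists_ne_one).1 hY1
  have hy1' : y ≠ 1 := fun h0 => hy1 (Subtype.ext h0)
  rcases h.dvd_of_isPElt hp (hY.isPElt hy) hy1' with hpA | hpB
  · exact (h.isSylowIn_pPart_of_le hp hpA ((pPart_le A p).trans hK)).le_of_conj_mem hp hY hYK hn
  -- For p dividing |B|, Y lies in the Sylow p-subgroup of B ∩ K, hence in B, and A normalises it.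
  · refine absurd (h.eq_bot_of_conj_mem ?_ fun a ha => hn a (hK ha)) hY1
    have h1 := (h.isNilHall_inf hK)
    have h2 : IsSylowIn p (pPart (B ⊓ K) p) K :=
      (h1.isNilpotent.isSylowIn_pPart hp).trans hp inf_le_right (h1.not_dvd_relIndex p hp hpB)
    exact (h2.le_of_conj_mem hp hY hYK hn).trans ((pPart_le _ _).trans inf_le_left)

theorem fit_le (h : SimpleFactorization A B M H) {F : Subgroup G} (hF : IsFit F M) : F ≤ A :=
  le_of_forall_pPart_le fun _ hp => (h.le_of_conj_mem h.A_le hp (hF.isNilpotent.isPGroup_pPart hp)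
    ((pPart_le _ _).trans hF.le) fun _ hm _ hx => hF.conj_mem_pPart hm hx).trans (pPart_le _ _)

/-- Since F ≤ A with A nilpotent, the p-part of A centralises all r-parts of F for r ≠ p. If the
p-part of F vanished, that of A would centralise F and hence lie in it. -/
theorem pPart_fit_ne_bot (h : SimpleFactorization A B M H) {F : Subgroup G} (hF : IsFit F M)
    {p : ℕ} (hp : p.Prime) (hpA : p ∣ Nat.card A) : pPart F p ≠ ⊥ := by
  intro h0
  refine h.pPart_ne_bot hp hpA (le_bot_iff.1 (h0 ▸ fun x hx => ?_))
  rw [h.nilA.mem_pPart_iff hp] at hx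
  refine mem_pPart_of_mem (hF.mem_of_commute x (h.A_le hx.1) fun f hf => ?_) hx.2
  have key : F ≤ Subgroup.centralizer {x} := by
    refine le_of_forall_pPart_le fun t ht => (Subgroup.closure_le _).2 fun f hf => ?_
    refine Subgroup.mem_centralizer_singleton_iff.2 (Commute.symm (?_ : Commute x f))
    rcases eq_or_ne t p with rfl | htp
    · have : f ∈ pPart F t := mem_pPart_of_mem hf.1 hf.2
      rw [h0, Subgroup.mem_bot] at this
      rw [this]; exact Commute.one_right _
    · exact h.nilA.commute_of_isPElt hp ht htp.symm hx.1 (h.fit_le hF hf.1) hx.2 hf.2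
  exact (Subgroup.mem_centralizer_singleton_iff.1 (key hf)).symm

/-- For distinct prime divisors `p`, `r` of `|A|`, the `p`-elements and `r`-elements of `M`
commute. -/
theorem commute (h : SimpleFactorization A B M H) {p r : ℕ} (hp : p.Prime) (hr : r.Prime)
    (hpr : p ≠ r) (hpA : p ∣ Nat.card A) (hrA : r ∣ Nat.card A) {x y : G} (hx : x ∈ M) (hy : y ∈ M)
    (hxp : IsPElt p x) (hyr : IsPElt r y) : Commute x y := by
  have := h.isSolvable_M
  obtain ⟨F, hF⟩ := exists_isFit M
  have key : ∀ p : ℕ, p.Prime → p ∣ Nat.card A → ∀ t : ℕ, t.Prime → t ≠ p → ∀ x ∈ M, ∀ f ∈ F,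
      IsPElt p x → IsPElt t f → Commute x f := by
    intro p hp hpA t ht htp x hx f hf hxp hft
    -- A p-element of M is conjugate in M into A, and A is nilpotent and contains F; so p-elements
    -- of M centralise the p'-part of F.
    obtain ⟨k, hk, hkx⟩ := (h.isSylowIn_pPart_of_le hp hpA
      ((pPart_le A p).trans h.A_le)).exists_conj_mem hp hxp hx
    have h1 := hF.conj_mem k⁻¹ (M.inv_mem hk) f hf
    rw [inv_inv] at h1
    have h2 := h.nilA.commute_of_isPElt hp ht htp.symm (pPart_le _ _ hkx) (h.fit_le hF h1)
      (hxp.conj' k) (hft.conj' k)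
    have h3 := h2.map (MulAut.conj k)
    simpa [mul_assoc] using h3
  exact hF.commute hp hr hpr (key p hp hpA) (key r hr hrA) hx hy hxp hyr

theorem normalizer_le_of_conj_mem (h : SimpleFactorization A B M H) {D : Subgroup G}
    (hD : D ≠ ⊥) (hDM : D ≤ M) (hn : ∀ m ∈ M, ∀ x ∈ D, m * x * m⁻¹ ∈ D) :
    Subgroup.normalizer (D : Set G) = M := by
  have h1 : M ≤ Subgroup.normalizer (D : Set G) := fun m hm => mem_normalizer_of_conj_mem (hn m hm)
  refine (h.isCoatom_M.le_iff.1 h1).resolve_left (h.normalizer_ne_top hD ?_)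
  rintro rfl
  exact h.isCoatom_M.1 (top_le_iff.1 hDM)

/-- Elements centralising the `r'`-part of `A` lie in `M`. -/
theorem mem_of_forall_commute (h : SimpleFactorization A B M H) {r : ℕ} {x : G}
    (hx : ∀ p : ℕ, p.Prime → p ≠ r → ∀ a ∈ pPart A p, Commute x a) : x ∈ M := by
  have := h.isSolvable_M
  obtain ⟨F, hF⟩ := exists_isFit M
  obtain ⟨p, hp, hpr, hpA⟩ := h.exists_prime_ne_A r
  rw [← h.normalizer_le_of_conj_mem (h.pPart_fit_ne_bot hF hp hpA) ((pPart_le _ _).trans hF.le)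
    fun m hm y hy => hF.conj_mem_pPart hm hy]
  refine mem_normalizer_of_conj_mem fun y hy => ?_
  have h1 : y ∈ pPart A p := by
    have := (hF.isNilpotent.mem_pPart_iff hp).1 hy
    exact mem_pPart_of_mem (h.fit_le hF this.1) this.2
  rw [(hx p hp hpr y h1).eq, mul_inv_cancel_right]
  exact hy

/-- Describes the r-elements of M in terms of A alone; this is what makes M the unique maximal
subgroup above A. -/
theorem forall_commute_iff (h : SimpleFactorization A B M H) {r : ℕ} (hr : r.Prime)
    (hrA : r ∣ Nat.card A) {x : G} (hx : IsPElt r x) :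
    (∀ p : ℕ, p.Prime → p ≠ r → ∀ a ∈ pPart A p, Commute x a) ↔ x ∈ M := by
  refine ⟨h.mem_of_forall_commute, fun hxM p hp hpr a ha => ?_⟩
  rw [h.nilA.mem_pPart_iff hp] at ha
  rcases eq_or_ne a 1 with rfl | ha1
  · exact Commute.one_right _
  exact h.commute hr hp hpr.symm hrA (dvd_card_of_isPElt_mem hp ha.1 ha.2 ha1) hxM (h.A_le ha.1) hx ha.2

/-- `M` is the only maximal subgroup containing `A`. -/
theorem eq_M (h : SimpleFactorization A B M H) {M' : Subgroup G} (hM' : IsCoatom M')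
    (hA : A ≤ M') : M' = M := by
  have h' : SimpleFactorization A B M' H := { h with isCoatom_M := hM', A_le := hA }
  obtain ⟨r, hr, -, hrA⟩ := h.exists_prime_ne_A 0
  have hX : pPart M r = pPart M' r := by
    have : {x | x ∈ M ∧ IsPElt r x} = {x | x ∈ M' ∧ IsPElt r x} := by
      ext x
      refine and_congr_left fun hx => ?_
      rw [← h.forall_commute_iff hr hrA hx, h'.forall_commute_iff hr hrA hx]
    rw [pPart, this, pPart]
  have hne : pPart M r ≠ ⊥ := _root_.pPart_ne_bot hr (hrA.trans (Subgroup.card_dvd_of_le h.A_le))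
  have key : ∀ K : Subgroup G, ∀ m ∈ K, ∀ x ∈ pPart K r, m * x * m⁻¹ ∈ pPart K r :=
    fun K m hm x hx => conj_mem_pPart (fun a ha => K.mul_mem (K.mul_mem hm ha) (K.inv_mem hm)) hx
  rw [← h.normalizer_le_of_conj_mem hne (pPart_le _ _) (key M), hX]
  exact (h'.normalizer_le_of_conj_mem (hX ▸ hne) (pPart_le _ _) (key M')).symm

theorem le_M (h : SimpleFactorization A B M H) {K : Subgroup G} (hK : K ≠ ⊤) (hA : A ≤ K) :
    K ≤ M := by
  obtain ⟨M', hM', hKM'⟩ := (IsCoatomic.eq_top_or_exists_le_coatom K).resolve_left hK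
  rwa [← h.eq_M hM' (hA.trans hKM')]

/-- Hall subgroups of the solvable group K exist, and those for the primes of A are nilpotent
because elements of M of the relevant coprime orders commute. -/
theorem exists_isNilHall (h : SimpleFactorization A B M H) {K : Subgroup G} (hK : K ≤ M) :
    ∃ L, IsNilHall (Nat.card A) L K := by
  have := h.isSolvable_M
  have : Group.IsSolvable K :=
    Group.isSolvable_of_isSolvable_injective (Subgroup.inclusion_injective hK)
  obtain ⟨L, hL1, hL2⟩ := exists_hall_subgroup (fun p => p ∣ Nat.card A) _ K rfl
  have hcard : Nat.card (L.map K.subtype) = Nat.card L :=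
    (Nat.card_congr (L.equivMapOfInjective _ K.subtype_injective).toEquiv).symm
  have hidx : (L.map K.subtype).relIndex K = L.index := by
    rw [Subgroup.relIndex, Subgroup.subgroupOf, Subgroup.comap_map_eq_self_of_injective
      K.subtype_injective]
  have hle : L.map K.subtype ≤ K := Subgroup.map_subtype_le L
  have hd : ∀ p : ℕ, p.Prime → p ∣ Nat.card (L.map K.subtype) → p ∣ Nat.card A :=
    fun p hp hd => hL1 p hp (hcard ▸ hd)
  refine ⟨L.map K.subtype, hle, isNilpotent_of_forall_commute ?_, hd, fun p hp hpA hd =>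
    hL2 p hp (hidx ▸ hd) hpA⟩
  intro p r hp hr hpr x hx y hy hxp hyr
  rcases eq_or_ne x 1 with rfl | hx1
  · exact Commute.one_left _
  rcases eq_or_ne y 1 with rfl | hy1
  · exact Commute.one_right _
  exact h.commute hp hr hpr (hd p hp (dvd_card_of_isPElt_mem hp hx hxp hx1))
    (hd r hr (dvd_card_of_isPElt_mem hr hy hyr hy1)) (hK (hle hx)) (hK (hle hy)) hxp hyr

end SimpleFactorization

/-- At most one conjugate of `M` contains `D`, where conjugates are indexed by cosets of `M`. -/
def Uniq (M D : Subgroup G) : Prop :=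
  ∀ g k : G, D ≤ MulAut.conj g • M → D ≤ MulAut.conj k • M → g⁻¹ * k ∈ M

theorem Uniq.mono {M D D' : Subgroup G} (h : Uniq M D) (hD : D ≤ D') : Uniq M D' :=
  fun g k hg hk => h g k (hD.trans hg) (hD.trans hk)

theorem Uniq.conj_smul {M D : Subgroup G} (h : Uniq M D) (x : G) :
    Uniq M (MulAut.conj x • D) := fun g k hg hk => by
  have key : ∀ g : G, MulAut.conj x • D ≤ MulAut.conj g • M → D ≤ MulAut.conj (x⁻¹ * g) • M := by
    intro g hg
    have := conj_smul_le_conj_smul (g := x⁻¹) hg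
    rwa [conj_inv_smul_conj_smul, ← conj_mul_smul] at this
  have := h _ _ (key g hg) (key k hk)
  simpa [mul_assoc] using this

theorem Uniq.mem {M D : Subgroup G} (h : Uniq M D) (hD : D ≤ M) {g : G}
    (hg : D ≤ MulAut.conj g • M) : g ∈ M := by
  have := h 1 g (by simpa using hD) hg
  simpa using this

theorem Uniq.normalizer_le {M D : Subgroup G} (h : Uniq M D) (hD : D ≤ M) :
    Subgroup.normalizer (D : Set G) ≤ M := fun g hg => by
  refine h.mem hD ?_
  rw [← conj_smul_eq_iff_mem_normalizer.2 hg]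
  exact conj_smul_le_conj_smul hD

/-- A nilpotent overgroup of `T` lies in `M` if `T ≤ M` is contained in no other conjugate. -/
theorem Uniq.le_of_isNilpotent [Finite G] {M T S : Subgroup G} (h : Uniq M T) (hT : T ≤ M)
    (hTS : T ≤ S) (hS : Group.IsNilpotent S) : S ≤ M := by
  by_contra hSM
  -- Normalisers grow in S, whereas the normaliser of S ∩ M stays in M because S ∩ M contains T.
  have h1 : S ⊓ M < S := lt_of_le_of_ne inf_le_left fun h0 => hSM (inf_eq_left.1 h0)
  have h2 := hS.lt_inf_normalizer h1
  have h3 := (h.mono (le_inf hTS hT)).normalizer_le inf_le_right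
  exact h2.not_ge (le_inf inf_le_left (inf_le_right.trans h3))

end Configuration

/-! ### Subgroups lying in only one conjugate of M, and the intersection M ∩ H. -/

section Uniqueness

variable {G : Type*} [Group G]

theorem pPart_mono {A B : Subgroup G} (h : A ≤ B) (p : ℕ) : pPart A p ≤ pPart B p :=
  Subgroup.closure_mono fun _ hx => ⟨h hx.1, hx.2⟩

variable [Finite G]

theorem mem_normalizer_of_forall_commute {Y : Subgroup G} {x : G} (h : ∀ y ∈ Y, Commute x y) :
    x ∈ Subgroup.normalizer (Y : Set G) :=
  mem_normalizer_of_conj_mem fun y hy => by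
    rw [(h y hy).eq, mul_inv_cancel_right]
    exact hy

namespace SimpleFactorization

variable {A B M H : Subgroup G}

/-- A proper solvable subgroup cannot contain Sylow subgroups of `G` both for a divisor of `|A|`
and for a divisor of `|B|`. -/
theorem false_of_isSylowIn (h : SimpleFactorization A B M H) {E P Q : Subgroup G}
    (hE : Group.IsSolvable E) {p q : ℕ} (hp : p.Prime) (hq : q.Prime) (hpA : p ∣ Nat.card A)
    (hqB : q ∣ Nat.card B) (hP : IsSylowIn p P ⊤) (hQ : IsSylowIn q Q ⊤) (hPE : P ≤ E)
    (hQE : Q ≤ E) : False := by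
  have hpq : p ≠ q := fun e => h.not_dvd hp hpA (e ▸ hqB)
  obtain ⟨L, hL1, hL2⟩ := exists_hall_subgroup (fun t => t = p ∨ t = q) _ E rfl
  set R := L.map E.subtype with hR
  have hRE : R ≤ E := Subgroup.map_subtype_le L
  have hcard : Nat.card R = Nat.card L :=
    (Nat.card_congr (L.equivMapOfInjective _ E.subtype_injective).toEquiv).symm
  have hidx : R.relIndex E = L.index := by
    rw [Subgroup.relIndex, Subgroup.subgroupOf, Subgroup.comap_map_eq_self_of_injective
      E.subtype_injective]
  -- E contains full Sylow subgroups of G for p and q, so its Hall {p, q}-subgroup R does too.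
  have hSyl : ∀ {t : ℕ}, t.Prime → (t = p ∨ t = q) → ∀ {S T : Subgroup G}, IsSylowIn t S ⊤ →
      S ≤ E → IsSylowIn t T ⊤ → ∃ x : G, MulAut.conj x • T ≤ R := by
    intro t ht htpq S T hS hSE hT
    obtain ⟨S', hS'⟩ := exists_isSylowIn ht R
    have h1 : IsSylowIn t S' ⊤ := (hS'.trans ht hRE fun hd => hL2 t ht (hidx ▸ hd) htpq).trans ht
      le_top (hS.not_dvd_of_le hSE)
    obtain ⟨x, -, rfl⟩ := hT.exists_eq_conj ht h1
    exact ⟨x, hS'.le⟩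
  have hAp := h.isSylowIn_pPart hp hpA
  have hBq := h.symm.isSylowIn_pPart hq hqB
  obtain ⟨x, hx⟩ := hSyl hp (Or.inl rfl) hP hPE hAp
  obtain ⟨y, hy⟩ := hSyl hq (Or.inr rfl) hQ hQE hBq
  -- G is the product of A with any conjugate of B, so one conjugate of R can be moved by an element
  -- of A to contain the p-part of A and a prescribed conjugate of the q-part of B.
  have key : ∀ g : G, ∃ u : G, pPart A p ≤ MulAut.conj u • R ∧
      MulAut.conj g • pPart B q ≤ MulAut.conj u • R := by
    intro g
    obtain ⟨a, ha, b, hb, e⟩ := forall_exists_mul_conj h.exists_mul (x⁻¹ * y) (g * (x⁻¹ * y)⁻¹)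
    refine ⟨a * x⁻¹, ?_, ?_⟩
    · have := conj_smul_le_conj_smul (g := a * x⁻¹) hx
      rwa [← conj_mul_smul, inv_mul_cancel_right, conj_smul_pPart_of_mem ha] at this
    · have h1 := conj_smul_le_conj_smul (g := a * x⁻¹) hy
      rw [mem_conj_smul] at hb
      rw [← conj_smul_pPart_of_mem (B.inv_mem hb) q, ← conj_mul_smul]
      rw [← conj_mul_smul] at h1
      have h2 : g = a * b * (x⁻¹ * y) := by rw [← e]; group
      have h3 : g * ((x⁻¹ * y)⁻¹ * b * (x⁻¹ * y))⁻¹ = a * x⁻¹ * y := by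
        rw [h2]; group
      rwa [h3]
  have hperm : ∀ g : G, Permutes (pPart A p) (MulAut.conj g • pPart B q) := by
    intro g
    obtain ⟨u, h1, h2⟩ := key g
    refine permutes_of_forall_exists_mul h1 h2 fun k hk => exists_mul_of_relIndex_eq h2 ?_ hk
    have s1 := hAp.mono h1 le_top
    have s2 := (hBq.conj_smul_of_mem (Subgroup.mem_top g)).mono h2 le_top
    set Y := MulAut.conj g • pPart B q
    set R' := MulAut.conj u • R
    have hcR' : ∀ t : ℕ, t.Prime → t ∣ Nat.card R' → t = p ∨ t = q := fun t ht hd =>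
      hL1 t ht (by rwa [card_conj_smul, hcard] at hd)
    have c0 : (Nat.card (pPart A p)).Coprime (Nat.card Y) :=
      Nat.coprime_of_dvd fun t ht d1 d2 => h.not_dvd ht
        (d1.trans (Subgroup.card_dvd_of_le (pPart_le A p)))
        (by rw [card_conj_smul] at d2; exact d2.trans (Subgroup.card_dvd_of_le (pPart_le B q)))
    have c1 : ((pPart A p).relIndex R').Coprime (Y.relIndex R') :=
      Nat.coprime_of_dvd fun t ht d1 d2 => by
        rcases hcR' t ht (d1.trans (Subgroup.relIndex_dvd_card _ _)) with rfl | rfl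
        · exact s1.not_dvd d1
        · exact s2.not_dvd d2
    have e1 := card_mul_relIndex h1
    have e2 := card_mul_relIndex h2
    have e3 : (pPart A p).relIndex Y = Nat.card Y := by
      rw [← Subgroup.inf_relIndex_right, (Subgroup.disjoint_of_coprime_natCard c0).eq_bot,
        Subgroup.relIndex_bot_left]
    rw [e3]
    refine Nat.dvd_antisymm ?_ ?_
    · exact c1.dvd_of_dvd_mul_right (Dvd.intro_left _ (e1.trans e2.symm))
    · exact c0.symm.dvd_of_dvd_mul_left (Dvd.intro _ (e2.trans e1.symm))
  have := h.isSimpleGroup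
  -- By orders a conjugate of R is the product of the two Sylow subgroups, so they permute; Kegel's
  -- lemma makes them generate G, but R is proper.
  have htop := sup_eq_top_of_permutes (h.pPart_ne_bot hp hpA) (h.symm.pPart_ne_bot hq hqB) hperm
  obtain ⟨u, h1, h2⟩ := key 1
  rw [map_one, one_smul] at h2
  have h3 : MulAut.conj u • R = ⊤ := top_le_iff.1 (htop ▸ sup_le h1 h2)
  have h4 : R = ⊤ := by
    rw [← conj_inv_smul_conj_smul u R, h3, conj_smul_mem_self (Subgroup.mem_top _)]
  exact h.ne_top_of_isSolvable hE (top_le_iff.1 (h4 ▸ hRE))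

theorem normalizer_pPart_le (h : SimpleFactorization A B M H) {p : ℕ} (hp : p.Prime)
    (hpA : p ∣ Nat.card A) : Subgroup.normalizer (pPart A p : Set G) ≤ M :=
  h.le_M (h.normalizer_ne_top_of_isPGroup hp (h.pPart_ne_bot hp hpA) (h.nilA.isPGroup_pPart hp))
    fun _ ha => conj_smul_eq_iff_mem_normalizer.1 (conj_smul_pPart_of_mem ha p)

/-- If the conjugate of M by g contains T, then the conjugate by g of an r-part of A, r ≠ p,
centralises T and so lies in M. There it is a Sylow subgroup conjugate to the r-part of A, whose
normaliser lies in M; hence g ∈ M. -/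
theorem uniq_of_forall_commute (h : SimpleFactorization A B M H) {p : ℕ} (hp : p.Prime)
    (hpA : p ∣ Nat.card A) {T : Subgroup G} (hT : IsPGroup p T)
    (hC : ∀ x, (∀ t ∈ T, Commute x t) → x ∈ M) : Uniq M T := by
  have key : ∀ g : G, T ≤ MulAut.conj g • M → g ∈ M := by
    intro g hg
    obtain ⟨r, hr, hrp, hrA⟩ := h.exists_prime_ne_A p
    have h1 : MulAut.conj g • pPart A r ≤ M := by
      refine conj_smul_le_iff.2 fun a ha => hC _ fun t ht => ?_
      rw [h.nilA.mem_pPart_iff hr] at ha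
      have := (h.commute hr hp hrp hrA hpA (h.A_le ha.1) (mem_conj_smul.1 (hg ht)) ha.2
        ((hT.isPElt ht).conj' g)).map (MulAut.conj g)
      simpa [mul_assoc] using this
    obtain ⟨k, hk, e⟩ := (h.isSylowIn_pPart_of_le hr hrA
      ((pPart_le _ _).trans h.A_le)).exists_eq_conj hr
      (((h.isSylowIn_pPart hr hrA).conj_smul_of_mem (Subgroup.mem_top g)).mono h1 le_top)
    have h2 : k⁻¹ * g ∈ Subgroup.normalizer (pPart A r : Set G) := by
      rw [← conj_smul_eq_iff_mem_normalizer, conj_mul_smul, e, conj_inv_smul_conj_smul]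
    have := M.mul_mem hk (h.normalizer_pPart_le hr hrA h2)
    simpa using this
  exact fun g k hg hk => M.mul_mem (M.inv_mem (key g hg)) (key k hk)

theorem uniq_pPart (h : SimpleFactorization A B M H) {p : ℕ} (hp : p.Prime)
    (hpA : p ∣ Nat.card A) : Uniq M (pPart A p) :=
  h.uniq_of_forall_commute hp hpA (h.nilA.isPGroup_pPart hp)
    fun _ hx => h.normalizer_pPart_le hp hpA (mem_normalizer_of_forall_commute hx)

theorem uniq_of_isSylowIn (h : SimpleFactorization A B M H) {p : ℕ} (hp : p.Prime)
    (hpA : p ∣ Nat.card A) {T : Subgroup G} (hT : IsSylowIn p T ⊤) : Uniq M T := by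
  obtain ⟨k, -, rfl⟩ := (h.isSylowIn_pPart hp hpA).exists_eq_conj hp hT
  exact (h.uniq_pPart hp hpA).conj_smul k

/-- Take a nontrivial central element of the p-part of A. It is central in A, so its centralizer is
a proper subgroup containing A and lies in M. -/
theorem exists_uniq_zpowers (h : SimpleFactorization A B M H) {p : ℕ} (hp : p.Prime)
    (hpA : p ∣ Nat.card A) :
    ∃ z ∈ A, IsPElt p z ∧ (∀ a ∈ A, Commute z a) ∧ Uniq M (Subgroup.zpowers z) := by
  have : Fact p.Prime := ⟨hp⟩
  have hP := h.nilA.isPGroup_pPart hp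
  have : Nontrivial (pPart A p) := (Subgroup.nontrivial_iff_ne_bot _).2 (h.pPart_ne_bot hp hpA)
  have := hP.center_nontrivial
  obtain ⟨⟨z, hz⟩, hz1⟩ := exists_ne (1 : Subgroup.center (pPart A p))
  have hzA := (h.nilA.mem_pPart_iff hp).1 z.2
  have hcomm : ∀ a ∈ A, Commute (z : G) a := by
    have : A ≤ Subgroup.centralizer {(z : G)} := by
      refine le_of_forall_pPart_le fun t ht a ha => Subgroup.mem_centralizer_singleton_iff.2 ?_
      rcases eq_or_ne t p with rfl | htp
      · exact congrArg Subtype.val (Subgroup.mem_center_iff.1 hz ⟨a, ha⟩)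
      · exact (h.nilA.commute_pPart ht hp htp ha z.2).eq
    exact fun a ha => (Subgroup.mem_centralizer_singleton_iff.1 (this ha)).symm
  have hne : Subgroup.centralizer {(z : G)} ≠ ⊤ := by
    intro h0
    have := h.isSimpleGroup
    have hzc : (z : G) ∈ Subgroup.center G := Subgroup.mem_center_iff.2 fun g =>
      Subgroup.mem_centralizer_singleton_iff.1 (h0 ▸ Subgroup.mem_top g)
    rcases (inferInstance : (Subgroup.center G).Normal).eq_bot_or_eq_top with h1 | h1
    · rw [h1, Subgroup.mem_bot] at hzc
      exact hz1 (Subtype.ext (Subtype.ext hzc))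
    · exact h.not_isSolvable (Group.isSolvable_of_comm fun a b =>
        Subgroup.mem_center_iff.1 (h1 ▸ Subgroup.mem_top b) a)
  refine ⟨z, hzA.1, hzA.2, hcomm, h.uniq_of_forall_commute hp hpA
    hzA.2.isPGroup_zpowers fun x hx => ?_⟩
  refine h.le_M hne (fun a ha => Subgroup.mem_centralizer_singleton_iff.2 (hcomm a ha).symm.eq) ?_
  exact Subgroup.mem_centralizer_singleton_iff.2 (hx z (Subgroup.mem_zpowers _)).eq

/-- The normaliser of a nontrivial `q`-subgroup, where `q` divides `|B|`, does not contain a large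
family of subgroups that pin down `M`. -/
theorem false_of_normalizer (h : SimpleFactorization A B M H) {q : ℕ} (hq : q.Prime)
    (hqB : q ∣ Nat.card B) {Y : Subgroup G} (hYq : IsPGroup q Y) (hY : Y ≠ ⊥)
    (hT : ∀ t : ℕ, t.Prime → t ∣ Nat.card A → ∃ T : Subgroup G, IsPGroup t T ∧ T ≤ M ∧
      T ≤ Subgroup.normalizer (Y : Set G) ∧ Uniq M T) {t : ℕ} (ht : t.Prime)
    (htA : t ∣ Nat.card A) {S : Subgroup G} (hS : IsSylowIn t S ⊤)
    (hSY : S ≤ Subgroup.normalizer (Y : Set G)) : False := by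
  set N := Subgroup.normalizer (Y : Set G) with hN
  obtain ⟨L, hL⟩ := h.exists_isNilHall (inf_le_right (a := N) (b := M))
  -- A Sylow t-subgroup of N above T is forced into M, so N ∩ M has index prime to |A| in N.
  have hL' : IsNilHall (Nat.card A) L N := by
    refine hL.trans inf_le_left fun t ht htA => ?_
    obtain ⟨T, hTt, hTM, hTN, hTu⟩ := hT t ht htA
    obtain ⟨S', hTS', hS'⟩ := exists_isSylowIn_ge ht hTt hTN
    exact hS'.not_dvd_of_le (le_inf hS'.le
      (hTu.le_of_isNilpotent hTM hTS' (hS'.isPGroup.isNilpotent_subgroup ht)))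
  obtain ⟨Q, hQ⟩ := exists_isSylowIn hq N
  have hYQ : Y ≤ Q := hQ.le_of_conj_mem hq hYq Subgroup.le_normalizer
    fun k hk y hy => conj_mem_of_mem_normalizer hk hy
  obtain ⟨g, -, hg⟩ := (h.symm.isSylowIn_pPart hq hqB).exists_le_conj hq hQ.isPGroup le_top
  -- Y lies in a conjugate of the q-part of B, which the remaining parts of that conjugate of B
  -- centralise.
  have hgB : ∀ s : ℕ, s.Prime → s ≠ q → MulAut.conj g • pPart B s ≤ N := by
    intro s hs hsq x hx
    refine mem_normalizer_of_forall_commute fun y hy => ?_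
    have := (h.nilB.commute_pPart hs hq hsq (mem_conj_smul.1 hx)
      (mem_conj_smul.1 (hg (hYQ hy)))).map (MulAut.conj g)
    simpa [mul_assoc] using this
  have hW : IsNilHall (Nat.card B) (MulAut.conj g • B ⊓ N) N := by
    refine ⟨inf_le_right, (h.nilB.conj_smul g).mono inf_le_left, fun s _ hd => ?_,
      fun s hs hsB => ?_⟩
    · have := hd.trans (Subgroup.card_dvd_of_le inf_le_left)
      rwa [card_conj_smul] at this
    · rcases eq_or_ne s q with rfl | hsq
      · exact hQ.not_dvd_of_le (le_inf (hg.trans (conj_smul_le_conj_smul (pPart_le _ _))) hQ.le)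
      · have h1 := ((h.symm.isSylowIn_pPart hs hsB).conj_smul_of_mem (Subgroup.mem_top g)).mono
          (hgB s hs hsq) le_top
        exact h1.not_dvd_of_le (le_inf (conj_smul_le_conj_smul (pPart_le _ _)) h1.le)
  have hsol := h.isSolvable_of_isNilHall (h.normalizer_ne_top_of_isPGroup hq hY hYq) hL' hW
  obtain ⟨s, hs, hsq, hsB⟩ := h.exists_prime_ne_B q
  exact h.false_of_isSylowIn hsol ht hs htA hsB hS
    ((h.symm.isSylowIn_pPart hs hsB).conj_smul_of_mem (Subgroup.mem_top g)) hSY (hgB s hs hsq)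

theorem pPart_eq_bot_of_not_dvd (h : SimpleFactorization A B M H) {K : Subgroup G} {t : ℕ}
    (ht : t.Prime) (hA : ¬ t ∣ Nat.card A) (hB : ¬ t ∣ Nat.card B) : pPart K t = ⊥ :=
  _root_.pPart_eq_bot_of_not_dvd ht fun hd => (h.dvd_or_dvd ht hd).elim hA hB

/-- The Fitting subgroup F of J has no part for primes of B, by `false_of_normalizer`; its t-parts
for t ≠ p lie in A, and its p-part lies in M because of T. Some r-part with r ≠ p is nontrivial, for
otherwise the r-part of A would centralise F. J and A normalise that part, so J ≤ M. -/
theorem le_M_of_isSolvable (h : SimpleFactorization A B M H) {J : Subgroup G}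
    (hJ : Group.IsSolvable J) {p : ℕ} (hp : p.Prime) {T : Subgroup G}
    (hTp : IsPGroup p T) (hTJ : T ≤ J) (hTM : T ≤ M) (hTu : Uniq M T)
    (hA : ∀ r : ℕ, r.Prime → r ≠ p → pPart A r ≤ J) : J ≤ M := by
  obtain ⟨F, hF⟩ := exists_isFit J
  have hJF : ∀ t, J ≤ Subgroup.normalizer (pPart F t : Set G) := fun t j hj =>
    mem_normalizer_of_conj_mem fun x hx => hF.conj_mem_pPart hj hx
  obtain ⟨r, hr, hrp, hrA⟩ := h.exists_prime_ne_A p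
  have hFσ : ∀ t : ℕ, t.Prime → ¬ t ∣ Nat.card A → pPart F t = ⊥ := by
    intro t ht htA
    by_cases htB : t ∣ Nat.card B
    · by_contra hne
      refine h.false_of_normalizer ht htB (hF.isNilpotent.isPGroup_pPart ht) hne ?_ hr hrA
        (h.isSylowIn_pPart hr hrA) ((hA r hr hrp).trans (hJF t))
      intro s hs hsA
      rcases eq_or_ne s p with rfl | hsp
      · exact ⟨T, hTp, hTM, hTJ.trans (hJF t), hTu⟩
      · exact ⟨pPart A s, h.nilA.isPGroup_pPart hs, (pPart_le _ _).trans h.A_le,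
          (hA s hs hsp).trans (hJF t), h.uniq_pPart hs hsA⟩
    · exact h.pPart_eq_bot_of_not_dvd ht htA htB
  have hFA : ∀ t : ℕ, t.Prime → t ≠ p → pPart F t ≤ pPart A t := by
    intro t ht htp
    by_cases htA : t ∣ Nat.card A
    · exact (h.isSylowIn_pPart_of_le ht htA (hA t ht htp)).le_of_conj_mem ht
        (hF.isNilpotent.isPGroup_pPart ht) ((pPart_le _ _).trans hF.le)
        fun k hk x hx => hF.conj_mem_pPart hk hx
    · rw [hFσ t ht htA]; exact bot_le
  have hFM : F ≤ M := by
    refine le_of_forall_pPart_le fun t ht => ?_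
    rcases eq_or_ne t p with rfl | htp
    · have : Fact t.Prime := ⟨ht⟩
      have hS : IsPGroup t (T ⊔ pPart F t : Subgroup G) :=
        hTp.to_sup_of_normal_right' (hF.isNilpotent.isPGroup_pPart ht) (hTJ.trans (hJF t))
      exact le_sup_right.trans
        (hTu.le_of_isNilpotent hTM le_sup_left (hS.isNilpotent_subgroup ht))
    · exact (hFA t ht htp).trans ((pPart_le _ _).trans h.A_le)
  have hFr : pPart F r ≠ ⊥ := by
    intro h0
    refine h.pPart_ne_bot hr hrA (le_bot_iff.1 (h0 ▸ fun x hx => ?_))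
    have hxJ := hA r hr hrp hx
    rw [h.nilA.mem_pPart_iff hr] at hx
    refine mem_pPart_of_mem (hF.mem_of_commute x hxJ fun f hf => ?_) hx.2
    have key : F ≤ Subgroup.centralizer {x} := by
      refine le_of_forall_pPart_le fun t ht => (Subgroup.closure_le _).2 fun f hf => ?_
      refine Subgroup.mem_centralizer_singleton_iff.2 (Commute.symm (?_ : Commute x f))
      have hft : f ∈ pPart F t := mem_pPart_of_mem hf.1 hf.2
      rcases eq_or_ne t r with rfl | htr
      · rw [h0, Subgroup.mem_bot] at hft
        rw [hft]; exact Commute.one_right _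
      by_cases htA : t ∣ Nat.card A
      · exact h.commute hr ht htr.symm hrA htA (h.A_le hx.1) (hFM hf.1) hx.2 hf.2
      · rw [hFσ t ht htA, Subgroup.mem_bot] at hft
        rw [hft]; exact Commute.one_right _
    exact (Subgroup.mem_centralizer_singleton_iff.1 (key hf)).symm
  refine (hJF r).trans (h.le_M (h.normalizer_ne_top_of_isPGroup hr hFr
    (hF.isNilpotent.isPGroup_pPart hr)) (le_of_forall_pPart_le fun t ht => ?_))
  rcases eq_or_ne t r with rfl | htr
  · exact (hA t ht hrp).trans (hJF t)
  · exact fun x hx => mem_normalizer_of_forall_commute fun y hy =>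
      h.nilA.commute_pPart ht hr htr hx (hFA r hr hrp hy)

theorem isSylowIn_pPart_inf (h : SimpleFactorization A B M H) {p : ℕ} (hp : p.Prime)
    (hpA : p ∣ Nat.card A) : IsSylowIn p (pPart (A ⊓ H) p) H :=
  have h1 := h.symm.isNilHall_inf h.B_le
  (h1.isNilpotent.isSylowIn_pPart hp).trans hp inf_le_right (h1.not_dvd_relIndex p hp hpA)

/-- The normaliser J of U = (A ∩ H)ₚ inherits the factorisation: for ab in J, the conjugate of U by
b lies in A because ab normalises U, and in H because B ≤ H, so b ∈ J. Hence J is solvable and lies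
in M. -/
theorem uniq_pPart_inf (h : SimpleFactorization A B M H) {p : ℕ} (hp : p.Prime)
    (hpA : p ∣ Nat.card A) (hU : pPart (A ⊓ H) p ≠ ⊥) : Uniq M (pPart (A ⊓ H) p) := by
  have hnilU : Group.IsNilpotent (A ⊓ H : Subgroup G) := h.nilA.mono inf_le_left
  have hUp := hnilU.isPGroup_pPart hp
  have hUA : pPart (A ⊓ H) p ≤ pPart A p := pPart_mono inf_le_left p
  set J := Subgroup.normalizer (pPart (A ⊓ H) p : Set G) with hJ
  have hfac : ∀ k ∈ J, ∃ a ∈ A ⊓ J, ∃ b ∈ B ⊓ J, k = a * b := by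
    intro k hk
    obtain ⟨a, ha, b, hb, rfl⟩ := h.exists_mul k
    have hbJ : b ∈ J := by
      refine mem_normalizer_of_conj_mem fun x hx => ?_
      have hx' := (hnilU.mem_pPart_iff hp).1 hx
      refine mem_pPart_of_mem ⟨?_, ?_⟩ (hx'.2.conj b)
      · have h1 := pPart_le _ _ (hUA (conj_mem_of_mem_normalizer hk hx))
        have h2 := A.mul_mem (A.mul_mem (A.inv_mem ha) h1) ha
        simpa [mul_assoc] using h2
      · exact H.mul_mem (H.mul_mem (h.B_le hb) hx'.1.2) (H.inv_mem (h.B_le hb))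
    exact ⟨a, ⟨ha, (J.mul_mem_cancel_right hbJ).1 hk⟩, b, ⟨hb, hbJ⟩, rfl⟩
  have hsol : Group.IsSolvable J := by
    refine h.isSolvable J (A ⊓ J) (B ⊓ J) (h.normalizer_ne_top_of_isPGroup hp hU hUp) inf_le_right
      inf_le_right (h.nilA.mono inf_le_left) (h.nilB.mono inf_le_left) ?_ ?_
    · exact (h.coprime.coprime_dvd_left (Subgroup.card_dvd_of_le inf_le_left)).coprime_dvd_right
        (Subgroup.card_dvd_of_le inf_le_left)
    · rw [← card_mul_relIndex (inf_le_right (a := A) (b := J)),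
        relIndex_of_forall_exists_mul' inf_le_right hfac]
      exact Nat.mul_dvd_mul_left _ (Subgroup.relIndex_dvd_card _ _)
  obtain ⟨z, hzA, hzp, hzc, hzu⟩ := h.exists_uniq_zpowers hp hpA
  have hJM : J ≤ M := by
    refine h.le_M_of_isSolvable hsol hp hzp.isPGroup_zpowers (Subgroup.zpowers_le.2 ?_)
      (Subgroup.zpowers_le.2 (h.A_le hzA)) hzu fun r hr hrp x hx => ?_
    · exact mem_normalizer_of_forall_commute fun y hy => hzc y (pPart_le _ _ (hUA hy))
    · exact mem_normalizer_of_forall_commute fun y hy => h.nilA.commute_pPart hr hp hrp hx (hUA hy)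
  exact h.uniq_of_forall_commute hp hpA hUp
    fun x hx => hJM (mem_normalizer_of_forall_commute hx)

/-- E meets the normal subgroup X of H generated by its q-elements trivially: E ∩ X is normalised by
the q-part of B ∩ M and centralised by the other parts of B, contrary to `false_of_normalizer` with
the factors exchanged. The commutator of e and y lies in E ∩ X. -/
theorem commute_of_conj_mem (h : SimpleFactorization A B M H) {p q : ℕ} (hp : p.Prime)
    (hq : q.Prime) (hpA : p ∣ Nat.card A) (hqB : q ∣ Nat.card B) {E : Subgroup G}
    (hEp : IsPGroup p E) (hEH : E ≤ H)
    (hn : ∀ k ∈ M ⊓ H, ∀ e ∈ E, k * e * k⁻¹ ∈ E) {y : G} (hy : y ∈ M ⊓ H) (hyq : IsPElt q y) {e : G}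
    (he : e ∈ E) : Commute e y := by
  have hS := h.symm.isSylowIn_pPart_inf hq hqB
  rcases eq_or_ne (pPart (B ⊓ M) q) ⊥ with h0 | h0
  · obtain ⟨k, -, hk⟩ := hS.exists_conj_mem hq hyq hy.1
    rw [h0, Subgroup.mem_bot, mul_assoc, inv_mul_eq_one, eq_comm, mul_eq_right] at hk
    rw [hk]; exact Commute.one_right _
  have hu := h.symm.uniq_pPart_inf hq hqB h0
  have hX : ∀ k ∈ H, ∀ x ∈ pPart H q, k * x * k⁻¹ ∈ pPart H q := fun k hk x hx =>
    conj_mem_pPart (fun a ha => H.mul_mem (H.mul_mem hk ha) (H.inv_mem hk)) hx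
  have hE0 : E ⊓ pPart H q = ⊥ := by
    by_contra hne
    have hB : ∀ s : ℕ, s.Prime → s ∣ Nat.card B → s ≠ q →
        pPart B s ≤ Subgroup.normalizer ((E ⊓ pPart H q : Subgroup G) : Set G) := by
      intro s hs hsB hsq b hb
      rw [h.nilB.mem_pPart_iff hs] at hb
      exact mem_normalizer_of_forall_commute fun x hx => centralizer_pPart
        (fun a ha haq => h.symm.commute hs hq hsq hsB hqB (h.B_le hb.1) ha hb.2 haq) hx.2
    obtain ⟨s, hs, hsq, hsB⟩ := h.exists_prime_ne_B q
    refine h.symm.false_of_normalizer hp hpA (hEp.to_le inf_le_left) hne ?_ hs hsB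
      (h.symm.isSylowIn_pPart hs hsB) (hB s hs hsB hsq)
    intro t ht htB
    rcases eq_or_ne t q with rfl | htq
    · refine ⟨pPart (B ⊓ M) t, hS.isPGroup, (pPart_le _ _).trans (inf_le_left.trans h.B_le), ?_, hu⟩
      intro v hv
      have hv' := pPart_le _ _ hv
      exact mem_normalizer_of_conj_mem fun x hx =>
        ⟨hn v ⟨hv'.2, h.B_le hv'.1⟩ x hx.1, hX v (h.B_le hv'.1) x hx.2⟩
    · exact ⟨pPart B t, h.nilB.isPGroup_pPart ht, (pPart_le _ _).trans h.B_le, hB t ht htB htq,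
        h.symm.uniq_pPart ht htB⟩
  have h1 : e * y * e⁻¹ * y⁻¹ ∈ E ⊓ pPart H q := by
    have hyX : y ∈ pPart H q := mem_pPart_of_mem hy.2 hyq
    refine ⟨?_, (pPart H q).mul_mem (hX e (hEH he) y hyX) ((pPart H q).inv_mem hyX)⟩
    have := E.mul_mem he (hn y hy e⁻¹ (E.inv_mem he))
    simpa [mul_assoc] using this
  rw [hE0, Subgroup.mem_bot, mul_inv_eq_one, mul_inv_eq_iff_eq_mul] at h1
  exact h1

/-- Primes t of A are handled by commutation within M; for t dividing |B|, the t-part of F is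
normalised by M ∩ H and the previous lemma applies with the factors exchanged. -/
theorem commute_of_isFit_inf (h : SimpleFactorization A B M H) {F : Subgroup G}
    (hF : IsFit F (M ⊓ H)) {p : ℕ} (hp : p.Prime) (hpA : p ∣ Nat.card A) (t : ℕ) (ht : t.Prime)
    (htp : t ≠ p) (x : G) (hx : x ∈ M ⊓ H) (f : G) (hf : f ∈ F) (hxp : IsPElt p x)
    (hft : IsPElt t f) : Commute x f := by
  rcases eq_or_ne f 1 with rfl | hf1
  · exact Commute.one_right _
  rcases h.dvd_of_isPElt ht hft hf1 with htA | htB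
  · exact h.commute hp ht htp.symm hpA htA hx.1 (hF.le hf).1 hxp hft
  · refine (h.symm.commute_of_conj_mem ht hp htB hpA (E := pPart F t)
      (hF.isNilpotent.isPGroup_pPart ht) ((pPart_le _ _).trans (hF.le.trans inf_le_left)) ?_
      ⟨hx.2, hx.1⟩ hxp (mem_pPart_of_mem hf hft)).symm
    exact fun k hk e he => hF.conj_mem_pPart ⟨hk.2, hk.1⟩ he

/-- In `M ⊓ H`, elements of prime power order for primes dividing `|A|` and `|B|` commute. -/
theorem commute_of_mem_inf (h : SimpleFactorization A B M H) {p q : ℕ} (hp : p.Prime)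
    (hq : q.Prime) (hpA : p ∣ Nat.card A) (hqB : q ∣ Nat.card B) {x y : G} (hx : x ∈ M ⊓ H)
    (hy : y ∈ M ⊓ H) (hxp : IsPElt p x) (hyq : IsPElt q y) : Commute x y := by
  have hpq : p ≠ q := fun e => h.not_dvd hp hpA (e ▸ hqB)
  have := h.isSolvable_M
  have : Group.IsSolvable (M ⊓ H : Subgroup G) :=
    Group.isSolvable_of_isSolvable_injective (Subgroup.inclusion_injective inf_le_left)
  obtain ⟨F, hF⟩ := exists_isFit (M ⊓ H)
  exact hF.commute hp hq hpq (h.commute_of_isFit_inf hF hp hpA)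
    (fun t ht htq x hx => h.symm.commute_of_isFit_inf (inf_comm M H ▸ hF) hq hqB t ht htq x
      ⟨hx.2, hx.1⟩) hx hy hxp hyq

end SimpleFactorization

end Uniqueness

/-! ### A normal complement criterion from the focal subgroup theorem. -/

section Fusion

open scoped commutatorElement

variable {G : Type*} [Group G]

/-- The subgroup generated by the elements of `C` of order coprime to `t`. -/
def coprimeClosure (C : Subgroup G) (t : ℕ) : Subgroup G :=
  Subgroup.closure {x | x ∈ C ∧ (orderOf x).Coprime t}

theorem mem_coprimeClosure {C : Subgroup G} {t : ℕ} {x : G} (hx : x ∈ C)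
    (hxt : (orderOf x).Coprime t) : x ∈ coprimeClosure C t := Subgroup.subset_closure ⟨hx, hxt⟩

theorem coprimeClosure_le (C : Subgroup G) (t : ℕ) : coprimeClosure C t ≤ C :=
  (Subgroup.closure_le _).2 fun _ hx => hx.1

theorem conj_mem_coprimeClosure {C : Subgroup G} {t : ℕ} {c x : G} (hc : c ∈ C)
    (hx : x ∈ coprimeClosure C t) : c * x * c⁻¹ ∈ coprimeClosure C t := by
  have : coprimeClosure C t ≤ (coprimeClosure C t).comap (MulAut.conj c).toMonoidHom :=
    (Subgroup.closure_le _).2 fun y hy => mem_coprimeClosure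
      (C.mul_mem (C.mul_mem hc hy.1) (C.inv_mem hc))
      (by
        have : orderOf (c * y * c⁻¹) = orderOf y :=
          orderOf_injective (MulAut.conj c).toMonoidHom (MulAut.conj c).injective y
        exact this ▸ hy.2)
  exact this hx

theorem IsPElt.mem_coprimeClosure {C : Subgroup G} {s t : ℕ} {x : G} (hxs : IsPElt s x)
    (hx : x ∈ C) (hs : s.Prime) (ht : t.Prime) (hst : s ≠ t) : x ∈ coprimeClosure C t := by
  obtain ⟨k, hk⟩ := hxs.orderOf_eq hs
  exact _root_.mem_coprimeClosure hx (hk ▸ ((Nat.coprime_primes hs ht).2 hst).pow_left k)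

variable [Finite G]

/-- A criterion for the existence of normal `t`-complements: if the nilpotent subgroup `P`
contains a Sylow `t`-subgroup of `C` and controls its fusion, then the elements of order prime to
`t` generate a subgroup of order prime to `t`. -/
theorem not_dvd_card_coprimeClosure {C P : Subgroup G} (hP : Group.IsNilpotent P) {t : ℕ}
    (ht : t.Prime) (hS : IsSylowIn t (pPart P t) C)
    (hfus : ∀ s ∈ pPart P t, ∀ c ∈ C, c⁻¹ * s * c ∈ pPart P t →
      ∃ m ∈ P, m⁻¹ * s * m = c⁻¹ * s * c) :
    ¬ t ∣ Nat.card (coprimeClosure C t) := by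
  have : Fact t.Prime := ⟨ht⟩
  set N := coprimeClosure C t with hN
  obtain ⟨Q, hQ, hQS⟩ : ∃ Q, IsSylowIn t Q N ∧ Q ≤ pPart P t := by
    obtain ⟨Q, hQ⟩ := exists_isSylowIn ht N
    obtain ⟨c, hc, hle⟩ := hS.exists_le_conj ht hQ.isPGroup (hQ.le.trans (coprimeClosure_le C t))
    refine ⟨MulAut.conj c⁻¹ • Q, ?_, ?_⟩
    · have h1 := hQ.conj_smul c⁻¹
      rwa [conj_smul_eq_of_le (conj_smul_le_iff.2 fun x hx =>
        conj_mem_coprimeClosure (C.inv_mem hc) hx)] at h1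
    · have := conj_smul_le_conj_smul (g := c⁻¹) hle
      rwa [conj_inv_smul_conj_smul] at this
  let R : Sylow t N := hQ.toSylow ht
  -- N is generated by elements of order prime to t, and the transfer goes to a t-group; so R equals
  -- its focal subgroup.
  have hker : R.transferFocal.ker = ⊤ := by
    have h1 : N ≤ R.transferFocal.ker.map N.subtype := by
      refine (Subgroup.closure_le _).2 fun x hx => ?_
      have hxN : x ∈ N := Subgroup.subset_closure hx
      refine ⟨⟨x, hxN⟩, MonoidHom.mem_ker.2 ?_, rfl⟩
      have hT : IsPGroup t (R ⧸ R.focalSubgroupOf) := R.2.to_quotient _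
      obtain ⟨k, hk⟩ := hT (R.transferFocal ⟨x, hxN⟩)
      have h2 : orderOf (R.transferFocal ⟨x, hxN⟩) ∣ orderOf x := by
        rw [← Subgroup.orderOf_mk x hxN]
        exact orderOf_map_dvd _ _
      exact orderOf_eq_one_iff.1 (Nat.eq_one_of_dvd_coprimes (hx.2.pow_right k) h2
        (orderOf_dvd_of_pow_eq_one hk))
    refine top_le_iff.1 fun x _ => ?_
    obtain ⟨y, hy, e⟩ := h1 x.2
    rwa [← Subtype.ext e]
  have hfoc : (R : Subgroup N) = R.focalSubgroup := by
    rw [← Subgroup.ker_transferFocal_inf_eq_focalSubgroup, hker, top_inf_eq]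
  -- Controlled fusion lets each focal commutator be rewritten with an element of P. Iterating puts
  -- Q in every term of the lower central series of P.
  have hQle : Q ≤ ⁅Q, P⁆ := by
    have h1 : R.focalSubgroup ≤ (⁅Q, P⁆).comap N.subtype := by
      refine (Subgroup.closure_le _).2 ?_
      rintro _ ⟨hmem, x, hx, u, rfl⟩
      have hxQ : (x : G) ∈ Q := hx
      have hu : (u : G) ∈ C := coprimeClosure_le C t u.2
      have hmem' : (x : G) * u * (x : G)⁻¹ * (u : G)⁻¹ ∈ Q := hmem
      have h2 : ((u : G)⁻¹)⁻¹ * (x : G)⁻¹ * (u : G)⁻¹ ∈ pPart P t := by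
        have := (pPart P t).mul_mem (hQS (Q.inv_mem hxQ)) (hQS hmem')
        simpa [mul_assoc] using this
      obtain ⟨m, hm, e⟩ := hfus _ (hQS (Q.inv_mem hxQ)) _ (C.inv_mem hu) h2
      have h3 : (x : G) * u * (x : G)⁻¹ * (u : G)⁻¹ = ⁅(x : G), m⁻¹⁆ := by
        calc (x : G) * u * (x : G)⁻¹ * (u : G)⁻¹ =
            x * (((u : G)⁻¹)⁻¹ * (x : G)⁻¹ * (u : G)⁻¹) := by group
          _ = _ := by rw [← e, commutatorElement_def]; group
      change (x : G) * u * (x : G)⁻¹ * (u : G)⁻¹ ∈ ⁅Q, P⁆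
      rw [h3]
      exact Subgroup.commutator_mem_commutator hxQ (P.inv_mem hm)
    intro x hx
    have : (⟨x, hQ.le hx⟩ : N) ∈ (R : Subgroup N) := hx
    rw [hfoc] at this
    exact h1 this
  have hQbot : Q = ⊥ := by
    obtain ⟨n, hn⟩ := (Subgroup.isNilpotent_iff_lowerCentralSeries P).1 hP
    have : ∀ n, Q ≤ P.lowerCentralSeries n := by
      intro n
      induction n with
      | zero => exact hQS.trans (pPart_le P t)
      | succ n ih => exact hQle.trans (Subgroup.commutator_mono ih le_rfl)
    exact le_bot_iff.1 (hn ▸ this n)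
  have := hQ.not_dvd
  rwa [hQbot, Subgroup.relIndex_bot_left] at this

end Fusion

/-! ### Every nontrivial p-subgroup of H, for p dividing |A|, lies in at most one conjugate of M. -/

section Contradiction

variable {G : Type*} [Group G]

theorem Uniq.of_conj {M : Subgroup G} {g x : G} (h : Uniq M (Subgroup.zpowers (g⁻¹ * x * g))) :
    Uniq M (Subgroup.zpowers x) := fun k l hk hl => by
  have key : ∀ k : G, Subgroup.zpowers x ≤ MulAut.conj k • M →
      Subgroup.zpowers (g⁻¹ * x * g) ≤ MulAut.conj (g⁻¹ * k) • M := by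
    intro k hk
    rw [Subgroup.zpowers_le, mem_conj_smul] at hk ⊢
    simpa [mul_assoc] using hk
  have := h _ _ (key k hk) (key l hl)
  simpa [mul_assoc] using this

theorem conj_smul_normalizer (k : G) (D : Subgroup G) :
    MulAut.conj k • Subgroup.normalizer (D : Set G) =
      Subgroup.normalizer ((MulAut.conj k • D : Subgroup G) : Set G) := by
  ext x
  rw [mem_conj_smul, ← conj_smul_eq_iff_mem_normalizer, ← conj_smul_eq_iff_mem_normalizer,
    conj_mul_smul, conj_mul_smul, ← smul_left_cancel_iff (MulAut.conj k)]
  rw [conj_smul_conj_inv_smul]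

namespace SimpleFactorization

variable [Finite G] {A B M H : Subgroup G}

/-- The inductive step: larger p-subgroups of H are already known to pin down M. It suffices to show
that the normaliser N of D is solvable, for then N ≤ M. -/
theorem uniq_of_isSylowIn_normalizer (h : SimpleFactorization A B M H) {p : ℕ} (hp : p.Prime)
    (hpA : p ∣ Nat.card A) {D P : Subgroup G} (hD : D ≠ ⊥) (hDp : IsPGroup p D) (hDP : D ≤ P)
    (hPU : P ≤ pPart (A ⊓ H) p) (hP : IsSylowIn p P (Subgroup.normalizer (D : Set G) ⊓ H))
    (ih : ∀ D' : Subgroup G, IsPGroup p D' → D' ≤ H → Nat.card D < Nat.card D' → Uniq M D') :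
    Uniq M D := by
  have hnilU : Group.IsNilpotent (A ⊓ H : Subgroup G) := h.nilA.mono inf_le_left
  have hUp := hnilU.isPGroup_pPart hp
  have hUH : pPart (A ⊓ H) p ≤ H := (pPart_le _ _).trans inf_le_right
  have hUA : pPart (A ⊓ H) p ≤ pPart A p := pPart_mono inf_le_left p
  have hUM : pPart (A ⊓ H) p ≤ M := hUA.trans ((pPart_le _ _).trans h.A_le)
  have hnilUp := hUp.isNilpotent_subgroup hp
  have hDU := hDP.trans hPU
  rcases eq_or_ne D (pPart (A ⊓ H) p) with rfl | hne
  · exact h.uniq_pPart_inf hp hpA hD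
  have hcardlt : ∀ {X Y : Subgroup G}, X < Y → Nat.card X < Nat.card Y := fun {X Y} hXY =>
    lt_of_le_of_ne (Nat.le_of_dvd Nat.card_pos (Subgroup.card_dvd_of_le hXY.le)) fun e =>
      hXY.ne (Subgroup.eq_of_le_of_card_ge hXY.le e.ge)
  have hcardD := hcardlt (lt_of_le_of_ne hDU hne)
  have hnorm : ∀ X : Subgroup G, X ≤ pPart (A ⊓ H) p → Nat.card X = Nat.card D →
      Nat.card D < Nat.card (pPart (A ⊓ H) p ⊓ Subgroup.normalizer (X : Set G) : Subgroup G) := by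
    intro X hX hc
    rw [← hc]
    refine hcardlt (hnilUp.lt_inf_normalizer (lt_of_le_of_ne hX ?_))
    rintro rfl
    exact hcardD.ne' hc
  set N := Subgroup.normalizer (D : Set G) with hN
  have hPu : Uniq M P := by
    refine ih P hP.isPGroup (hP.le.trans inf_le_right) ((hnorm D hDU rfl).trans_le ?_)
    exact hP.card_le hp (hUp.to_le inf_le_left) (le_inf inf_le_right (inf_le_left.trans hUH))
  have hPM : P ≤ M := hPU.trans hUM
  -- For n = ab the conjugate D' of D lies in A ∩ H, and its normaliser in the p-part of A ∩ H is
  -- larger than D, so the induction applies. Sylow's theorem in N ∩ H corrects b by some k with bk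
  -- ∈ M, giving N = (N ∩ M)(N ∩ H).
  have hfac : ∀ n ∈ N, ∃ a ∈ N ⊓ M, ∃ b ∈ N ⊓ H, n = a * b := by
    intro n hn
    obtain ⟨a, ha, b, hb, e⟩ := h.exists_mul n
    have hbn : b = a⁻¹ * n := by rw [e]; group
    have hDn := conj_smul_eq_iff_mem_normalizer.2 hn
    set D' := MulAut.conj a⁻¹ • D with hD'
    have hD'b : D' = MulAut.conj b • D := by rw [hbn, conj_mul_smul, hDn]
    have hD'A : D' ≤ A := by
      rw [hD', ← conj_smul_mem_self (A.inv_mem ha)]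
      exact conj_smul_le_conj_smul (hDU.trans (hUA.trans (pPart_le _ _)))
    have hD'H : D' ≤ H := by
      rw [hD'b, ← conj_smul_mem_self (h.B_le hb)]
      exact conj_smul_le_conj_smul (hDU.trans hUH)
    have hD'U : D' ≤ pPart (A ⊓ H) p := fun x hx =>
      mem_pPart_of_mem ⟨hD'A hx, hD'H hx⟩ ((hDp.conj_smul a⁻¹).isPElt hx)
    set T := pPart (A ⊓ H) p ⊓ Subgroup.normalizer (D' : Set G) with hT
    have hTu : Uniq M T := ih T (hUp.to_le inf_le_left) (inf_le_left.trans hUH)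
      (hnorm D' hD'U (card_conj_smul _ _))
    have hTb : MulAut.conj b⁻¹ • T ≤ N ⊓ H := by
      refine le_inf ?_ ?_
      · have h1 : MulAut.conj b⁻¹ • T ≤
            MulAut.conj b⁻¹ • Subgroup.normalizer (D' : Set G) :=
          conj_smul_le_conj_smul inf_le_right
        rwa [conj_smul_normalizer, hD'b, conj_inv_smul_conj_smul] at h1
      · have h1 : MulAut.conj b⁻¹ • T ≤ MulAut.conj b⁻¹ • H :=
          conj_smul_le_conj_smul (inf_le_left.trans hUH)
        rwa [conj_smul_mem_self (H.inv_mem (h.B_le hb))] at h1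
    obtain ⟨k, hk, hTk⟩ := hP.exists_le_conj hp
      ((hUp.to_le (inf_le_left (b := Subgroup.normalizer (D' : Set G)))).conj_smul b⁻¹) hTb
    have hbk : b * k ∈ M := by
      refine hTu.mem (inf_le_left.trans hUM) ?_
      have h1 := conj_smul_le_conj_smul (g := b) (hTk.trans (conj_smul_le_conj_smul hPM))
      rwa [conj_smul_conj_inv_smul, ← conj_mul_smul] at h1
    refine ⟨n * k, ⟨N.mul_mem hn hk.1, ?_⟩, k⁻¹, (N ⊓ H).inv_mem hk, by group⟩
    rw [e, mul_assoc]
    exact M.mul_mem (h.A_le ha) hbk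
  have hAN : ∀ r : ℕ, r.Prime → r ≠ p → pPart A r ≤ N := fun r hr hrp x hx =>
    mem_normalizer_of_forall_commute fun y hy => h.nilA.commute_pPart hr hp hrp hx (hUA (hDU hy))
  obtain ⟨L, hL⟩ := h.exists_isNilHall (inf_le_right (a := N) (b := M))
  have hL' : IsNilHall (Nat.card A) L N := by
    refine hL.trans inf_le_left fun t ht htA => ?_
    rcases eq_or_ne t p with rfl | htp
    · obtain ⟨S, hPS, hS⟩ := exists_isSylowIn_ge hp hP.isPGroup (hP.le.trans inf_le_left)
      exact hS.not_dvd_of_le (le_inf hS.le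
        (hPu.le_of_isNilpotent hPM hPS (hS.isPGroup.isNilpotent_subgroup hp)))
    · exact ((h.isSylowIn_pPart ht htA).mono (hAN t ht htp) le_top).not_dvd_of_le
        (le_inf (hAN t ht htp) ((pPart_le _ _).trans h.A_le))
  obtain ⟨W, hW⟩ := h.symm.exists_isNilHall (inf_le_right (a := N) (b := H))
  -- The factorisation reduces the index of N ∩ H in N to an index in N ∩ M, whose Sylow q-subgroup
  -- lies in H and centralises D.
  have hW' : IsNilHall (Nat.card B) W N := by
    refine hW.trans inf_le_left fun q hq hqB => ?_
    rw [relIndex_of_forall_exists_mul inf_le_left hfac]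
    have hV := h.symm.isSylowIn_pPart_inf hq hqB
    have hVK : pPart (B ⊓ M) q ≤ M ⊓ H :=
      (pPart_le _ _).trans (le_inf inf_le_right (inf_le_left.trans h.B_le))
    have hVN : pPart (B ⊓ M) q ≤ N := fun v hv => mem_normalizer_of_forall_commute fun y hy =>
      (h.commute_of_mem_inf hp hq hpA hqB ⟨hUM (hDU hy), hUH (hDU hy)⟩ (hVK hv)
        (hDp.isPElt hy) (hV.isPGroup.isPElt hv)).symm
    exact (hV.mono (le_inf hVN (hVK.trans inf_le_left)) inf_le_right).not_dvd_of_le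
      (le_inf hVN (hVK.trans inf_le_right))
  have hsol := h.isSolvable_of_isNilHall (h.normalizer_ne_top_of_isPGroup hp hD hDp) hL' hW'
  have hNM := h.le_M_of_isSolvable hsol hp hP.isPGroup (hP.le.trans inf_le_left) hPM hPu hAN
  exact h.uniq_of_forall_commute hp hpA hDp fun x hx => hNM (mem_normalizer_of_forall_commute hx)

/-- Downward induction on |D|, after conjugating in H so that a Sylow p-subgroup of the normaliser
of D in H falls inside A ∩ H. -/
theorem uniq_of_le_H (h : SimpleFactorization A B M H) {p : ℕ} (hp : p.Prime)
    (hpA : p ∣ Nat.card A) {D : Subgroup G} (hD : D ≠ ⊥) (hDp : IsPGroup p D) (hDH : D ≤ H) :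
    Uniq M D := by
  induction hn : Nat.card H - Nat.card D using Nat.strong_induction_on generalizing D with
  | _ n ih =>
  obtain ⟨P, hDP, hP⟩ := exists_isSylowIn_ge hp hDp (le_inf Subgroup.le_normalizer hDH)
  obtain ⟨k, hk, hPk⟩ := (h.isSylowIn_pPart_inf hp hpA).exists_le_conj hp hP.isPGroup
    (hP.le.trans inf_le_right)
  have key : Uniq M (MulAut.conj k⁻¹ • D) := by
    refine h.uniq_of_isSylowIn_normalizer hp hpA (P := MulAut.conj k⁻¹ • P) ?_ (hDp.conj_smul _)
      (conj_smul_le_conj_smul hDP) ?_ ?_ ?_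
    · intro h0
      have h1 := card_conj_smul k⁻¹ D
      rw [h0, Subgroup.card_bot] at h1
      exact hD (Subgroup.card_eq_one.1 h1.symm)
    · have := conj_smul_le_conj_smul (g := k⁻¹) hPk
      rwa [conj_inv_smul_conj_smul] at this
    · have := hP.conj_smul k⁻¹
      rwa [Subgroup.smul_inf, conj_smul_normalizer, conj_smul_mem_self (H.inv_mem hk)] at this
    · intro D' hD'p hD'H hlt
      rw [card_conj_smul] at hlt
      have h1 : Nat.card D' ≤ Nat.card H :=
        Nat.le_of_dvd Nat.card_pos (Subgroup.card_dvd_of_le hD'H)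
      refine ih _ (by omega) ?_ hD'p hD'H rfl
      rintro rfl
      rw [Subgroup.card_bot] at hlt
      exact absurd hlt (by have := Nat.card_pos (α := D); omega)
  have := key.conj_smul k
  rwa [conj_smul_conj_inv_smul] at this

end SimpleFactorization

end Contradiction

/-! ### Centralizers of elements of A, and the final count. -/

section Contradiction

variable {G : Type*} [Group G]

theorem zpowers_ne_bot {x : G} (hx : x ≠ 1) : Subgroup.zpowers x ≠ ⊥ :=
  fun h => hx (Subgroup.zpowers_eq_bot.1 h)

namespace SimpleFactorization

variable [Finite G] {A B M H : Subgroup G}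

/-- If `⟨x⟩` does not pin down `M`, then `C(x) ∩ M` contains no `q`-elements for `q ∣ |B|`. -/
theorem eq_one_of_not_uniq (h : SimpleFactorization A B M H) {p q : ℕ} (hp : p.Prime)
    (hq : q.Prime) (hpA : p ∣ Nat.card A) (hqB : q ∣ Nat.card B) {x y : G} (hxp : IsPElt p x)
    (hx1 : x ≠ 1) (hxu : ¬ Uniq M (Subgroup.zpowers x)) (hyM : y ∈ M) (hyq : IsPElt q y)
    (hxy : Commute x y) : y = 1 := by
  by_contra hy1
  have hyu := h.symm.uniq_of_le_H hq hqB (zpowers_ne_bot hy1) hyq.isPGroup_zpowers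
    (Subgroup.zpowers_le.2 hyM)
  obtain ⟨g, -, hg⟩ := (h.symm.isSylowIn_pPart hq hqB).exists_conj_mem hq hyq (Subgroup.mem_top y)
  have hgH := h.B_le (pPart_le _ _ hg)
  -- ⟨y⟩ lies in a unique conjugate of H, which x must therefore normalise and belong to; but then
  -- x, up to conjugacy a p-element of H, would pin down M.
  have h1 : g⁻¹ * (x * g) ∈ H := by
    refine hyu g (x * g) (Subgroup.zpowers_le.2 (mem_conj_smul.2 hgH))
      (Subgroup.zpowers_le.2 (mem_conj_smul.2 ?_))
    have : (x * g)⁻¹ * y * (x * g) = g⁻¹ * (x⁻¹ * (y * x)) * g := by group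
    rwa [this, ← hxy.eq, inv_mul_cancel_left]
  rw [← mul_assoc] at h1
  refine hxu (Uniq.of_conj (g := g) (h.uniq_of_le_H hp hpA (zpowers_ne_bot ?_)
    (hxp.conj' g).isPGroup_zpowers (Subgroup.zpowers_le.2 h1)))
  intro h2
  rw [mul_assoc, inv_mul_eq_one, eq_comm, mul_eq_right] at h2
  exact hx1 h2

/-- The structure of `C = C(x)` when `⟨x⟩` does not pin down `M`: the group `C ∩ M` is nilpotent,
contains Sylow `t`-subgroups of `C` for all `t ∣ |A|` and controls their fusion. -/
theorem exists_mem_pPart_centralizer (h : SimpleFactorization A B M H) {p : ℕ} (hp : p.Prime)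
    {x : G} (hxA : x ∈ A) (hxp : IsPElt p x) {P : Subgroup G} (hpA : p ∣ Nat.card A)
    (hPC : P = Subgroup.centralizer {x} ⊓ M) (hP : Group.IsNilpotent P) {t : ℕ} (ht : t.Prime)
    (htA : t ∣ Nat.card A) :
    IsSylowIn t (pPart P t) (Subgroup.centralizer {x}) ∧ ∃ z ∈ pPart P t,
      Uniq M (Subgroup.zpowers z) ∧ ∀ s ∈ pPart P t, Commute z s := by
  set C := Subgroup.centralizer {x}
  have hle : P ≤ C := hPC.le.trans inf_le_left
  have hleM : P ≤ M := hPC.le.trans inf_le_right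
  obtain ⟨z, hzA, hzt, hzc, hzu⟩ := h.exists_uniq_zpowers ht htA
  have hzC : z ∈ C := Subgroup.mem_centralizer_singleton_iff.2 (hzc x hxA)
  obtain ⟨S, hzS, hS⟩ := exists_isSylowIn_ge ht hzt.isPGroup_zpowers (Subgroup.zpowers_le.2 hzC)
  have hSM : S ≤ M := hzu.le_of_isNilpotent (Subgroup.zpowers_le.2 (h.A_le hzA)) hzS
    (hS.isPGroup.isNilpotent_subgroup ht)
  have hSP : S ≤ P := (le_inf hS.le hSM).trans hPC.ge
  have hSyl : IsSylowIn t (pPart P t) C :=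
    (hP.isSylowIn_pPart ht).trans ht hle (hS.not_dvd_of_le hSP)
  refine ⟨hSyl, ?_⟩
  obtain ⟨m, hm, hPm⟩ := (h.isSylowIn_pPart_of_le ht htA
    ((pPart_le _ _).trans h.A_le)).exists_le_conj ht hSyl.isPGroup ((pPart_le _ _).trans hleM)
  have hcomm : ∀ s ∈ pPart P t, Commute (m * z * m⁻¹) s := by
    intro s hs
    have := (hzc _ (pPart_le _ _ (mem_conj_smul.1 (hPm hs)))).map (MulAut.conj m)
    simpa [mul_assoc] using this
  have hzM : m * z * m⁻¹ ∈ M := M.mul_mem (M.mul_mem hm (h.A_le hzA)) (M.inv_mem hm)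
  have hxP : x ∈ P := hPC ▸ ⟨Subgroup.mem_centralizer_singleton_iff.2 rfl, h.A_le hxA⟩
  have hzx : Commute (m * z * m⁻¹) x := by
    rcases eq_or_ne t p with rfl | htp
    · exact hcomm x (mem_pPart_of_mem hxP hxp)
    · exact h.commute ht hp htp htA hpA hzM (h.A_le hxA) (hzt.conj m) hxp
  refine ⟨m * z * m⁻¹, mem_pPart_of_mem (hPC ▸ ⟨Subgroup.mem_centralizer_singleton_iff.2 hzx.eq,
    hzM⟩) (hzt.conj m), Uniq.of_conj (g := m) ?_, hcomm⟩
  simpa [mul_assoc] using hzu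

/-- If c carries s to another element of S, then z and its conjugate by c both centralise the
result. Sylow's theorem in that centralizer gives k moving the conjugate into M, and since ⟨z⟩ pins
down M, ck ∈ M; ck and c have the same effect on s. -/
theorem exists_conj_eq_of_conj_mem {M C P S : Subgroup G} {t : ℕ} (ht : t.Prime)
    (hPC : P = C ⊓ M) (hS : IsPGroup t S) (hSP : S ≤ P) {z : G} (hz : z ∈ S)
    (hzu : Uniq M (Subgroup.zpowers z)) (hzc : ∀ s ∈ S, Commute z s) :
    ∀ s ∈ S, ∀ c ∈ C, c⁻¹ * s * c ∈ S → ∃ m ∈ P, m⁻¹ * s * m = c⁻¹ * s * c := by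
  intro s hs c hc hcs
  have hSC : S ≤ C := hSP.trans (hPC.le.trans inf_le_left)
  have hSM : S ≤ M := hSP.trans (hPC.le.trans inf_le_right)
  set D := C ⊓ Subgroup.centralizer {c⁻¹ * s * c} with hD
  have hzt : IsPElt t z := hS.isPElt hz
  have hzD : z ∈ D := ⟨hSC hz, Subgroup.mem_centralizer_singleton_iff.2 (hzc _ hcs)⟩
  have hzD' : c⁻¹ * z * c ∈ D := by
    refine ⟨C.mul_mem (C.mul_mem (C.inv_mem hc) (hSC hz)) hc,
      Subgroup.mem_centralizer_singleton_iff.2 ?_⟩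
    have := (hzc s hs).map (MulAut.conj c⁻¹)
    simpa [mul_assoc] using this.eq
  obtain ⟨R, hzR, hR⟩ := exists_isSylowIn_ge ht hzt.isPGroup_zpowers (Subgroup.zpowers_le.2 hzD)
  have hzM : Subgroup.zpowers z ≤ M := Subgroup.zpowers_le.2 (hSM hz)
  have hRM := hzu.le_of_isNilpotent hzM hzR (hR.isPGroup.isNilpotent_subgroup ht)
  obtain ⟨k, hk, hkR⟩ := hR.exists_conj_mem ht (hzt.conj' c) hzD'
  have hckM : c * k ∈ M := by
    refine hzu.mem hzM (Subgroup.zpowers_le.2 (mem_conj_smul.2 ?_))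
    have : (c * k)⁻¹ * z * (c * k) = k⁻¹ * (c⁻¹ * z * c) * k := by group
    rw [this]
    exact hRM hkR
  refine ⟨c * k, hPC ▸ ⟨C.mul_mem hc hk.1, hckM⟩, ?_⟩
  have h1 : (c * k)⁻¹ * s * (c * k) = k⁻¹ * ((c⁻¹ * s * c) * k) := by group
  rw [h1, ← Subgroup.mem_centralizer_singleton_iff.1 hk.2, inv_mul_cancel_left]

/-- Otherwise C = C(x) is not contained in M, while P = C ∩ M is a nilpotent subgroup carrying the
Sylow subgroups of C for the primes of A and controlling their fusion. Normal complements then yield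
a q-subgroup, q dividing |B|, whose normaliser contradicts `false_of_normalizer`. -/
theorem uniq_zpowers (h : SimpleFactorization A B M H) {p : ℕ} (hp : p.Prime) {x : G}
    (hxA : x ∈ A) (hxp : IsPElt p x) (hx1 : x ≠ 1) : Uniq M (Subgroup.zpowers x) := by
  have hpA := dvd_card_of_isPElt_mem hp hxA hxp hx1
  by_contra hxu
  set C := Subgroup.centralizer {x} with hC
  have hmemC : ∀ {g : G}, g ∈ C ↔ Commute g x := Subgroup.mem_centralizer_singleton_iff
  have hCM : ¬ C ≤ M := fun hle => hxu (h.uniq_of_forall_commute hp hpA hxp.isPGroup_zpowers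
    fun y hy => hle (hmemC.2 (hy x (Subgroup.mem_zpowers x))))
  obtain ⟨P, hPC⟩ : ∃ P, P = C ⊓ M := ⟨_, rfl⟩
  have hPle : P ≤ C := hPC.le.trans inf_le_left
  have hPM : P ≤ M := hPC.le.trans inf_le_right
  have hPdvd : ∀ t : ℕ, t.Prime → ∀ u ∈ P, IsPElt t u → u ≠ 1 → t ∣ Nat.card A := by
    intro t ht u hu hut hu1
    refine (h.dvd_of_isPElt ht hut hu1).resolve_right fun htB => hu1 ?_
    exact h.eq_one_of_not_uniq hp ht hpA htB hxp hx1 hxu (hPM hu) hut (hmemC.1 (hPle hu)).symm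
  have hPnil : Group.IsNilpotent P := by
    refine isNilpotent_of_forall_commute fun a b ha hb hab u hu v hv hua hvb => ?_
    rcases eq_or_ne u 1 with rfl | hu1
    · exact Commute.one_left _
    rcases eq_or_ne v 1 with rfl | hv1
    · exact Commute.one_right _
    exact h.commute ha hb hab (hPdvd a ha u hu hua hu1) (hPdvd b hb v hv hvb hv1) (hPM hu) (hPM hv)
      hua hvb
  have hSyl : ∀ t : ℕ, t.Prime → t ∣ Nat.card A → IsSylowIn t (pPart P t) C :=
    fun t ht htA => (h.exists_mem_pPart_centralizer hp hxA hxp hpA hPC hPnil ht htA).1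
  have hcore : ∀ t : ℕ, t.Prime → t ∣ Nat.card A → ¬ t ∣ Nat.card (coprimeClosure C t) := by
    intro t ht htA
    obtain ⟨hS, z, hz, hzu, hzc⟩ := h.exists_mem_pPart_centralizer hp hxA hxp hpA hPC hPnil ht htA
    exact not_dvd_card_coprimeClosure hPnil ht hS
      (exists_conj_eq_of_conj_mem ht hPC hS.isPGroup (pPart_le _ _) hz hzu hzc)
  obtain ⟨q, hq, hqB, hqC⟩ : ∃ q : ℕ, q.Prime ∧ q ∣ Nat.card B ∧ q ∣ Nat.card C := by
    by_contra! hno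
    refine hCM ((eq_of_forall_not_dvd_relIndex hPle fun t ht hd => ?_) ▸ hPM)
    have hdC := hd.trans (Subgroup.relIndex_dvd_card P C)
    rcases h.dvd_or_dvd ht hdC with htA | htB
    · exact (hSyl t ht htA).not_dvd_of_le (pPart_le _ _) hd
    · exact hno t ht htB hdC
  -- The intersection of the normal t-complements: a normal subgroup of C of order prime to |A|
  -- containing all elements of C of prime power order dividing |B|.
  set Y := C ⊓ ⨅ t : {t : ℕ // t.Prime ∧ t ∣ Nat.card A}, coprimeClosure C t with hY
  have hmemY : ∀ {y : G}, y ∈ Y ↔ y ∈ C ∧ ∀ t : ℕ, t.Prime → t ∣ Nat.card A →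
      y ∈ coprimeClosure C t := by
    intro y
    rw [hY, Subgroup.mem_inf, Subgroup.mem_iInf, Subtype.forall]
    simp only [and_imp]
  have hYC : Y ≤ C := inf_le_left
  have hYcard : ∀ t : ℕ, t.Prime → t ∣ Nat.card A → ¬ t ∣ Nat.card Y := fun t ht htA hd =>
    hcore t ht htA (hd.trans (Subgroup.card_dvd_of_le fun y hy => (hmemY.1 hy).2 t ht htA))
  have hYconj : ∀ c ∈ C, ∀ y ∈ Y, c * y * c⁻¹ ∈ Y := fun c hc y hy =>
    hmemY.2 ⟨C.mul_mem (C.mul_mem hc (hYC hy)) (C.inv_mem hc),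
      fun t ht htA => conj_mem_coprimeClosure hc ((hmemY.1 hy).2 t ht htA)⟩
  have hYmem : ∀ s : ℕ, s.Prime → s ∣ Nat.card B → ∀ y ∈ C, IsPElt s y → y ∈ Y :=
    fun s hs hsB y hy hys => hmemY.2 ⟨hy, fun t ht htA => hys.mem_coprimeClosure hy hs ht
      fun e => h.not_dvd ht htA (e ▸ hsB)⟩
  obtain ⟨Q, hQ⟩ := exists_isSylowIn hq C
  have hQ1 : Q ≠ ⊥ := by
    rintro rfl
    exact hQ.not_dvd (by rwa [Subgroup.relIndex_bot_left])
  have hQY : Q ≤ Y := fun y hy => hYmem q hq hqB y (hQ.le hy) (hQ.isPGroup.isPElt hy)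
  set N := C ⊓ Subgroup.normalizer (Q : Set G) with hN
  -- Frattini argument for the Sylow subgroup Q of Y.
  have hfrat : ∀ c ∈ C, ∃ y ∈ Y, ∃ n ∈ N, c = y * n := by
    intro c hc
    have hcQ : MulAut.conj c • Q ≤ Y := conj_smul_le_iff.2 fun y hy => hYconj c hc y (hQY hy)
    obtain ⟨y, hy, e⟩ := (hQ.mono hQY hYC).exists_eq_conj hq
      ((hQ.conj_smul_of_mem hc).mono hcQ hYC)
    exact ⟨y, hy, y⁻¹ * c, ⟨C.mul_mem (C.inv_mem (hYC hy)) hc, conj_smul_eq_iff_mem_normalizer.1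
      (by rw [conj_mul_smul, e, conj_inv_smul_conj_smul])⟩, by group⟩
  -- X is a Schur–Zassenhaus complement of Y ∩ N in N. Commutators of its elements of coprime prime
  -- power orders lie in every t-complement, hence in Y, so X is nilpotent.
  obtain ⟨X, hXN, hXnil, hXSyl⟩ : ∃ X, X ≤ N ∧ Group.IsNilpotent X ∧
      ∀ t : ℕ, t.Prime → t ∣ Nat.card A → IsSylowIn t (pPart X t) C := by
    have hYN : Y ⊓ N ≤ N := inf_le_right
    have hcop : (Nat.card ((Y ⊓ N).subgroupOf N)).Coprime ((Y ⊓ N).subgroupOf N).index := by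
      rw [Nat.card_congr (Subgroup.subgroupOfEquivOfLe hYN).toEquiv]
      refine Nat.coprime_of_dvd fun t ht d1 d2 => ?_
      have d2' : t ∣ (Y ⊓ N).relIndex N := d2
      rcases h.dvd_or_dvd ht d1 with htA | htB
      · exact hYcard t ht htA (d1.trans (Subgroup.card_dvd_of_le inf_le_left))
      · obtain ⟨R, hR⟩ := exists_isSylowIn ht N
        exact hR.not_dvd_of_le (le_inf (fun y hy => hYmem t ht htB y (hR.le hy).1
          (hR.isPGroup.isPElt hy)) hR.le) d2'
    have hnormal : ((Y ⊓ N).subgroupOf N).Normal := by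
      refine ⟨fun y hy n => ?_⟩
      rw [Subgroup.mem_subgroupOf] at hy ⊢
      exact ⟨hYconj n n.2.1 y hy.1, N.mul_mem (N.mul_mem n.2 y.2) (N.inv_mem n.2)⟩
    obtain ⟨X₀, hX₀⟩ := Subgroup.exists_right_complement'_of_coprime hcop
    set X := X₀.map N.subtype with hX
    have hXN : X ≤ N := Subgroup.map_subtype_le X₀
    have hdisj : ∀ w ∈ X, w ∈ Y → w = 1 := by
      rintro _ ⟨w, hw, rfl⟩ hwY
      have : w ∈ (Y ⊓ N).subgroupOf N ⊓ X₀ := ⟨Subgroup.mem_subgroupOf.2 ⟨hwY, w.2⟩, hw⟩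
      rw [hX₀.disjoint.eq_bot, Subgroup.mem_bot] at this
      rw [this]; rfl
    have hXidx : X.relIndex N = Nat.card (Y ⊓ N : Subgroup G) := by
      rw [Subgroup.relIndex, Subgroup.subgroupOf, Subgroup.comap_map_eq_self_of_injective
        N.subtype_injective, hX₀.index_eq_card,
        Nat.card_congr (Subgroup.subgroupOfEquivOfLe hYN).toEquiv]
    have hXn : Group.IsNilpotent X := by
      refine isNilpotent_of_forall_commute fun a b ha hb hab u hu v hv hua hvb => ?_
      have huC := (hXN hu).1
      have hvC := (hXN hv).1
      have hmem : u * v * u⁻¹ * v⁻¹ ∈ Y := by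
        refine hmemY.2 ⟨C.mul_mem (C.mul_mem (C.mul_mem huC hvC) (C.inv_mem huC)) (C.inv_mem hvC),
          fun t ht htA => ?_⟩
        rcases eq_or_ne a t with rfl | hat
        · have h1 := hvb.mem_coprimeClosure hvC hb ht hab.symm
          exact mul_mem (conj_mem_coprimeClosure huC h1) (inv_mem h1)
        · have h1 := hua.mem_coprimeClosure huC ha ht hat
          have := mul_mem h1 (conj_mem_coprimeClosure hvC (inv_mem h1))
          simpa [mul_assoc] using this
      have := hdisj _ (X.mul_mem (X.mul_mem (X.mul_mem hu hv) (X.inv_mem hu)) (X.inv_mem hv)) hmem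
      rw [mul_inv_eq_one, mul_inv_eq_iff_eq_mul] at this
      exact this
    refine ⟨X, hXN, hXn, fun t ht htA => ?_⟩
    refine ((hXn.isSylowIn_pPart ht).trans ht hXN ?_).trans ht inf_le_left ?_
    · rw [hXidx]
      exact fun hd => hYcard t ht htA (hd.trans (Subgroup.card_dvd_of_le inf_le_left))
    · rw [relIndex_of_forall_exists_mul hYC hfrat]
      exact fun hd => hYcard t ht htA (hd.trans (Subgroup.relIndex_dvd_card _ _))
  obtain ⟨c, hc, hcX⟩ := (hSyl p hp hpA).exists_eq_conj hp (hXSyl p hp hpA)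
  have hSM : pPart P p ≤ M := (pPart_le _ _).trans hPM
  have hSu : Uniq M (pPart P p) := by
    obtain ⟨-, z, hz, hzu, -⟩ :=
      h.exists_mem_pPart_centralizer hp hxA hxp hpA hPC hPnil hp hpA
    exact hzu.mono (Subgroup.zpowers_le.2 hz)
  -- Conjugated so that its p-part is that of P and lies in M; the other parts centralise this
  -- p-part, which pins down M, and so lie in M too.
  set X' := MulAut.conj c⁻¹ • X with hX'
  have hX'nil : Group.IsNilpotent X' := hXnil.conj_smul _
  have hX'p : pPart X' p = pPart P p := by
    rw [hX', pPart_conj_smul, hcX, conj_inv_smul_conj_smul]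
  have hX'Syl : ∀ t : ℕ, t.Prime → t ∣ Nat.card A → IsSylowIn t (pPart X' t) C := by
    intro t ht htA
    rw [hX', pPart_conj_smul]
    exact (hXSyl t ht htA).conj_smul_of_mem (C.inv_mem hc)
  have hX'Q : X' ≤ Subgroup.normalizer ((MulAut.conj c⁻¹ • Q : Subgroup G) : Set G) := by
    rw [← conj_smul_normalizer]
    exact conj_smul_le_conj_smul (hXN.trans inf_le_right)
  have hfull : ∀ t : ℕ, t.Prime → t ∣ Nat.card A → t ≠ p → IsSylowIn t (pPart X' t) ⊤ := by
    intro t ht htA htp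
    refine (hX'Syl t ht htA).trans ht le_top ((h.isSylowIn_pPart ht htA).not_dvd_of_le ?_)
    exact fun a ha => hmemC.2
      (h.nilA.commute_pPart ht hp htp ha (mem_pPart_of_mem hxA hxp))
  obtain ⟨t, ht, htp, htA⟩ := h.exists_prime_ne_A p
  refine h.false_of_normalizer hq hqB (hQ.isPGroup.conj_smul c⁻¹) ?_ ?_ ht htA
    (hfull t ht htA htp) ((pPart_le _ _).trans hX'Q)
  · intro h0
    have h1 := card_conj_smul c⁻¹ Q
    rw [h0, Subgroup.card_bot] at h1
    exact hQ1 (Subgroup.card_eq_one.1 h1.symm)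
  · intro t ht htA
    refine ⟨pPart X' t, (hX'Syl t ht htA).isPGroup, ?_, (pPart_le _ _).trans hX'Q, ?_⟩
    · rcases eq_or_ne t p with rfl | htp
      · exact hX'p ▸ hSM
      · refine le_trans (fun u hu => ?_) (hSu.normalizer_le hSM)
        exact mem_normalizer_of_forall_commute fun v hv =>
          hX'nil.commute_pPart ht hp htp hu (hX'p ▸ hv)
    · rcases eq_or_ne t p with rfl | htp
      · exact hX'p ▸ hSu
      · exact h.uniq_of_isSylowIn ht htA (hfull t ht htA htp)

/-- Choosing g outside M, A meets its conjugate by g trivially; so A has at least |A| cosets, while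
|G : A| divides |B|. -/
theorem card_le (h : SimpleFactorization A B M H) : Nat.card A ≤ Nat.card B := by
  obtain ⟨g, hg⟩ : ∃ g, g ∉ M := by
    by_contra! hall
    exact h.isCoatom_M.1 (top_le_iff.1 fun g _ => hall g)
  have hdisj : A ⊓ MulAut.conj g • A = ⊥ := by
    rw [eq_bot_iff]
    intro x hx
    refine mem_of_forall_isPElt_mem fun p hp y hy hyp => Subgroup.mem_bot.2 ?_
    by_contra hy1
    have hy' := Subgroup.zpowers_le.2 hx hy
    exact hg ((h.uniq_zpowers hp hy'.1 hyp hy1).mem (Subgroup.zpowers_le.2 (h.A_le hy'.1))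
      (Subgroup.zpowers_le.2 (conj_smul_le_conj_smul h.A_le hy'.2)))
  calc Nat.card A = A.relIndex (MulAut.conj g • A) := by
        rw [← Subgroup.inf_relIndex_right, hdisj, Subgroup.relIndex_bot_left, card_conj_smul]
    _ ≤ A.relIndex ⊤ := Subgroup.relIndex_le_of_le_right le_top (Nat.pos_of_dvd_of_pos
        h.relIndex_top_dvd Nat.card_pos).ne'
    _ ≤ Nat.card B := Nat.le_of_dvd Nat.card_pos h.relIndex_top_dvd

/-- There are no such factorizations. -/
theorem false (h : SimpleFactorization A B M H) : False := by
  obtain ⟨p, hp, -, hpA⟩ := h.exists_prime_ne_A 0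
  exact h.not_dvd hp hpA (le_antisymm h.card_le h.symm.card_le ▸ hpA)

end SimpleFactorization

end Contradiction

/-! ### Reduction to the simple coprime case: the Kegel–Wielandt theorem. -/

section KegelWielandt

universe u

/-- Groups of order less than `n` that are products of two nilpotent subgroups are solvable. -/
def SolvableProductsBelow (n : ℕ) : Prop :=
  ∀ (G : Type u) [Group G] [Finite G] (A B : Subgroup G), Nat.card G < n → Group.IsNilpotent A →
    Group.IsNilpotent B → (∀ x : G, ∃ a ∈ A, ∃ b ∈ B, x = a * b) → Group.IsSolvable G

namespace SolvableProductsBelow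

variable {G : Type u} [Group G] [Finite G] {A B : Subgroup G}

theorem quotient (ih : SolvableProductsBelow.{u} (Nat.card G)) (hA : Group.IsNilpotent A)
    (hB : Group.IsNilpotent B) (h : ∀ x : G, ∃ a ∈ A, ∃ b ∈ B, x = a * b) {N : Subgroup G}
    [N.Normal] (hN : N ≠ ⊥) : Group.IsSolvable (G ⧸ N) := by
  refine ih (G ⧸ N) (A.map (QuotientGroup.mk' N)) (B.map (QuotientGroup.mk' N)) ?_ ?_ ?_ ?_
  · have h1 : 1 < Nat.card N := Subgroup.one_lt_card_iff_ne_bot N |>.2 hN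
    rw [Subgroup.card_eq_card_quotient_mul_card_subgroup N]
    exact lt_mul_of_one_lt_right Nat.card_pos h1
  · exact Group.nilpotent_of_surjective ((QuotientGroup.mk' N).subgroupMap A)
      ((QuotientGroup.mk' N).subgroupMap_surjective A)
  · exact Group.nilpotent_of_surjective ((QuotientGroup.mk' N).subgroupMap B)
      ((QuotientGroup.mk' N).subgroupMap_surjective B)
  · intro x
    obtain ⟨x, rfl⟩ := QuotientGroup.mk'_surjective N x
    obtain ⟨a, ha, b, hb, rfl⟩ := h x
    exact ⟨_, Subgroup.mem_map_of_mem _ ha, _, Subgroup.mem_map_of_mem _ hb, map_mul _ _ _⟩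

theorem subgroup (ih : SolvableProductsBelow.{u} (Nat.card G)) {K L W : Subgroup G} (hK : K ≠ ⊤)
    (hL : Group.IsNilpotent L) (hW : Group.IsNilpotent W) (hLK : L ≤ K) (hWK : W ≤ K)
    (h : ∀ x ∈ K, ∃ a ∈ L, ∃ b ∈ W, x = a * b) : Group.IsSolvable K := by
  refine ih K (L.subgroupOf K) (W.subgroupOf K) ?_ ?_ ?_ ?_
  · exact lt_of_not_ge fun hge => hK (Subgroup.eq_top_of_le_card K hge)
  · exact Group.nilpotent_of_mulEquiv (Subgroup.subgroupOfEquivOfLe hLK).symm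
  · exact Group.nilpotent_of_mulEquiv (Subgroup.subgroupOfEquivOfLe hWK).symm
  · rintro ⟨x, hx⟩
    obtain ⟨a, ha, b, hb, rfl⟩ := h x hx
    exact ⟨⟨a, hLK ha⟩, ha, ⟨b, hWK hb⟩, hb, rfl⟩

theorem subgroup_of_coprime (ih : SolvableProductsBelow.{u} (Nat.card G)) {K L W : Subgroup G}
    (hK : K ≠ ⊤) (hLK : L ≤ K) (hWK : W ≤ K) (hL : Group.IsNilpotent L) (hW : Group.IsNilpotent W)
    (hco : (Nat.card L).Coprime (Nat.card W)) (hd : Nat.card K ∣ Nat.card L * Nat.card W) :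
    Group.IsSolvable K := by
  refine ih.subgroup hK hL hW hLK hWK fun x hx => exists_mul_of_relIndex_eq hWK ?_ hx
  have hc : Nat.card K = Nat.card L * Nat.card W := Nat.dvd_antisymm hd
    (hco.mul_dvd_of_dvd_of_dvd (Subgroup.card_dvd_of_le hLK) (Subgroup.card_dvd_of_le hWK))
  rw [← card_mul_relIndex hLK] at hc
  rw [Nat.eq_of_mul_eq_mul_left Nat.card_pos hc, ← Subgroup.inf_relIndex_right,
    (Subgroup.disjoint_of_coprime_natCard hco).eq_bot, Subgroup.relIndex_bot_left]

/-- A proper nontrivial normal subgroup makes `G` solvable. -/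
theorem of_normal (ih : SolvableProductsBelow.{u} (Nat.card G)) (hA : Group.IsNilpotent A)
    (hB : Group.IsNilpotent B) (h : ∀ x : G, ∃ a ∈ A, ∃ b ∈ B, x = a * b)
    (hco : (Nat.card A).Coprime (Nat.card B)) {N : Subgroup G} [N.Normal] (hN : N ≠ ⊥)
    (hN' : N ≠ ⊤) : Group.IsSolvable G := by
  have key : ∀ {A B : Subgroup G}, Group.IsNilpotent A → Group.IsNilpotent B →
      (∀ x : G, ∃ a ∈ A, ∃ b ∈ B, x = a * b) → A ⊔ N ≠ ⊤ → Group.IsSolvable N := by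
    intro A B hA hB h hAN
    have := ih.subgroup hAN hA (hB.mono (inf_le_left (b := A ⊔ N))) le_sup_left inf_le_right
      fun x hx => by
        obtain ⟨a, ha, b, hb, rfl⟩ := h x
        exact ⟨a, ha, b, ⟨hb, ((A ⊔ N).mul_mem_cancel_left (le_sup_left (b := N) ha)).1 hx⟩, rfl⟩
    exact Group.isSolvable_of_isSolvable_injective
      (Subgroup.inclusion_injective (le_sup_right (a := A) (b := N)))
  refine Group.isSolvable_iff_subgroup_quotient N |>.2 ⟨?_, ih.quotient hA hB h hN⟩
  -- If AN = BN = G, the index of N divides both |A| and |B|, so N = G. Otherwise N lies in a proper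
  -- subgroup AN or BN, which inherits a factorisation.
  by_cases hAN : A ⊔ N = ⊤
  · by_cases hBN : B ⊔ N = ⊤
    · refine absurd (Subgroup.index_eq_one.1 (Nat.eq_one_of_dvd_coprimes hco ?_ ?_)) hN'
      · rw [← Subgroup.relIndex_top_right, ← hAN, Subgroup.relIndex_sup_right]
        exact Subgroup.relIndex_dvd_card N A
      · rw [← Subgroup.relIndex_top_right, ← hBN, Subgroup.relIndex_sup_right]
        exact Subgroup.relIndex_dvd_card N B
    · exact key hB hA (forall_exists_mul_symm h) hBN
  · exact key hA hB h hAN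

end SolvableProductsBelow

variable {G : Type*} [Group G] [Finite G] {A B : Subgroup G}

/-- A nontrivial central element of B has class size dividing |A|; were |A| a prime power,
Burnside's theorem would make G abelian. -/
theorem exists_prime_ne_dvd_card [IsSimpleGroup G] (hns : ¬ Group.IsSolvable G)
    (hA : Group.IsNilpotent A) (hB : Group.IsNilpotent B)
    (h : ∀ x : G, ∃ a ∈ A, ∃ b ∈ B, x = a * b) (p : ℕ) :
    ∃ r : ℕ, r.Prime ∧ r ≠ p ∧ r ∣ Nat.card A := by
  by_contra! hno
  have hBnt : Nontrivial B := by
    rw [Subgroup.nontrivial_iff_ne_bot]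
    rintro rfl
    refine hns ?_
    have htop : A = ⊤ := (Subgroup.eq_top_iff' A).2 fun x => by
      obtain ⟨a, ha, b, hb, rfl⟩ := h x
      rwa [Subgroup.mem_bot.1 hb, mul_one]
    subst htop
    have := Group.isNilpotent_top.1 hA
    infer_instance
  have := hB
  have := (Subgroup.nontrivial_iff_ne_bot _).2 (Group.IsNilpotent.center_ne_bot (G := B))
  obtain ⟨y, hy⟩ := exists_ne (1 : Subgroup.center B)
  have hBC : B ≤ Subgroup.centralizer {(y : G)} := fun b hb =>
    Subgroup.mem_centralizer_singleton_iff.2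
      (congrArg Subtype.val (Subgroup.mem_center_iff.1 y.2 ⟨b, hb⟩))
  have hidx : (Subgroup.centralizer {(y : G)}).index ∣ Nat.card A := by
    refine (Subgroup.index_dvd_of_le hBC).trans ?_
    rw [← Subgroup.relIndex_top_right, relIndex_of_forall_exists_mul le_top fun x _ => h x]
    exact Subgroup.relIndex_dvd_card B A
  have hy1 : (y : G) ≠ 1 := fun e => hy (Subtype.ext (Subtype.ext e))
  have hcard : ∃ (q k : ℕ), q.Prime ∧ Nat.card A = q ^ k := by
    by_cases hp : p.Prime
    · exact ⟨p, _, hp, Nat.eq_prime_pow_of_unique_prime_dvd Nat.card_pos.ne' fun {d} hd hdA =>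
        by_contra fun hne => hno d hd hne hdA⟩
    · refine ⟨2, 0, Nat.prime_two, by_contra fun h1 => ?_⟩
      obtain ⟨d, hd, hdA⟩ := Nat.exists_prime_and_dvd h1
      exact hno d hd (fun e => hp (e ▸ hd)) hdA
  obtain ⟨q, k, hq, hk⟩ := hcard
  obtain ⟨m, -, hm⟩ := (Nat.dvd_prime_pow hq).1 (hk ▸ hidx)
  exact hns (Group.isSolvable_of_comm
    (commute_of_card_isConj_eq_prime_pow hq hy1 ((card_isConj _).trans hm)))

theorem isSolvable_of_forall_exists_mul_of_below {G : Type u} [Group G] [Finite G]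
    {A B : Subgroup G} (ih : SolvableProductsBelow.{u} (Nat.card G)) (hA : Group.IsNilpotent A)
    (hB : Group.IsNilpotent B) (h : ∀ x : G, ∃ a ∈ A, ∃ b ∈ B, x = a * b) : Group.IsSolvable G := by
  by_cases hF : fittingSubgroup G = ⊥
  swap
  · have := fittingSubgroup_normal (G := G)
    have := isNilpotent_fittingSubgroup (G := G)
    exact (Group.isSolvable_iff_subgroup_quotient (fittingSubgroup G)).2
      ⟨inferInstance, ih.quotient hA hB h hF⟩
  by_cases hco : (Nat.card A).Coprime (Nat.card B)
  swap
  · obtain ⟨p, hp, hpA, hpB⟩ := Nat.Prime.not_coprime_iff_dvd.1 hco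
    obtain ⟨M, N, hM, hN, hM1, hN1, hMN⟩ := exists_normal_inf_eq_bot hA hB h hp hpA hpB hF
    have := ih.quotient hA hB h hM1
    have := ih.quotient hA hB h hN1
    refine Group.isSolvable_of_isSolvable_injective
      (f := (QuotientGroup.mk' M).prod (QuotientGroup.mk' N)) ?_
    rw [← MonoidHom.ker_eq_bot_iff, MonoidHom.ker_prod, QuotientGroup.ker_mk',
      QuotientGroup.ker_mk', hMN]
  by_contra hns
  have hnt : Nontrivial G := not_subsingleton_iff_nontrivial.1 fun _ => hns inferInstance
  have hsimple : IsSimpleGroup G := ⟨fun N hN => by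
    by_contra! hne
    exact hns (ih.of_normal hA hB h hco hne.1 hne.2)⟩
  have hne : ∀ {A : Subgroup G}, Group.IsNilpotent A → ∃ M, IsCoatom M ∧ A ≤ M := fun {A} hA =>
    (IsCoatomic.eq_top_or_exists_le_coatom A).resolve_left fun htop => hns (by
      subst htop
      have := Group.isNilpotent_top.1 hA
      infer_instance)
  obtain ⟨M, hM, hAM⟩ := hne hA
  obtain ⟨H, hH, hBH⟩ := hne hB
  exact SimpleFactorization.false (A := A) (B := B) (M := M) (H := H)
    { isSimpleGroup := hsimple
      not_isSolvable := hns
      nilA := hA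
      nilB := hB
      coprime := hco
      exists_mul := h
      isSolvable := fun K L W hK hLK hWK => ih.subgroup_of_coprime hK hLK hWK
      exists_prime_ne_A := exists_prime_ne_dvd_card hns hA hB h
      exists_prime_ne_B := exists_prime_ne_dvd_card hns hB hA (forall_exists_mul_symm h)
      isCoatom_M := hM
      A_le := hAM
      isCoatom_H := hH
      B_le := hBH }

theorem solvableProductsBelow (n : ℕ) : SolvableProductsBelow.{u} n := by
  induction n with
  | zero => exact fun G _ _ A B hn => absurd hn (Nat.not_lt_zero _)
  | succ n ih =>
    intro G _ _ A B hn hA hB h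
    exact isSolvable_of_forall_exists_mul_of_below
      (fun G' _ _ A' B' hlt => ih G' A' B' (hlt.trans_le (Nat.lt_succ_iff.1 hn))) hA hB h

/-- The Kegel–Wielandt theorem: a finite group that is the product of two nilpotent subgroups is
solvable. -/
theorem isSolvable_of_forall_exists_mul (hA : Group.IsNilpotent A) (hB : Group.IsNilpotent B)
    (h : ∀ x : G, ∃ a ∈ A, ∃ b ∈ B, x = a * b) : Group.IsSolvable G :=
  isSolvable_of_forall_exists_mul_of_below (solvableProductsBelow _) hA hB h

end KegelWielandt

/-! ### Nilpotency of G. -/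

section Main

variable {G : Type*} [Group G] [Finite G]

/-- Both A and F lie in the Fitting subgroup of the group they generate, the first as a subnormal
nilpotent subgroup, the second as a normal one. -/
theorem isNilpotent_sup_fittingSubgroup {A : Subgroup G} (hA : Group.IsNilpotent A)
    (h : IsRSubnormal (fittingSubgroup G) A) :
    Group.IsNilpotent (A ⊔ fittingSubgroup G : Subgroup G) := by
  have hFn := fittingSubgroup_normal (G := G)
  set F := fittingSubgroup G
  have h1 : A.subgroupOf (A ⊔ F) ≤ fittingSubgroup (A ⊔ F : Subgroup G) :=
    Subgroup.IsSubnormal.le_fittingSubgroup h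
      (Group.nilpotent_of_mulEquiv (Subgroup.subgroupOfEquivOfLe le_sup_left).symm)
  have hF : Group.IsNilpotent F := isNilpotent_fittingSubgroup
  have h2 : F.subgroupOf (A ⊔ F) ≤ fittingSubgroup (A ⊔ F : Subgroup G) :=
    le_fittingSubgroup inferInstance
      (Group.nilpotent_of_mulEquiv (Subgroup.subgroupOfEquivOfLe le_sup_right).symm)
  have h3 : fittingSubgroup (A ⊔ F : Subgroup G) = ⊤ := by
    rw [eq_top_iff, ← Subgroup.subgroupOf_self,
      Subgroup.subgroupOf_sup (le_sup_left (b := F)) le_sup_right]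
    exact sup_le h1 h2
  have := isNilpotent_fittingSubgroup (G := (A ⊔ F : Subgroup G))
  rw [h3] at this
  exact Group.isNilpotent_top.1 this

/-- If the factors generate nilpotent subgroups together with the Fitting subgroup, then the
`p`-elements of `G` centralise the `p'`-part of the Fitting subgroup. -/
theorem commute_of_mem_fittingSubgroup {A B : Subgroup G}
    (hA : Group.IsNilpotent (A ⊔ fittingSubgroup G : Subgroup G))
    (hB : Group.IsNilpotent (B ⊔ fittingSubgroup G : Subgroup G))
    (h : ∀ x : G, ∃ a ∈ A, ∃ b ∈ B, x = a * b) {p t : ℕ} (hp : p.Prime) (ht : t.Prime)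
    (htp : t ≠ p) {x f : G} (hf : f ∈ fittingSubgroup G) (hx : IsPElt p x) (hft : IsPElt t f) :
    Commute x f := by
  have hAn : Group.IsNilpotent A := hA.mono le_sup_left
  have hBn : Group.IsNilpotent B := hB.mono le_sup_left
  -- Up to conjugacy x = ab with p-elements a ∈ A and b ∈ B, each centralising the conjugated f
  -- inside a nilpotent group.
  obtain ⟨P, hP, -, -, hmul⟩ := exists_isSylowIn_forall_exists_mul hAn hBn h hp
  obtain ⟨k, -, hk⟩ := hP.exists_conj_mem hp hx (Subgroup.mem_top x)
  have hf' : k⁻¹ * f * k ∈ fittingSubgroup G := by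
    simpa using fittingSubgroup_normal.conj_mem f hf k⁻¹
  obtain ⟨a, ha, b, hb, e⟩ := hmul _ hk
  rw [hAn.mem_pPart_iff hp] at ha
  rw [hBn.mem_pPart_iff hp] at hb
  have hc : Commute (k⁻¹ * x * k) (k⁻¹ * f * k) := by
    rw [e]
    exact (hA.commute_of_isPElt hp ht htp.symm (le_sup_left (b := fittingSubgroup G) ha.1)
      (le_sup_right (a := A) hf') ha.2 (hft.conj' k)).mul_left
      (hB.commute_of_isPElt hp ht htp.symm (le_sup_left (b := fittingSubgroup G) hb.1)
      (le_sup_right (a := B) hf') hb.2 (hft.conj' k))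
  simpa [mul_assoc] using hc.map (MulAut.conj k)

end Main

theorem theorem4p5 {G : Type*} [Group G] [Finite G] (A B : Subgroup G)
    (hAnil : Group.IsNilpotent A) (hBnil : Group.IsNilpotent B)
    (hA : IsRSubnormal (fittingSubgroup G) A) (hB : IsRSubnormal (fittingSubgroup G) B)
    (hAB : (A : Set G) * (B : Set G) = Set.univ) :
    Group.IsNilpotent G := by
  have h : ∀ x : G, ∃ a ∈ A, ∃ b ∈ B, x = a * b := fun x => by
    obtain ⟨a, ha, b, hb, e⟩ := Set.mem_mul.1 (hAB ▸ Set.mem_univ x)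
    exact ⟨a, ha, b, hb, e.symm⟩
  have := isSolvable_of_forall_exists_mul hAnil hBnil h
  have hA' := isNilpotent_sup_fittingSubgroup hAnil hA
  have hB' := isNilpotent_sup_fittingSubgroup hBnil hB
  refine Group.isNilpotent_top.1 (isNilpotent_of_forall_commute
    fun p r hp hr hpr x hx y hy hxp hyr => ?_)
  exact isFit_fittingSubgroup.commute hp hr hpr
    (fun t ht htp x _ f hf hxp hft => commute_of_mem_fittingSubgroup hA' hB' h hp ht htp hf hxp hft)
    (fun t ht htr x _ f hf hxr hft => commute_of_mem_fittingSubgroup hA' hB' h hr ht htr hf hxr hft)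
    hx hy hxp hyr
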